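/- Let $f:\mathbb{R}^d\times\mathbb{R}^r\to\mathbb{R}^d$ be of class $C^\infty$, let $\Omega\subset\mathbb{R}^d\times\mathbb{R}^r$ be open, and let $U=\Omega_{\mathbb{R}^d}\subset\mathbb{R}^d$ be its projection onto the first factor. A \emph{feedback} on $\Omega$ is a continuous map $\alpha:U\to\mathbb{R}^r$ with $(x,\alpha(x))\in\Omega$ for all $x\in U$; it is smooth if $\alpha$ is $C^\infty$. For feedbacks $\alpha_1,\alpha_2$ on $\Omega$ put $\delta f_{\alpha_1,\alpha_2}(x)=f(x,\alpha_1(x))-f(x,\alpha_2(x))$, a continuous vector field on $U$. A continuous vector field $X$ on $U$ \emph{has a flow} if for each $x_0\in U$ the Cauchy problem $\dot x=X(x)$, $x(0)=x_0$, has a unique solution, defined for $|t|<\varepsilon(x_0)$, $\varepsilon(x_0)>0$; its value at time $t$ is denoted $X_t(x_0)$ wherever the solution exists in $U$. Let $$\mathcal F''=\{\delta f_{\alpha_1,\alpha_2}:\alpha_1,\alpha_2\text{ feedbacks on }\Omega,\ \delta f_{\alpha_1,\alpha_2}\text{ has a flow}\},\qquad \mathcal F=\{\delta f_{\alpha_1,\alpha_2}:\alpha_1,\alpha_2\text{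 smooth feedbacks on }\Omega\}.$$ For a family $\mathcal G$ of vector fields on $U$ having a flow and $m\in U$, the \emph{orbit} $\mathcal O_{\mathcal G,m}$ is the union of the images of all the maps $$F:(t_1,\dots,t_N)\mapsto X^1_{t_1}(X^2_{t_2}(\cdots X^N_{t_N}(m)\cdots)),\qquad N\ge 1,\ X^1,\dots,X^N\in\mathcal G,\tag{1}$$ each being defined on the set $\mathrm{dom}(F)\subset\mathbb{R}^N$ of those $(t_1,\dots,t_N)$ for which the successive integral curves exist in $U$. The \emph{orbit topology} is the finest topology on $\mathcal O_{\mathcal G,m}$ for which all these maps are continuous. $P_{\mathcal G}$ denotes the set of all push-forwards $\varphi_\star X^0$ of members $X^0$ of $\mathcal G$ through local diffeomorphisms $\varphi$ of the form $X^1_{t_1}\circ\cdots\circ X^N_{t_N}$, $X^j\in\mathcal G$ (when the $X^j$ are not smooth: through those restrictions of such compositions that are $C^1$ diffeomorphisms between open subsets of $U$), and $P_{\mathcal G}(x)\subset\mathbb{R}^d$ is the linear span of the values at $x$ of the members of $P_{\mathcal G}$ that are defined near $x$. \textbf{Proposition.} For every $m\in U$, $\mathcal O_{\mathcal F'',m}=\mathcal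 O_{\mathcal F,m}$ as sets, and the orbit topologies defined by $\mathcal F''$ and by $\mathcal F$ coincide. In particular, if $\Omega$ admits at least one feedback, the conclusions of Sussmann's orbit theorem hold for $\mathcal O=\mathcal O_{\mathcal F'',m}$ and the family $\mathcal F''$ on $U$: (i) $\mathcal O$ with the orbit topology is connected, Hausdorff and second countable, and has a unique differential structure compatible with this topology that makes it a smooth immersed submanifold of $U$; for this structure the maps (1) with $X^1,\dots,X^N\in\mathcal F''$ smooth are smooth as maps into $\mathcal O$. (ii) The tangent space to $\mathcal O$ at $x\in\mathcal O$ is $P_{\mathcal F''}(x)$, and $P_{\mathcal F''}(x)=P_{\mathcal F}(x)$. (iii) Let $q=\dim\mathcal O$. There are an open neighborhood $W\subset U$ of $m$, a number $\eta>0$, and smooth coordinates $\xi:W\to(-\eta,\eta)^d$ (a $C^\infty$ diffeomorphism onto the cube) with $\xi(m)=0$ such that: (a) in these coordinates $W\cap\mathcal O=(-\eta,\eta)^q\times T$ for some $T\subset(-\eta,\eta)^{d-q}$ containing the origin, and the orbit topology induces on $W\cap\mathcal O$ the product of the Euclidean topology on $(-\eta,\eta)^q$ and the discrete topology on $T$;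 (b) if $\gamma:[t_1,t_2]\to W\cap\mathcal O$ is an integral curve of a member of $P_{\mathcal F''}$ (staying in its domain), then $\xi_i\circ\gamma$ is constant for $q<i\le d$; (c) at each $p\in W\cap\mathcal O$ the tangent space to $\mathcal O$ is spanned by $\partial/\partial\xi_1,\dots,\partial/\partial\xi_q$; (d) at each $p\in W$ the vectors $\partial/\partial\xi_1,\dots,\partial/\partial\xi_q$ are tangent to the orbit of $\mathcal F''$ through $p$. -/

import Mathlib

open Set Topology
open scoped ContDiff Manifold

noncomputable section

namespace FeedbackOrbit

/-- The Euclidean space `ℝⁿ`. -/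
abbrev Euc (n : ℕ) : Type := EuclideanSpace ℝ (Fin n)

/-! ### Vector fields on a subset of `ℝᵈ`, their integral curves and flows

A vector field on `U ⊆ ℝᵈ` is represented by a map `Euc d → Euc d`; only its values on `U` are ever
used. -/

section Flows

variable {d : ℕ}

/-- `γ` is, on the interval `I`, an integral curve of the vector field `X` defined on `U`:
it stays in `U` and satisfies `γ' = X ∘ γ` (one-sided derivatives at the end points of `I`). -/
def IsIntegralCurve (U : Set (Euc d)) (X : Euc d → Euc d) (I : Set ℝ) (γ : ℝ → Euc d) : Prop :=
  ∀ t ∈ I, γ t ∈ U ∧ HasDerivWithinAt γ (X (γ t)) I t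

/-- `X` has a flow on `U`: for every `x₀ ∈ U` the Cauchy problem `x' = X(x)`, `x(0) = x₀` has a
unique solution, defined for `|t| < ε`, with `ε > 0` depending on `x₀`. -/
def HasFlow (U : Set (Euc d)) (X : Euc d → Euc d) : Prop :=
  ∀ x₀ ∈ U, ∃ ε : ℝ, 0 < ε ∧ ∃ γ : ℝ → Euc d,
    γ 0 = x₀ ∧ IsIntegralCurve U X (Ioo (-ε) ε) γ ∧
    ∀ δ : ℝ, 0 < δ → δ ≤ ε → ∀ η : ℝ → Euc d,
      η 0 = x₀ → IsIntegralCurve U X (Ioo (-δ) δ) η → EqOn η γ (Ioo (-δ) δ)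

/-- `X_t(x)` is defined and equal to `y`: some integral curve of `X` in `U` defined on `[0, t]`
(on `[t, 0]` if `t < 0`) goes from `x` at time `0` to `y` at time `t`. When `X` has a flow, `y` is
determined by `x` and `t`. -/
def FlowsTo (U : Set (Euc d)) (X : Euc d → Euc d) (t : ℝ) (x y : Euc d) : Prop :=
  ∃ γ : ℝ → Euc d, γ 0 = x ∧ γ t = y ∧ IsIntegralCurve U X (uIcc 0 t) γ

/-- `X¹_{t₁}(X²_{t₂}(⋯ X^N_{t_N}(x) ⋯))` is defined and equal to `y`; the `p j` are the successive
intermediate points. -/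
def ConcatTo (U : Set (Euc d)) {N : ℕ} (X : Fin N → Euc d → Euc d) (t : Fin N → ℝ)
    (x y : Euc d) : Prop :=
  ∃ p : Fin (N + 1) → Euc d, p (Fin.last N) = x ∧ p 0 = y ∧
    ∀ j : Fin N, FlowsTo U (X j) (t j) (p j.succ) (p j.castSucc)

/-- The domain of `F : (t₁, …, t_N) ↦ X¹_{t₁}(⋯ X^N_{t_N}(m) ⋯)`. -/
def concatDom (U : Set (Euc d)) {N : ℕ} (X : Fin N → Euc d → Euc d) (m : Euc d) :
    Set (Fin N → ℝ) :=
  {t | ∃ y, ConcatTo U X t m y}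

end Flows

/-! ### Orbits -/

section Orbits

variable {d : ℕ}

/-- The orbit through `m` of the family `𝓕` of vector fields on `U`: the union of the images of
the maps `(t₁, …, t_N) ↦ X¹_{t₁}(⋯ X^N_{t_N}(m) ⋯)`, `N ≥ 1`, `Xʲ ∈ 𝓕`. -/
def orbit (U : Set (Euc d)) (𝓕 : Set (Euc d → Euc d)) (m : Euc d) : Set (Euc d) :=
  {y | ∃ N : ℕ, 0 < N ∧ ∃ X : Fin N → Euc d → Euc d, (∀ j, X j ∈ 𝓕) ∧
    ∃ t : Fin N → ℝ, ConcatTo U X t m y}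

/-- The orbit as a type of its own; it carries the orbit topology, not the induced one. -/
def OrbitSpace (U : Set (Euc d)) (𝓕 : Set (Euc d → Euc d)) (m : Euc d) : Type :=
  {y : Euc d // y ∈ orbit U 𝓕 m}

/-- The inclusion of the orbit in `ℝᵈ`. -/
def OrbitSpace.incl {U : Set (Euc d)} {𝓕 : Set (Euc d → Euc d)} {m : Euc d}
    (p : OrbitSpace U 𝓕 m) : Euc d :=
  Subtype.val p

/-- The map `F : dom(F) → orbit`, `(t₁, …, t_N) ↦ X¹_{t₁}(⋯ X^N_{t_N}(m) ⋯)`. -/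
def concatMap (U : Set (Euc d)) (𝓕 : Set (Euc d → Euc d)) (m : Euc d) {N : ℕ} (hN : 0 < N)
    (X : Fin N → Euc d → Euc d) (hX : ∀ j, X j ∈ 𝓕) (t : concatDom U X m) : OrbitSpace U 𝓕 m :=
  ⟨t.2.choose, N, hN, X, hX, t.1, t.2.choose_spec⟩

/-- The orbit topology: the finest one for which all the maps `F : dom(F) → orbit` are continuous.
(In Mathlib's order on topologies, the supremum is the finest topology coarser than all the
given ones.) -/
instance OrbitSpace.instTopologicalSpace (U : Set (Euc d)) (𝓕 : Set (Euc d → Euc d))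
    (m : Euc d) : TopologicalSpace (OrbitSpace U 𝓕 m) :=
  ⨆ (N : ℕ) (hN : 0 < N) (X : Fin N → Euc d → Euc d) (hX : ∀ j, X j ∈ 𝓕),
    TopologicalSpace.coinduced (concatMap U 𝓕 m hN X hX) inferInstance

/-- `Y`, with domain `D`, is the push-forward `(X¹_{t₁} ∘ ⋯ ∘ X^N_{t_N})_⋆ X⁰`, with
`X⁰, …, X^N ∈ 𝓕`, through a local diffeomorphism `φ` of the form `X¹_{t₁} ∘ ⋯ ∘ X^N_{t_N}`.
If the members of `𝓕` are smooth, the composed flow is a diffeomorphism on the whole of its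
domain; in general only those restrictions of it which are `C¹` diffeomorphisms between
open sets are considered. -/
def IsPushforward (U : Set (Euc d)) (𝓕 : Set (Euc d → Euc d)) (D : Set (Euc d))
    (Y : Euc d → Euc d) : Prop :=
  ∃ X₀ ∈ 𝓕, ∃ N : ℕ, 0 < N ∧ ∃ X : Fin N → Euc d → Euc d, (∀ j, X j ∈ 𝓕) ∧
    ∃ (t : Fin N → ℝ) (φ : OpenPartialHomeomorph (Euc d) (Euc d)),
      (∀ x ∈ φ.source, ConcatTo U X t x (φ x)) ∧
      φ.source ⊆ U ∧
      ContDiffOn ℝ 1 φ φ.source ∧ ContDiffOn ℝ 1 φ.symm φ.target ∧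
      D = φ.target ∧
      ∀ x ∈ φ.source, Y (φ x) = fderiv ℝ φ x (X₀ x)

/-- `P_𝓕(x)`: the span of the values at `x` of all the `Y ∈ P_𝓕` defined near `x`. -/
def pushforwardSpan (U : Set (Euc d)) (𝓕 : Set (Euc d → Euc d)) (x : Euc d) :
    Submodule ℝ (Euc d) :=
  Submodule.span ℝ {v | ∃ (D : Set (Euc d)) (Y : Euc d → Euc d),
    IsPushforward U 𝓕 D Y ∧ x ∈ D ∧ v = Y x}

end Orbits

/-! ### Immersed submanifolds -/

section Immersed

/-- A differential structure on the topological space `M`, of dimension `dim` and compatible with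
its topology, for which `ι : M → ℝᵈ` is a smooth immersion. -/
structure ImmersedStructure {d : ℕ} {M : Type} [TopologicalSpace M] (ι : M → Euc d) where
  /-- the dimension of the manifold -/
  dim : ℕ
  /-- the charts -/
  [charted : ChartedSpace (Euc dim) M]
  isManifold : IsManifold (𝓡 dim) ∞ M
  contMDiff : ContMDiff (𝓡 dim) (𝓡 d) ∞ ι
  injective_mfderiv : ∀ p : M, Function.Injective (mfderiv (𝓡 dim) (𝓡 d) ι p)

namespace ImmersedStructure

variable {d : ℕ} {M : Type} [TopologicalSpace M] {ι : M → Euc d}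

/-- The tangent space at `p`, as a linear subspace of `ℝᵈ`. -/
def tangent (S : ImmersedStructure ι) (p : M) : Submodule ℝ (Euc d) :=
  letI := S.charted
  LinearMap.range
    (show Euc S.dim →ₗ[ℝ] Euc d from (mfderiv (𝓡 S.dim) (𝓡 d) ι p).toLinearMap)

/-- Two differential structures are the same: the identity is a diffeomorphism between them. -/
def Same (S S' : ImmersedStructure ι) : Prop :=
  S.dim = S'.dim ∧
  @ContMDiff ℝ _ _ _ _ _ _ (𝓡 S.dim) M _ S.charted _ _ _ _ _ (𝓡 S'.dim) M _ S'.charted ∞ id ∧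
  @ContMDiff ℝ _ _ _ _ _ _ (𝓡 S'.dim) M _ S'.charted _ _ _ _ _ (𝓡 S.dim) M _ S.charted ∞ id

/-- The map `g`, defined on the subset `A` of `ℝᴺ` with values in `M`, is smooth for `S`. -/
def SmoothOn (S : ImmersedStructure ι) {N : ℕ} (A : Set (Fin N → ℝ)) (g : A → M) : Prop :=
  letI := S.charted
  ∃ G : (Fin N → ℝ) → M, (∀ t : A, G t = g t) ∧
    ContMDiffOn 𝓘(ℝ, Fin N → ℝ) (𝓡 S.dim) ∞ G A

end ImmersedStructure

end Immersed

/-! ### The conclusions of the orbit theorem -/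

section OrbitTheorem

variable {d : ℕ}

/-- The coordinates of index `< q` of a vector of `ℝᵈ`. -/
def headCoord (q : ℕ) (v : Euc d) : {i : Fin d // i.1 < q} → ℝ := fun i => v i.1

/-- The coordinates of index `≥ q` of a vector of `ℝᵈ`. -/
def tailCoord (q : ℕ) (v : Euc d) : {i : Fin d // q ≤ i.1} → ℝ := fun i => v i.1

/-- The vector field `∂/∂ξᵢ`, evaluated at `x`, of local coordinates `ξ`. -/
def coordField (ξ : OpenPartialHomeomorph (Euc d) (Euc d)) (i : Fin d) (x : Euc d) : Euc d :=
  fderiv ℝ ξ.symm (ξ x) (EuclideanSpace.single i 1)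

/-- The local coordinates `ξ` onto the cube `(-η, η)ᵈ`, defined on the open set `W = ξ.source`, are
adapted to the orbit of `𝓕` through `m`, which is endowed with the immersed structure `S` of
dimension `q`. -/
structure IsAdaptedChart (U : Set (Euc d)) (𝓕 : Set (Euc d → Euc d)) (m : Euc d)
    (S : ImmersedStructure (OrbitSpace.incl (U := U) (𝓕 := 𝓕) (m := m)))
    (ξ : OpenPartialHomeomorph (Euc d) (Euc d)) (η : ℝ) : Prop where
  source_subset : ξ.source ⊆ U
  mem_source : m ∈ ξ.source
  map_base : ξ m = 0
  pos : 0 < η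
  target_eq : ξ.target = {v | ∀ i, v i ∈ Ioo (-η) η}
  contDiffOn : ContDiffOn ℝ ∞ ξ ξ.source
  contDiffOn_symm : ContDiffOn ℝ ∞ ξ.symm ξ.target
  /-- In the coordinates `ξ`, the set `W ∩ 𝓞` is a product `(-η, η)^q × T` with `0 ∈ T`, and the
  orbit topology on it is the product topology, `T` being discrete. -/
  product : ∃ T : Set ({i : Fin d // S.dim ≤ i.1} → ℝ),
    (∀ a ∈ T, ∀ i, a i ∈ Ioo (-η) η) ∧ 0 ∈ T ∧
    (∀ x ∈ ξ.source, x ∈ orbit U 𝓕 m ↔ tailCoord S.dim (ξ x) ∈ T) ∧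
    @IsInducing {p : OrbitSpace U 𝓕 m // p.incl ∈ ξ.source}
      (({i : Fin d // i.1 < S.dim} → ℝ) × ({i : Fin d // S.dim ≤ i.1} → ℝ))
      _ (@instTopologicalSpaceProd _ _ _ ⊥)
      (fun p => (headCoord S.dim (ξ p.1.incl), tailCoord S.dim (ξ p.1.incl)))
  /-- The coordinates of index `≥ q` are constant along the integral curves in `W ∩ 𝓞` of the
  members of `P_𝓕`. -/
  constant : ∀ (D : Set (Euc d)) (Y : Euc d → Euc d), IsPushforward U 𝓕 D Y →
    ∀ (t₁ t₂ : ℝ) (γ : ℝ → Euc d), IsIntegralCurve D Y (Icc t₁ t₂) γ →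
      (∀ t ∈ Icc t₁ t₂, γ t ∈ ξ.source ∩ orbit U 𝓕 m) →
      ∀ i : Fin d, S.dim ≤ i.1 →
        ∀ s ∈ Icc t₁ t₂, ∀ t ∈ Icc t₁ t₂, ξ (γ s) i = ξ (γ t) i
  /-- On `W ∩ 𝓞` the tangent space to the orbit is spanned by the `q` first coordinate fields. -/
  tangent_eq : ∀ p : OrbitSpace U 𝓕 m, p.incl ∈ ξ.source →
    S.tangent p = Submodule.span ℝ {v | ∃ i : Fin d, i.1 < S.dim ∧ v = coordField ξ i p.incl}
  /-- At any `x ∈ W` the `q` first coordinate fields are tangent to the orbit of `𝓕` through `x`. -/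
  tangent_orbit : ∀ x ∈ ξ.source,
    ∃ (Sx : ImmersedStructure (OrbitSpace.incl (U := U) (𝓕 := 𝓕) (m := x)))
      (p : OrbitSpace U 𝓕 x), p.incl = x ∧
        ∀ i : Fin d, i.1 < S.dim → coordField ξ i x ∈ Sx.tangent p

/-- The conclusions of Sussmann's orbit theorem for the orbit through `m` of the family `𝓕` of
vector fields on `U`. The smoothness of the maps `F` is asserted when the vector fields they are
built from are smooth (no restriction if `𝓕` is a family of smooth vector fields). -/
def OrbitTheoremHolds (U : Set (Euc d)) (𝓕 : Set (Euc d → Euc d)) (m : Euc d) : Prop :=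
  T2Space (OrbitSpace U 𝓕 m) ∧ SecondCountableTopology (OrbitSpace U 𝓕 m) ∧
  ConnectedSpace (OrbitSpace U 𝓕 m) ∧
  ∃ S : ImmersedStructure (OrbitSpace.incl (U := U) (𝓕 := 𝓕) (m := m)),
    (∀ S' : ImmersedStructure (OrbitSpace.incl (U := U) (𝓕 := 𝓕) (m := m)), S'.Same S) ∧
    (∀ (N : ℕ) (hN : 0 < N) (X : Fin N → Euc d → Euc d) (hX : ∀ j, X j ∈ 𝓕),
      (∀ j, ContDiffOn ℝ ∞ (X j) U) →
        S.SmoothOn (concatDom U X m) (concatMap U 𝓕 m hN X hX)) ∧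
    (∀ p : OrbitSpace U 𝓕 m, S.tangent p = pushforwardSpan U 𝓕 p.incl) ∧
    ∃ (ξ : OpenPartialHomeomorph (Euc d) (Euc d)) (η : ℝ), IsAdaptedChart U 𝓕 m S ξ η

end OrbitTheorem

/-! ### Feedbacks and difference vector fields -/

section Feedbacks

variable {d r : ℕ}

/-- The projection `Ω_{ℝᵈ}` of `Ω ⊆ ℝᵈ × ℝʳ` onto the first factor. -/
def stateProj (Ω : Set (Euc d × Euc r)) : Set (Euc d) := Prod.fst '' Ω

/-- `α` is a feedback on `Ω`: a continuous map `Ω_{ℝᵈ} → ℝʳ` whose graph lies in `Ω`. -/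
def IsFeedback (Ω : Set (Euc d × Euc r)) (α : Euc d → Euc r) : Prop :=
  ContinuousOn α (stateProj Ω) ∧ ∀ x ∈ stateProj Ω, (x, α x) ∈ Ω

/-- A smooth feedback on `Ω`. -/
def IsSmoothFeedback (Ω : Set (Euc d × Euc r)) (α : Euc d → Euc r) : Prop :=
  IsFeedback Ω α ∧ ContDiffOn ℝ ∞ α (stateProj Ω)

/-- The difference vector field `δf_{α₁,α₂}(x) = f(x, α₁(x)) - f(x, α₂(x))`. -/
def deltaField (f : Euc d × Euc r → Euc d) (α₁ α₂ : Euc d → Euc r) : Euc d → Euc d :=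
  fun x => f (x, α₁ x) - f (x, α₂ x)

/-- The family `𝓕'` of all the difference vector fields. -/
def family' (f : Euc d × Euc r → Euc d) (Ω : Set (Euc d × Euc r)) : Set (Euc d → Euc d) :=
  {X | ∃ α₁ α₂, IsFeedback Ω α₁ ∧ IsFeedback Ω α₂ ∧ X = deltaField f α₁ α₂}

/-- The family `𝓕''` of the members of `𝓕'` that have a flow. -/
def family'' (f : Euc d × Euc r → Euc d) (Ω : Set (Euc d × Euc r)) : Set (Euc d → Euc d) :=
  {X | X ∈ family' f Ω ∧ HasFlow (stateProj Ω) X}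

/-- The family `𝓕` of the difference vector fields of smooth feedbacks. -/
def smoothFamily (f : Euc d × Euc r → Euc d) (Ω : Set (Euc d × Euc r)) : Set (Euc d → Euc d) :=
  {X | ∃ α₁ α₂, IsSmoothFeedback Ω α₁ ∧ IsSmoothFeedback Ω α₂ ∧ X = deltaField f α₁ α₂}

end Feedbacks

end FeedbackOrbit

end

open FeedbackOrbit

noncomputable section

namespace FeedbackOrbit

/-! ### Integral curves: translation, gluing, extension, uniqueness. -/

section Curves

variable {d : ℕ} {U : Set (Euc d)} {X : Euc d → Euc d}

/-! Two ingredients: the orbit theorem for a nonempty family `𝓕` of smooth fields on an open set,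
proved from scratch, and a limiting argument showing that a larger family `𝓖 ⊇ 𝓕` of fields having a
flow, each a uniform limit of members of `𝓕`, has the same orbits. The second applies because a
continuous feedback has smooth feedbacks arbitrarily close to it, in the sense that `f` changes by
less than `ε` on all of `U` (`isUniformLimit_of_mem_family'`). Without any feedback both families
are empty and so are their orbits.

Smooth families. The span `P_𝓕` of the push-forwards is preserved by the flows, hence has constant
rank `q` along an orbit. A push-forward `φ_⋆ X⁰` is the velocity at `s = 0` of `φ ∘ X⁰_s ∘ φ⁻¹`,
again a composition of flows. Composing `q` such arcs with independent velocities and starting from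
an affine transversal gives coordinates (`exists_isFlowChart`) whose slices of dimension `q` are
each swept out by flows and are tangent to `P_𝓕`. On the orbit the slice directions exhaust `P_𝓕` by
dimension, so a map (1) has locally constant transverse coordinates. Therefore the orbit meets the
chart in a union of slices, and the orbit topology is the slice topology
(`IsFlowChart.isPlaqueChart`). The orbit is connected and covered by the plaques of countably many
charts, hence second countable. So a chart contains only countably many plaques, and a connected set
continuously mapped into the orbit, for the ambient topology, stays in one plaque as long as it
stays in the chart. This countability gives the lifting of continuity and drives the comparison.

Limits. Let `X` be a uniform limit of members of `𝓕`. The approximating integral curves from `x`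
stay in the plaque of `x`, which is closed in a small ball; a limit of them is an integral curve of
`X` in that plaque (`exists_curve_mem_orbit`). If `X` has a flow, uniqueness says that this is the
integral curve, so flows of `X` do not leave the orbit. The same compactness and uniqueness show
that the flow of `X` is continuous; the maps (1) for `𝓖` are thus continuous into `ℝᵈ`, with open,
locally connected domains, and lift to continuous maps into the orbit of `𝓕`. This identifies the
topologies.

Finally `P_𝓖 = P_𝓕`: values of `X` lie in `P_𝓕` because subspaces are closed, and a `C¹`
diffeomorphism made of flows of `𝓖` maps each point into its own orbit, hence plaques into plaques
locally, so that its differential preserves `P_𝓕` (`IsLimitFamily.fderiv_mem`). -/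

lemma IsIntegralCurve.mono {I J : Set ℝ} {γ : ℝ → Euc d} (h : IsIntegralCurve U X I γ)
    (hJ : J ⊆ I) : IsIntegralCurve U X J γ :=
  fun t ht => ⟨(h t (hJ ht)).1, (h t (hJ ht)).2.mono hJ⟩

lemma IsIntegralCurve.continuousOn {I : Set ℝ} {γ : ℝ → Euc d}
    (h : IsIntegralCurve U X I γ) : ContinuousOn γ I :=
  fun t ht => (h t ht).2.continuousWithinAt

lemma IsIntegralCurve.congr {I : Set ℝ} {γ γ' : ℝ → Euc d} (h : IsIntegralCurve U X I γ)
    (hγ : EqOn γ' γ I) : IsIntegralCurve U X I γ' := fun t ht => by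
  rw [hγ ht]
  exact ⟨(h t ht).1, (h t ht).2.congr (fun s hs => hγ hs) (hγ ht)⟩

lemma IsIntegralCurve.hasDerivAt {I : Set ℝ} {γ : ℝ → Euc d} (h : IsIntegralCurve U X I γ)
    {t : ℝ} (ht : I ∈ 𝓝 t) : HasDerivAt γ (X (γ t)) t :=
  (h t (mem_of_mem_nhds ht)).2.hasDerivAt ht

lemma IsIntegralCurve.comp_add {I J : Set ℝ} {γ : ℝ → Euc d} (h : IsIntegralCurve U X I γ)
    (c : ℝ) (hJ : ∀ t ∈ J, t + c ∈ I) : IsIntegralCurve U X J (fun t => γ (t + c)) :=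
  fun t ht => ⟨(h _ (hJ t ht)).1, by
    have := (h _ (hJ t ht)).2.scomp t ((hasDerivAt_id t).add_const c).hasDerivWithinAt
      (s := J) (fun s hs => hJ s hs)
    rw [one_smul] at this
    exact this⟩

/-- Gluing of two integral curves at a common point. -/
lemma IsIntegralCurve.glue {I₁ I₂ : Set ℝ} {γ₁ γ₂ : ℝ → Euc d} {c : ℝ}
    (h₁ : IsIntegralCurve U X I₁ γ₁) (h₂ : IsIntegralCurve U X I₂ γ₂) (hI₁ : I₁ ⊆ Iic c)
    (hI₂ : I₂ ⊆ Ici c) (hc₁ : c ∈ I₁) (hc₂ : c ∈ I₂) (hc : γ₁ c = γ₂ c) :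
    IsIntegralCurve U X (I₁ ∪ I₂) (fun t => if t ≤ c then γ₁ t else γ₂ t) := by
  set γ : ℝ → Euc d := fun t => if t ≤ c then γ₁ t else γ₂ t
  have e₁ : EqOn γ γ₁ I₁ := fun t ht => if_pos (hI₁ ht)
  have e₂ : EqOn γ γ₂ I₂ := fun t ht => by
    rcases (show c ≤ t from hI₂ ht).eq_or_lt with rfl | hlt
    · simp [γ, hc]
    · simp [γ, hlt.not_ge]
  have k₁ := h₁.congr e₁
  have k₂ := h₂.congr e₂
  -- Away from the junction only one piece matters, since `t` is outside the closure of the other;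
  -- at the junction both one-sided derivatives are the same vector.
  have key : ∀ t, (t ∈ I₁ ∨ t ∉ closure I₁) → (t ∈ I₂ ∨ t ∉ closure I₂) →
      HasDerivWithinAt γ (X (γ t)) (I₁ ∪ I₂) t := by
    intro t h1 h2
    refine HasDerivWithinAt.union ?_ ?_
    · rcases h1 with h1 | h1
      · exact (k₁ t h1).2
      · exact HasFDerivWithinAt.of_notMem_closure h1
    · rcases h2 with h2 | h2
      · exact (k₂ t h2).2
      · exact HasFDerivWithinAt.of_notMem_closure h2
  rintro t (ht | ht)
  · refine ⟨(k₁ t ht).1, key t (Or.inl ht) ?_⟩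
    rcases (show t ≤ c from hI₁ ht).eq_or_lt with rfl | hlt
    · exact Or.inl hc₂
    · exact Or.inr fun hcl => absurd (closure_minimal hI₂ isClosed_Ici hcl) (not_le.2 hlt)
  · refine ⟨(k₂ t ht).1, key t ?_ (Or.inl ht)⟩
    rcases (show c ≤ t from hI₂ ht).eq_or_lt with rfl | hlt
    · exact Or.inl hc₁
    · exact Or.inr fun hcl => absurd (closure_minimal hI₁ isClosed_Iic hcl) (not_le.2 hlt)

lemma HasFlow.eventuallyEq (hX : HasFlow U X) {a b c : ℝ} {γ₁ γ₂ : ℝ → Euc d}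
    (h₁ : IsIntegralCurve U X (Ioo a b) γ₁) (h₂ : IsIntegralCurve U X (Ioo a b) γ₂)
    (hc : c ∈ Ioo a b) (h : γ₁ c = γ₂ c) : γ₁ =ᶠ[𝓝 c] γ₂ := by
  obtain ⟨ε, hε, γ, -, -, huniq⟩ := hX (γ₁ c) (h₁ c hc).1
  -- `HasFlow` asks for uniqueness on every smaller window, so both curves, translated to time `0`,
  -- can be compared on a window that fits in `(a, b)`.
  set δ := min ε (min (c - a) (b - c))
  have hδ : 0 < δ := lt_min hε (lt_min (sub_pos.2 hc.1) (sub_pos.2 hc.2))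
  have hI : ∀ t ∈ Ioo (-δ) δ, t + c ∈ Ioo a b := by
    intro t ht
    have h1 : δ ≤ c - a := (min_le_right _ _).trans (min_le_left _ _)
    have h2 : δ ≤ b - c := (min_le_right _ _).trans (min_le_right _ _)
    constructor <;> linarith [ht.1, ht.2]
  have e₁ := huniq δ hδ (min_le_left _ _) _ (by simp) (h₁.comp_add c hI)
  have e₂ := huniq δ hδ (min_le_left _ _) _ (by simp [h]) (h₂.comp_add c hI)
  have hn : Ioo (c - δ) (c + δ) ∈ 𝓝 c := Ioo_mem_nhds (by linarith) (by linarith)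
  filter_upwards [hn] with t ht
  have ht' : t - c ∈ Ioo (-δ) δ := ⟨by linarith [ht.1], by linarith [ht.2]⟩
  simpa using (e₁ ht').trans (e₂ ht').symm

/-- The set of agreement is open by `hloc` and closed by continuity. Local uniqueness is a
hypothesis so that the argument also serves for `C¹` fields before they are known to have a flow. -/
lemma IsIntegralCurve.eqOn_Ioo {a b c : ℝ} {γ₁ γ₂ : ℝ → Euc d}
    (h₁ : IsIntegralCurve U X (Ioo a b) γ₁) (h₂ : IsIntegralCurve U X (Ioo a b) γ₂)
    (hloc : ∀ x ∈ Ioo a b, γ₁ x = γ₂ x → γ₁ =ᶠ[𝓝 x] γ₂)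
    (hc : c ∈ Ioo a b) (h : γ₁ c = γ₂ c) : EqOn γ₁ γ₂ (Ioo a b) := by
  intro t ht
  have := isPreconnected_Ioo.induction₂ (s := Ioo a b)
    (fun x y => γ₁ x = γ₂ x ↔ γ₁ y = γ₂ y) (fun x hx => ?_)
    (fun x y z _ _ _ h h' => h.trans h') (fun x y _ _ h => h.symm) hc ht
  · exact this.1 h
  · refine nhdsWithin_le_nhds ?_
    by_cases hxe : γ₁ x = γ₂ x
    · filter_upwards [hloc x hx hxe] with y hy
      exact iff_of_true hxe hy
    · have hn := isOpen_Ioo.mem_nhds hx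
      filter_upwards [((h₁.hasDerivAt hn).continuousAt.ne_iff_eventually_ne
        (h₂.hasDerivAt hn).continuousAt).1 hxe] with y hy
      exact iff_of_false hxe hy

lemma HasFlow.eqOn_Ioo (hX : HasFlow U X) {a b c : ℝ} {γ₁ γ₂ : ℝ → Euc d}
    (h₁ : IsIntegralCurve U X (Ioo a b) γ₁) (h₂ : IsIntegralCurve U X (Ioo a b) γ₂)
    (hc : c ∈ Ioo a b) (h : γ₁ c = γ₂ c) : EqOn γ₁ γ₂ (Ioo a b) :=
  h₁.eqOn_Ioo h₂ (fun _ hx hxe => hX.eventuallyEq h₁ h₂ hx hxe) hc h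

/-- Two integral curves on open intervals which agree at a common point glue together. -/
lemma HasFlow.exists_union (hX : HasFlow U X) {a b a' b' c : ℝ} {γ₁ γ₂ : ℝ → Euc d}
    (h₁ : IsIntegralCurve U X (Ioo a b) γ₁) (h₂ : IsIntegralCurve U X (Ioo a' b') γ₂)
    (hc : c ∈ Ioo a b) (hc' : c ∈ Ioo a' b') (h : γ₁ c = γ₂ c) :
    ∃ γ, IsIntegralCurve U X (Ioo (min a a') (max b b')) γ ∧ EqOn γ γ₁ (Ioo a b) ∧
      EqOn γ γ₂ (Ioo a' b') := by
  have hsub : Ioo a b ∩ Ioo a' b' = Ioo (max a a') (min b b') := Ioo_inter_Ioo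
  have he : EqOn γ₁ γ₂ (Ioo (max a a') (min b b')) :=
    hX.eqOn_Ioo (h₁.mono (hsub ▸ inter_subset_left)) (h₂.mono (hsub ▸ inter_subset_right))
      (c := c) (hsub ▸ ⟨hc, hc'⟩) h
  classical
  set γ : ℝ → Euc d := fun t => if t ∈ Ioo a b then γ₁ t else γ₂ t
  have e₁ : EqOn γ γ₁ (Ioo a b) := fun t ht => if_pos ht
  have e₂ : EqOn γ γ₂ (Ioo a' b') := fun t ht => by
    by_cases h : t ∈ Ioo a b
    · rw [e₁ h]
      exact he (hsub ▸ ⟨h, ht⟩)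
    · exact if_neg h
  refine ⟨γ, fun t ht => ?_, e₁, e₂⟩
  have hU : t ∈ Ioo a b ∨ t ∈ Ioo a' b' := by
    simp only [mem_Ioo, min_lt_iff, lt_max_iff] at ht hc hc' ⊢
    by_contra hcon
    rw [not_or, not_and_or, not_and_or] at hcon
    simp only [not_lt] at hcon
    rcases hcon with ⟨h1 | h1, h2 | h2⟩ <;> rcases ht with ⟨h3 | h3, h4 | h4⟩ <;> linarith
  rcases hU with hU | hU
  · have := (h₁.congr e₁) t hU
    exact ⟨this.1, (this.2.hasDerivAt (isOpen_Ioo.mem_nhds hU)).hasDerivWithinAt⟩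
  · have := (h₂.congr e₂) t hU
    exact ⟨this.1, (this.2.hasDerivAt (isOpen_Ioo.mem_nhds hU)).hasDerivWithinAt⟩

lemma HasFlow.exists_curve (hX : HasFlow U X) {x : Euc d} (hx : x ∈ U) (c : ℝ) :
    ∃ ε > 0, ∃ γ, γ c = x ∧ IsIntegralCurve U X (Ioo (c - ε) (c + ε)) γ := by
  obtain ⟨ε, hε, γ, h0, hγ, -⟩ := hX x hx
  refine ⟨ε, hε, fun t => γ (t + -c), by simp [h0], hγ.comp_add (-c) fun t ht => ?_⟩
  constructor <;> linarith [ht.1, ht.2]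

/-- An integral curve on a compact interval extends to an open interval. -/
lemma HasFlow.exists_extension (hX : HasFlow U X) {a b : ℝ} (hab : a ≤ b) {γ : ℝ → Euc d}
    (h : IsIntegralCurve U X (Icc a b) γ) :
    ∃ ε > 0, ∃ γ', IsIntegralCurve U X (Ioo (a - ε) (b + ε)) γ' ∧ EqOn γ' γ (Icc a b) := by
  obtain ⟨ε₁, hε₁, γ₁, h₁a, h₁⟩ := hX.exists_curve (h a ⟨le_rfl, hab⟩).1 a
  obtain ⟨ε₂, hε₂, γ₂, h₂b, h₂⟩ := hX.exists_curve (h b ⟨hab, le_rfl⟩).1 b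
  have k₁ := IsIntegralCurve.glue (I₁ := Ioc (a - ε₁) a) (c := a)
    (h₁.mono fun t ht => ⟨ht.1, by linarith [ht.2]⟩) h (fun t ht => ht.2) (fun t ht => ht.1)
    ⟨by linarith, le_rfl⟩ ⟨le_rfl, hab⟩ h₁a
  have k₂ := IsIntegralCurve.glue (I₂ := Ico b (b + ε₂)) (c := b) k₁
    (h₂.mono fun t ht => ⟨by linarith [ht.1], ht.2⟩)
    (union_subset (fun t ht => ht.2.trans hab) fun t ht => ht.2) (fun t ht => ht.1)
    (Or.inr ⟨hab, le_rfl⟩) ⟨le_rfl, by linarith⟩ (by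
      rcases hab.eq_or_lt with rfl | hlt
      · simp [h₁a, h₂b]
      · simp [hlt.not_ge, h₂b])
  refine ⟨min ε₁ ε₂, lt_min hε₁ hε₂, _, k₂.mono fun t ht => ?_, fun t ht => ?_⟩
  · have h1 := min_le_left ε₁ ε₂
    have h2 := min_le_right ε₁ ε₂
    rcases le_total t a with hta | hta
    · exact Or.inl (Or.inl ⟨by linarith [ht.1], hta⟩)
    · rcases le_total t b with htb | htb
      · exact Or.inl (Or.inr ⟨hta, htb⟩)
      · exact Or.inr ⟨htb, by linarith [ht.2]⟩
  · rw [if_pos ht.2]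
    rcases ht.1.eq_or_lt with rfl | hlt
    · simp [h₁a]
    · simp [hlt.not_ge]

/-- Extending past both ends replaces one-sided derivatives by genuine ones and allows curves to be
translated and united; the group law of the flow rests on this. -/
lemma FlowsTo.exists_Ioo (hX : HasFlow U X) {t : ℝ} {x y : Euc d} (h : FlowsTo U X t x y) :
    ∃ a b, 0 ∈ Ioo a b ∧ t ∈ Ioo a b ∧ ∃ γ, IsIntegralCurve U X (Ioo a b) γ ∧
      γ 0 = x ∧ γ t = y := by
  obtain ⟨γ, h0, ht, hγ⟩ := h
  obtain ⟨ε, hε, γ', h', he⟩ := hX.exists_extension (min_le_max : min 0 t ≤ max 0 t) hγ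
  have h1 := min_le_left 0 t
  have h2 := min_le_right 0 t
  have h3 := le_max_left 0 t
  have h4 := le_max_right 0 t
  exact ⟨_, _, ⟨by linarith, by linarith⟩, ⟨by linarith, by linarith⟩, γ', h',
    (he ⟨h1, h3⟩).trans h0, (he ⟨h2, h4⟩).trans ht⟩

lemma IsIntegralCurve.flowsTo {a b s t : ℝ} {γ : ℝ → Euc d}
    (h : IsIntegralCurve U X (Ioo a b) γ) (hs : s ∈ Ioo a b) (ht : t ∈ Ioo a b) :
    FlowsTo U X (t - s) (γ s) (γ t) := by
  refine ⟨fun r => γ (r + s), by simp, by simp, h.comp_add s fun r hr => ?_⟩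
  have := (ordConnected_Ioo (a := a) (b := b)).uIcc_subset hs ht
  refine this ?_
  rw [mem_uIcc] at hr ⊢
  rcases hr with hr | hr
  · left; constructor <;> linarith [hr.1, hr.2]
  · right; constructor <;> linarith [hr.1, hr.2]

lemma FlowsTo.mem_right {t : ℝ} {x y : Euc d} (h : FlowsTo U X t x y) : y ∈ U := by
  obtain ⟨γ, -, ht, hγ⟩ := h
  exact ht ▸ (hγ t right_mem_uIcc).1

lemma FlowsTo.zero {x : Euc d} (hx : x ∈ U) : FlowsTo U X 0 x x := by
  refine ⟨fun _ => x, rfl, rfl, fun t ht => ⟨hx, ?_⟩⟩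
  rw [uIcc_self, mem_singleton_iff] at ht
  subst ht
  rw [uIcc_self]
  exact HasFDerivWithinAt.of_subsingleton (𝕜 := ℝ) subsingleton_singleton

lemma FlowsTo.unique (hX : HasFlow U X) {t : ℝ} {x y z : Euc d} (h : FlowsTo U X t x y)
    (h' : FlowsTo U X t x z) : y = z := by
  obtain ⟨a, b, h0, ht, γ, hγ, hx, rfl⟩ := h.exists_Ioo hX
  obtain ⟨a', b', h0', ht', γ', hγ', hx', rfl⟩ := h'.exists_Ioo hX
  obtain ⟨γ'', -, e, e'⟩ := hX.exists_union hγ hγ' h0 h0' (hx.trans hx'.symm)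
  rw [← e ht, ← e' ht']

lemma FlowsTo.trans (hX : HasFlow U X) {s t : ℝ} {x y z : Euc d} (h : FlowsTo U X s x y)
    (h' : FlowsTo U X t y z) : FlowsTo U X (s + t) x z := by
  obtain ⟨a, b, h0, ht, γ, hγ, rfl, rfl⟩ := h.exists_Ioo hX
  obtain ⟨a', b', h0', ht', γ', hγ', hx', rfl⟩ := h'.exists_Ioo hX
  have hs : ∀ r, r ∈ Ioo a' b' → r + s ∈ Ioo (a' + s) (b' + s) := fun r hr =>
    ⟨by linarith [hr.1], by linarith [hr.2]⟩
  have k : IsIntegralCurve U X (Ioo (a' + s) (b' + s)) (fun r => γ' (r + -s)) :=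
    hγ'.comp_add (-s) fun r hr => ⟨by linarith [hr.1], by linarith [hr.2]⟩
  have hs0 : s ∈ Ioo (a' + s) (b' + s) := by simpa using hs 0 h0'
  have hst : s + t ∈ Ioo (a' + s) (b' + s) := by simpa [add_comm] using hs t ht'
  obtain ⟨γ'', h'', e, e'⟩ := hX.exists_union hγ k ht hs0 (by simp [hx'])
  have := h''.flowsTo (s := 0) (t := s + t)
    ⟨min_lt_of_left_lt h0.1, lt_max_of_lt_left h0.2⟩
    ⟨min_lt_of_right_lt hst.1, lt_max_of_lt_right hst.2⟩
  rw [e h0, e' hst] at this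
  simpa using this

lemma FlowsTo.symm (hX : HasFlow U X) {t : ℝ} {x y : Euc d} (h : FlowsTo U X t x y) :
    FlowsTo U X (-t) y x := by
  obtain ⟨a, b, h0, ht, γ, hγ, rfl, rfl⟩ := h.exists_Ioo hX
  simpa using hγ.flowsTo ht h0

/-- Picard–Lindelöf gives existence, and the local Lipschitz property gives local uniqueness, which
propagates along the interval. -/
lemma hasFlow_of_contDiffOn (hU : IsOpen U) (hX : ContDiffOn ℝ 1 X U) : HasFlow U X := by
  intro x hx
  have hat : ∀ y ∈ U, ContDiffAt ℝ 1 X y := fun y hy => hX.contDiffAt (hU.mem_nhds hy)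
  obtain ⟨γ, hγ0, ε₀, hε₀, hγ'⟩ :=
    (hat x hx).exists_forall_mem_closedBall_exists_eq_forall_mem_Ioo_hasDerivAt₀ 0
  have hγ : ∀ᶠ t in 𝓝 (0 : ℝ), HasDerivAt γ (X (γ t)) t := by
    filter_upwards [Ioo_mem_nhds (by linarith : 0 - ε₀ < 0) (by linarith : (0 : ℝ) < 0 + ε₀)] with t ht
    exact hγ' t ht
  have hc : ContinuousAt γ 0 := hγ.self_of_nhds.continuousAt
  have hUγ : ∀ᶠ t in 𝓝 (0 : ℝ), γ t ∈ U := hc.preimage_mem_nhds (by rw [hγ0]; exact hU.mem_nhds hx)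
  obtain ⟨ε, hε, hball⟩ := Metric.eventually_nhds_iff_ball.1 (hγ.and hUγ)
  rw [Real.ball_eq_Ioo, zero_sub, zero_add] at hball
  have hI : IsIntegralCurve U X (Ioo (-ε) ε) γ := fun t ht =>
    ⟨(hball t ht).2, (hball t ht).1.hasDerivWithinAt⟩
  refine ⟨ε, hε, γ, hγ0, hI, fun δ hδ hδε η hη0 hη => ?_⟩
  have hI' := hI.mono (J := Ioo (-δ) δ) (Ioo_subset_Ioo (by linarith) hδε)
  refine hη.eqOn_Ioo hI' (fun t ht hte => ?_) (c := 0) ⟨by linarith, hδ⟩ (hη0.trans hγ0.symm)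
  obtain ⟨K, s, hs, hK⟩ := (hat _ (hI' t ht).1).exists_lipschitzOnWith
  have hn := isOpen_Ioo.mem_nhds ht
  have key : ∀ c : ℝ → Euc d, IsIntegralCurve U X (Ioo (-δ) δ) c → c t = γ t →
      ∀ᶠ r in 𝓝 t, HasDerivAt c (X (c r)) r ∧ c r ∈ s := by
    intro c hc hct
    filter_upwards [isOpen_Ioo.mem_nhds ht,
      (hc.hasDerivAt hn).continuousAt.preimage_mem_nhds (by rw [hct]; exact hs)] with r hr hrs
    exact ⟨hc.hasDerivAt (isOpen_Ioo.mem_nhds hr), hrs⟩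
  exact ODE_solution_unique_of_eventually (v := fun _ => X) (s := fun _ => s)
    (Filter.Eventually.of_forall fun _ => hK) (key η hη hte) (key γ hI' rfl) hte

end Curves

/-! ### Flow boxes -/

section Boxes

variable {d : ℕ}

/-- The flow of `X` on `U` is defined and of class `Cⁿ` near the time `t₀` and the point `x₀`. -/
def FlowBox (n : WithTop ℕ∞) (U : Set (Euc d)) (X : Euc d → Euc d) (t₀ : ℝ) (x₀ : Euc d) : Prop :=
  ∃ A : Set (ℝ × Euc d), IsOpen A ∧ (t₀, x₀) ∈ A ∧ ∃ Θ : ℝ × Euc d → Euc d,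
    ContDiffOn ℝ n Θ A ∧ ∀ p ∈ A, FlowsTo U X p.1 p.2 (Θ p)

/-- If the flow is of class `Cⁿ` for small times, it is so on its whole domain. -/
lemma FlowsTo.flowBox {n : WithTop ℕ∞} {U : Set (Euc d)} {X : Euc d → Euc d} (hX : HasFlow U X)
    (hbox : ∀ x ∈ U, FlowBox n U X 0 x) {t₀ : ℝ} {x₀ y₀ : Euc d}
    (h : FlowsTo U X t₀ x₀ y₀) : FlowBox n U X t₀ x₀ := by
  obtain ⟨a, b, h0, ht, γ, hγ, rfl, rfl⟩ := h.exists_Ioo hX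
  -- A relation between times along the curve: boxes at time `0` give it between nearby times in
  -- both directions, and composition of flow maps makes it transitive.
  have := isPreconnected_Ioo.induction₂' (s := Ioo a b)
    (fun s s' => FlowBox n U X (s' - s) (γ s)) (fun s hs => ?_) ?_ h0 ht
  · simpa using this
  · obtain ⟨A, hA, hmem, Θ, hΘ, hfl⟩ := hbox (γ s) (hγ s hs).1
    have hc : ContinuousAt γ s := (hγ.hasDerivAt (isOpen_Ioo.mem_nhds hs)).continuousAt
    have c₁ : ContinuousAt (fun s' => (s' - s, γ s)) s := by fun_prop
    have c₂ : ContinuousAt (fun s' => (s - s', γ s')) s := by fun_prop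
    refine nhdsWithin_le_nhds ?_
    filter_upwards [c₁.preimage_mem_nhds (hA.mem_nhds (by simpa using hmem)),
      c₂.preimage_mem_nhds (hA.mem_nhds (by simpa using hmem))] with s' h₁ h₂
    exact ⟨⟨A, hA, h₁, Θ, hΘ, hfl⟩, ⟨A, hA, h₂, Θ, hΘ, hfl⟩⟩
  · rintro s s' s'' hs hs' hs'' ⟨A, hA, hmem, Θ, hΘ, hfl⟩ ⟨A', hA', hmem', Θ', hΘ', hfl'⟩
    have hA₁ : IsOpen {x | (s' - s, x) ∈ A} := hA.preimage (by fun_prop)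
    have hΘ₁ : ContDiffOn ℝ n (fun x => Θ (s' - s, x)) {x | (s' - s, x) ∈ A} :=
      hΘ.comp (by fun_prop) fun x hx => hx
    -- The first leg has the fixed duration `s' - s`; the second absorbs the variable part of the
    -- time.
    set g : ℝ × Euc d → ℝ × Euc d := fun p => (p.1 - (s' - s), Θ (s' - s, p.2))
    have hB : IsOpen (Prod.snd ⁻¹' {x | (s' - s, x) ∈ A} : Set (ℝ × Euc d)) :=
      hA₁.preimage continuous_snd
    have hg : ContDiffOn ℝ n g (Prod.snd ⁻¹' {x | (s' - s, x) ∈ A}) := by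
      refine ContDiffOn.prodMk (by fun_prop) ?_
      exact hΘ₁.comp (g := fun x => Θ (s' - s, x)) (f := Prod.snd) (by fun_prop) fun p hp => hp
    have hval : Θ (s' - s, γ s) = γ s' :=
      (hfl _ hmem).unique hX (hγ.flowsTo hs hs')
    refine ⟨_, hg.continuousOn.isOpen_inter_preimage hB hA', ⟨hmem, ?_⟩, fun p => Θ' (g p),
      hΘ'.comp (hg.mono inter_subset_left) fun p hp => hp.2, ?_⟩
    · simpa [g, hval] using hmem'
    · rintro p ⟨hp, hp'⟩
      have := (hfl _ hp).trans hX (hfl' _ hp')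
      simpa [g] using this

end Boxes


/-! ### Smooth dependence of flows on the initial conditions -/

section Superposition

variable {K E F : Type} [TopologicalSpace K] [CompactSpace K]
  [NormedAddCommGroup E] [NormedSpace ℝ E] [NormedAddCommGroup F] [NormedSpace ℝ F]

/-- Pointwise application of a continuous family of linear maps. -/
def pointwiseApply : C(K, E →L[ℝ] F) →L[ℝ] C(K, E) →L[ℝ] C(K, F) :=
  LinearMap.mkContinuous₂
    (LinearMap.mk₂ ℝ (fun (A : C(K, E →L[ℝ] F)) (γ : C(K, E)) => (⟨fun t => A t (γ t), by fun_prop⟩ : C(K, F)))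
      (fun A A' γ => by ext t; simp) (fun c A γ => by ext t; simp)
      (fun A γ γ' => by ext t; simp) (fun c A γ => by ext t; simp)) 1 (fun A γ => by
    rw [one_mul, ContinuousMap.norm_le _ (by positivity)]
    intro t
    exact ((A t).le_opNorm _).trans
      (mul_le_mul (A.norm_coe_le_norm t) (γ.norm_coe_le_norm t) (norm_nonneg _) (norm_nonneg A)))

@[simp] lemma pointwiseApply_apply (A : C(K, E →L[ℝ] F)) (γ : C(K, E)) (t : K) :
    pointwiseApply A γ t = A t (γ t) := rfl

/-- The mean value inequality bounds the remainder at each `t`; the bound is uniform in `t` because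
`η ↦ g' ∘ η` is continuous for the uniform norm. -/
lemma hasFDerivAt_comp_left (g : C(E, F)) (g' : C(E, E →L[ℝ] F))
    (hg : ∀ x, HasFDerivAt g (g' x) x) (γ : C(K, E)) :
    HasFDerivAt (fun γ : C(K, E) => g.comp γ) (pointwiseApply (g'.comp γ)) γ := by
  rw [hasFDerivAt_iff_isLittleO_nhds_zero, Asymptotics.isLittleO_iff]
  intro c hc
  have hcont : ContinuousAt (fun η : C(K, E) => g'.comp η) γ :=
    (ContinuousMap.continuous_postcomp g').continuousAt
  obtain ⟨δ, hδ, hball⟩ := (Metric.continuousAt_iff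
    (f := fun η : C(K, E) => g'.comp η) (a := γ)).1 hcont c hc
  filter_upwards [Metric.ball_mem_nhds (0 : C(K, E)) hδ] with h hh
  rw [mem_ball_zero_iff] at hh
  rw [ContinuousMap.norm_le _ (by positivity)]
  intro t
  have hht : ‖h t‖ ≤ ‖h‖ := h.norm_coe_le_norm t
  have key := (convex_ball (γ t) δ).norm_image_sub_le_of_norm_hasFDerivWithin_le'
    (f := g) (f' := g') (φ := g' (γ t)) (C := c) (x := γ t) (y := γ t + h t)
    (fun x _ => (hg x).hasFDerivWithinAt) (fun x hx => ?_) (Metric.mem_ball_self hδ)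
    (by rw [mem_ball_iff_norm]; simpa using hht.trans_lt hh)
  · simp only [add_sub_cancel_left] at key
    exact key.trans (by gcongr)
  -- Continuity at `γ` speaks of curves. To use it at the single point `x`, the curve `γ` is
  -- translated by a constant so as to take the value `x` at `t`.
  · have hη : dist (γ + ContinuousMap.const K (x - γ t)) γ < δ := by
      rw [dist_eq_norm, add_sub_cancel_left]
      refine lt_of_le_of_lt ?_ (mem_ball_iff_norm.1 hx)
      rw [ContinuousMap.norm_le _ (norm_nonneg _)]
      intro s
      simp
    have := (ContinuousMap.dist_lt_iff hc).1 (hball hη) t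
    rw [dist_eq_norm] at this
    simpa using this.le

/-- The derivative is composition with `fderiv ℝ g` followed by the bounded operator
`pointwiseApply`, an operator of the same kind with another target space; hence the induction on the
order with `F` generalized. -/
theorem contDiff_comp_left {g : E → F} (hg : ContDiff ℝ ∞ g) :
    ContDiff ℝ ∞ (fun γ : C(K, E) => (⟨g, hg.continuous⟩ : C(E, F)).comp γ) := by
  rw [contDiff_infty]
  intro n
  induction n generalizing F with
  | zero => exact contDiff_zero.2 (ContinuousMap.continuous_postcomp _)
  | succ n ih =>
    have hg' : ContDiff ℝ ∞ (fderiv ℝ g) := hg.fderiv_right (by simp)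
    have h := (pointwiseApply (K := K) (E := E) (F := F)).contDiff.comp (ih hg')
    refine contDiff_succ_iff_hasFDerivAt.2
      ⟨fun γ => pointwiseApply ((⟨fderiv ℝ g, hg'.continuous⟩ : C(E, E →L[ℝ] F)).comp γ), h,
        fun γ => hasFDerivAt_comp_left _ _ (fun x => ?_) γ⟩
    exact (hg.differentiable (by simp) x).hasFDerivAt

end Superposition

section InverseFunction

variable {E F : Type} [NormedAddCommGroup E] [NormedSpace ℝ E] [CompleteSpace E]
  [NormedAddCommGroup F] [NormedSpace ℝ F]

/-- A smooth map with invertible derivative at a point has a smooth local inverse. -/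
theorem exists_openPartialHomeomorph_of_contDiffOn {f : E → F} {A : Set E} (hA : IsOpen A)
    (hf : ContDiffOn ℝ ∞ f A) {a : E} (ha : a ∈ A) (f' : E ≃L[ℝ] F)
    (hf' : HasFDerivAt f (f' : E →L[ℝ] F) a) :
    ∃ φ : OpenPartialHomeomorph E F, a ∈ φ.source ∧ φ.source ⊆ A ∧ ⇑φ = f ∧
      ContDiffOn ℝ ∞ φ.symm φ.target := by
  have hat : ∀ x ∈ A, ContDiffAt ℝ ∞ f x := fun x hx => hf.contDiffAt (hA.mem_nhds hx)
  -- Restricting to points where the derivative is invertible makes the inverse smooth on its whole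
  -- domain, not only at the image of `a`.
  have hB : IsOpen (A ∩ fderiv ℝ f ⁻¹' range ContinuousLinearEquiv.toContinuousLinearMap) :=
    (hf.continuousOn_fderiv_of_isOpen hA (by simp)).isOpen_inter_preimage hA
      ContinuousLinearEquiv.isOpen
  set B := A ∩ fderiv ℝ f ⁻¹' range (ContinuousLinearEquiv.toContinuousLinearMap (R₁ := ℝ))
  set φ := ((hat a ha).toOpenPartialHomeomorph f hf' (by simp)).restrOpen B hB
  refine ⟨φ, ⟨(hat a ha).mem_toOpenPartialHomeomorph_source hf' (by simp), ha, f', hf'.fderiv.symm⟩,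
    fun x hx => hx.2.1, rfl, fun y hy => ?_⟩
  have hx := φ.map_target hy
  obtain ⟨e, he⟩ := hx.2.2
  refine (φ.contDiffAt_symm (f₀' := e) hy ?_ (hat _ hx.2.1)).contDiffWithinAt
  rw [he]
  exact ((hat _ hx.2.1).differentiableAt (by simp)).hasFDerivAt

end InverseFunction

/-! ### The flow as solution of an integral equation in a Banach space of curves. -/

section SmoothFlow

/-- The primitive vanishing at `0` of a continuous curve on `[0, 1]`. -/
def primitive (E : Type) [NormedAddCommGroup E] [NormedSpace ℝ E] :
    C(Icc (0 : ℝ) 1, E) →L[ℝ] C(Icc (0 : ℝ) 1, E) :=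
  LinearMap.mkContinuous
    { toFun := fun γ => ⟨fun t => ∫ s in (0 : ℝ)..t, γ (projIcc 0 1 zero_le_one s), by
        have hc : Continuous fun s => γ (projIcc 0 1 zero_le_one s) :=
          γ.continuous.comp continuous_projIcc
        exact (intervalIntegral.continuous_primitive
          (fun a b => hc.intervalIntegrable a b) 0).comp continuous_subtype_val⟩
      map_add' := fun γ γ' => by
        ext1 t
        exact intervalIntegral.integral_add
          ((γ.continuous.comp continuous_projIcc).intervalIntegrable _ _)
          ((γ'.continuous.comp continuous_projIcc).intervalIntegrable _ _)
      map_smul' := fun c γ => by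
        ext1 t
        exact intervalIntegral.integral_smul _ _ } 1 (fun γ => by
    rw [one_mul, ContinuousMap.norm_le _ (norm_nonneg _)]
    intro t
    refine (intervalIntegral.norm_integral_le_of_norm_le_const
      fun s _ => γ.norm_coe_le_norm _).trans ?_
    have : |(t : ℝ) - 0| ≤ 1 := by
      rw [sub_zero, abs_of_nonneg t.2.1]
      exact t.2.2
    exact mul_le_of_le_one_right (norm_nonneg _) this)

variable {d : ℕ}

/-- A bump function cuts the field off. This is needed because composition with the field is to act
on all curves, so the field must be smooth on the whole space. -/
lemma exists_contDiff_eqOn_ball {U : Set (Euc d)} (hU : IsOpen U) {X : Euc d → Euc d}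
    (hX : ContDiffOn ℝ ∞ X U) {x : Euc d} (hx : x ∈ U) :
    ∃ r > 0, Metric.ball x r ⊆ U ∧ ∃ Y : Euc d → Euc d, ContDiff ℝ ∞ Y ∧
      EqOn Y X (Metric.ball x r) := by
  obtain ⟨R, hR, hball⟩ := Metric.nhds_basis_closedBall.mem_iff.1 (hU.mem_nhds hx)
  let χ : ContDiffBump x := ⟨R / 2, R, by positivity, by linarith⟩
  refine ⟨R / 2, by positivity, (Metric.ball_subset_closedBall.trans
    (Metric.closedBall_subset_closedBall (by linarith))).trans hball,
    fun y => χ y • X y, ?_, fun y hy => ?_⟩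
  · rw [contDiff_iff_contDiffAt]
    intro y
    by_cases hy : y ∈ U
    · exact χ.contDiffAt.smul (hX.contDiffAt (hU.mem_nhds hy))
    · have : y ∉ tsupport χ := fun h => hy (hball (by rwa [χ.tsupport_eq] at h))
      refine (contDiffAt_const (c := (0 : Euc d))).congr_of_eventuallyEq ?_
      filter_upwards [notMem_tsupport_iff_eventuallyEq.1 this] with z hz
      simp [hz]
  · have : χ y = 1 := χ.one_of_mem_closedBall (Metric.ball_subset_closedBall hy)
    simp [this]

/-- The solution, in rescaled time, of the integral equation gives an integral curve. -/
lemma flowsTo_of_integral_eq {U : Set (Euc d)} {X Y : Euc d → Euc d} {x : Euc d}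
    {B : Set (Euc d)} (hB : B ⊆ U) (hY : Continuous Y) (hYX : EqOn Y X B) {a : ℝ}
    (γ : C(Icc (0 : ℝ) 1, Euc d)) (hγ : ∀ t, γ t ∈ B)
    (heq : ∀ t : Icc (0 : ℝ) 1, γ t = x + a • ∫ s in (0 : ℝ)..t, Y (γ (projIcc 0 1 zero_le_one s))) :
    FlowsTo U X a x (γ 1) := by
  have hc : Continuous fun s => Y (γ (projIcc 0 1 zero_le_one s)) :=
    hY.comp (γ.continuous.comp continuous_projIcc)
  by_cases ha : a = 0
  · subst ha
    have h1 : γ 1 = x := by simpa using heq 1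
    rw [h1]
    exact FlowsTo.zero (hB (h1 ▸ hγ 1))
  -- `c` is the right-hand side extended to all real times, so its derivative is two-sided; the
  -- integral curve sought is `s ↦ c (s / a)`.
  · set c : ℝ → Euc d := fun τ => x + a • ∫ s in (0 : ℝ)..τ, Y (γ (projIcc 0 1 zero_le_one s))
    have hcd : ∀ τ, HasDerivAt c (a • Y (γ (projIcc 0 1 zero_le_one τ))) τ := fun τ =>
      ((intervalIntegral.integral_hasDerivAt_right (hc.intervalIntegrable _ _)
        (hc.stronglyMeasurableAtFilter _ _) hc.continuousAt).const_smul a).const_add x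
    have hcγ : ∀ τ : ℝ, ∀ hτ : τ ∈ Icc (0 : ℝ) 1, c τ = γ ⟨τ, hτ⟩ := fun τ hτ => (heq ⟨τ, hτ⟩).symm
    refine ⟨fun s => c (s / a), by simp [c], ?_, fun s hs => ?_⟩
    · simp only [div_self ha]
      exact hcγ 1 ⟨zero_le_one, le_rfl⟩
    · have hsa : s / a ∈ Icc (0 : ℝ) 1 := by
        rcases lt_or_gt_of_ne ha with h | h
        · rw [uIcc_of_ge h.le] at hs
          exact ⟨div_nonneg_of_nonpos hs.2 h.le, (div_le_one_of_neg h).2 hs.1⟩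
        · rw [uIcc_of_le h.le] at hs
          exact ⟨div_nonneg hs.1 h.le, (div_le_one h).2 hs.2⟩
      have hval : c (s / a) = γ ⟨s / a, hsa⟩ := hcγ _ hsa
      refine ⟨hB (by simp only [hval]; exact hγ _), ?_⟩
      have h1 := (hcd (s / a)).scomp s ((hasDerivAt_id s).div_const a)
      have h2 : X (c (s / a)) = (1 / a) • a • Y (γ (projIcc 0 1 zero_le_one (s / a))) := by
        rw [smul_smul, one_div, inv_mul_cancel₀ ha, one_smul, projIcc_of_mem _ hsa, hval,
          hYX (hγ _)]
      rw [h2]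
      exact h1.hasDerivWithinAt

/-- Continuous curves in `ℝᵈ` parametrised by `[0, 1]`. -/
abbrev UnitCurve (d : ℕ) : Type := C(Icc (0 : ℝ) 1, Euc d)

/-- The flow of a smooth vector field is smooth for small times. -/
theorem flowBox_zero_of_contDiffOn {U : Set (Euc d)} (hU : IsOpen U) {X : Euc d → Euc d}
    (hX : ContDiffOn ℝ ∞ X U) {x₀ : Euc d} (hx₀ : x₀ ∈ U) : FlowBox ∞ U X 0 x₀ := by
  obtain ⟨r, hr, hball, Y, hY, hYX⟩ := exists_contDiff_eqOn_ball hU hX hx₀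
  let Γ : UnitCurve d → UnitCurve d := fun γ => (⟨Y, hY.continuous⟩ : C(Euc d, Euc d)).comp γ
  have hΓ : ContDiff ℝ ∞ Γ := contDiff_comp_left hY
  let κ : Euc d →L[ℝ] UnitCurve d := ContinuousLinearMap.const ℝ (Icc (0 : ℝ) 1)
  let J : UnitCurve d →L[ℝ] UnitCurve d := primitive (Euc d)
  -- With time rescaled to `[0, 1]`, the Cauchy problem on `[0, a]` reads `γ = x + a J(Y ∘ γ)`,
  -- where `a` is a mere parameter. At `a = 0` the equation is trivial in `γ`, so the inverse
  -- function theorem applies to `G`.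
  let G : (ℝ × Euc d) × UnitCurve d → (ℝ × Euc d) × UnitCurve d := fun p => (p.1, p.2 - κ p.1.2 - p.1.1 • J (Γ p.2))
  have hG : ContDiff ℝ ∞ G := by
    refine contDiff_fst.prodMk ?_
    refine (contDiff_snd.sub (κ.contDiff.comp contDiff_fst.snd)).sub ?_
    exact contDiff_fst.fst.smul (J.contDiff.comp (hΓ.comp contDiff_snd))
  let p₀ : (ℝ × Euc d) × UnitCurve d := ((0, x₀), κ x₀)
  -- In the derivative of `G` at `p₀` the term containing that of `Γ` carries the factor `a = 0`;
  -- what remains is a unipotent triangular map, inverted by changing the sign of `B`.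
  let B : (ℝ × Euc d) →L[ℝ] UnitCurve d := κ.comp (ContinuousLinearMap.snd ℝ ℝ (Euc d)) +
    (ContinuousLinearMap.fst ℝ ℝ (Euc d)).smulRight (J (Γ (κ x₀)))
  let π₁ := ContinuousLinearMap.fst ℝ (ℝ × Euc d) (UnitCurve d)
  let π₂ := ContinuousLinearMap.snd ℝ (ℝ × Euc d) (UnitCurve d)
  let e : ((ℝ × Euc d) × UnitCurve d) ≃L[ℝ] ((ℝ × Euc d) × UnitCurve d) :=
    ContinuousLinearEquiv.equivOfInverse (π₁.prod (π₂ - B.comp π₁)) (π₁.prod (π₂ + B.comp π₁))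
      (fun p => by ext1 <;> simp [π₁, π₂]) (fun p => by ext1 <;> simp [π₁, π₂])
  have hG' : HasFDerivAt G (e : ((ℝ × Euc d) × UnitCurve d) →L[ℝ] ((ℝ × Euc d) × UnitCurve d)) p₀ := by
    have hΓ' := ((hΓ.differentiable (by simp) p₀.2).hasFDerivAt).comp p₀ π₂.hasFDerivAt
    have h1 := π₁.hasFDerivAt (x := p₀)
    have h2 := π₂.hasFDerivAt (x := p₀)
    have h3 := ((ContinuousLinearMap.fst ℝ ℝ (Euc d)).comp π₁).hasFDerivAt (x := p₀)
    have h4 := (κ.comp ((ContinuousLinearMap.snd ℝ ℝ (Euc d)).comp π₁)).hasFDerivAt (x := p₀)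
    have h5 := h3.smul (J.hasFDerivAt.comp p₀ hΓ')
    refine (h1.prodMk ((h2.sub h4).sub h5)).congr_fderiv ?_
    refine ContinuousLinearMap.ext fun p => Prod.ext rfl (ContinuousMap.ext fun t => ?_)
    change p.2 t - p.1.2 - ((0 : ℝ) • (J (fderiv ℝ Γ p₀.2 p.2) t) + p.1.1 • J (Γ (κ x₀)) t) =
      p.2 t - (p.1.2 + p.1.1 • J (Γ (κ x₀)) t)
    rw [zero_smul, zero_add, sub_sub]
  obtain ⟨φ, hφ₀, hφA, hφG, hφs⟩ := exists_openPartialHomeomorph_of_contDiffOn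
    (A := Prod.snd ⁻¹' Metric.ball (κ x₀) r) (Metric.isOpen_ball.preimage continuous_snd)
    hG.contDiffOn (a := p₀) (Metric.mem_ball_self hr) e hG'
  have hGp : G p₀ = ((0, x₀), 0) := Prod.ext rfl (ContinuousMap.ext fun t => by
    change x₀ - x₀ - (0 : ℝ) • (J (Γ (κ x₀)) t) = 0
    rw [zero_smul, sub_self, sub_zero])
  -- Solutions of the integral equation are the preimages of `(q, 0)`; the flow is their value at
  -- rescaled time `1`.
  let i : ℝ × Euc d → (ℝ × Euc d) × UnitCurve d := fun q => (q, 0)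
  have hi : ContDiff ℝ ∞ i := contDiff_id.prodMk contDiff_const
  refine ⟨i ⁻¹' φ.target, φ.open_target.preimage hi.continuous, ?_,
    fun q => (φ.symm (i q)).2 1, ?_, fun q hq => ?_⟩
  · have := φ.map_source hφ₀
    rwa [hφG, hGp] at this
  · exact (ContinuousMap.evalCLM ℝ (1 : Icc (0 : ℝ) 1)).contDiff.comp_contDiffOn
      (hφs.comp hi.contDiffOn fun q hq => hq).snd
  · set p := φ.symm (i q)
    have hp : G p = (q, 0) := by rw [← hφG]; exact φ.right_inv hq
    have hpb : p.2 ∈ Metric.ball (κ x₀) r := hφA (φ.map_target hq)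
    have h1 : p.1 = q := congrArg Prod.fst hp
    have h2 : p.2 - κ p.1.2 - p.1.1 • J (Γ p.2) = 0 := congrArg Prod.snd hp
    rw [h1, sub_sub, sub_eq_zero] at h2
    refine flowsTo_of_integral_eq hball hY.continuous hYX p.2 (fun t => ?_) (fun t => ?_)
    · exact lt_of_le_of_lt (ContinuousMap.dist_apply_le_dist t) hpb
    · exact congrArg (fun γ : UnitCurve d => γ t) h2

end SmoothFlow


/-! ### Limits of integral curves -/

section Limits

variable {d : ℕ}

/-- The mean value inequality for `γ u - u • v`. With `v = 0` it bounds the displacement by the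
speed; with `v = X (γ t)` it controls the difference quotient. -/
lemma IsIntegralCurve.norm_sub_sub_le {K : Set (Euc d)} {X : Euc d → Euc d} {a b : ℝ}
    {γ : ℝ → Euc d} (h : IsIntegralCurve K X (Ioo a b) γ) {s t : ℝ} (hs : s ∈ Ioo a b)
    (ht : t ∈ Ioo a b) {v : Euc d} {C : ℝ} (hC : ∀ u ∈ uIcc t s, ‖X (γ u) - v‖ ≤ C) :
    ‖γ s - γ t - (s - t) • v‖ ≤ C * |s - t| := by
  have hsub : uIcc t s ⊆ Ioo a b := ordConnected_Ioo.uIcc_subset ht hs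
  have := (convex_uIcc t s).norm_image_sub_le_of_norm_hasDerivWithin_le
    (f := fun u => γ u - u • v) (f' := fun u => X (γ u) - (1 : ℝ) • v) (C := C)
    (fun u hu => ((h.hasDerivAt (isOpen_Ioo.mem_nhds (hsub hu))).sub
      ((hasDerivAt_id u).smul_const v)).hasDerivWithinAt)
    (fun u hu => by simpa using hC u hu) left_mem_uIcc right_mem_uIcc
  rw [Real.norm_eq_abs] at this
  have he : γ s - γ t - (s - t) • v = γ s - s • v - (γ t - t • v) := by
    rw [sub_smul]
    abel
  rw [he]
  exact this

/-- Pointwise convergence suffices: the curves are eventually Lipschitz with constant `M + 1`, so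
the estimate on their difference quotients at `t` holds on a window independent of `i` and passes to
the limit. -/
theorem isIntegralCurve_of_tendsto {ι : Type*} {l : Filter ι} [l.NeBot] {K : Set (Euc d)}
    (hK : IsCompact K) {X : Euc d → Euc d} (hX : ContinuousOn X K) {Y : ι → Euc d → Euc d}
    (hY : ∀ ε > 0, ∀ᶠ i in l, ∀ x ∈ K, ‖Y i x - X x‖ < ε) {c : ι → ℝ → Euc d} {a b : ℝ}
    (hc : ∀ᶠ i in l, IsIntegralCurve K (Y i) (Ioo a b) (c i)) {γ : ℝ → Euc d}
    (hγ : ∀ t ∈ Ioo a b, Filter.Tendsto (fun i => c i t) l (𝓝 (γ t))) :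
    IsIntegralCurve K X (Ioo a b) γ := by
  obtain ⟨M, hM⟩ := hK.exists_bound_of_continuousOn hX
  have hγK : ∀ t ∈ Ioo a b, γ t ∈ K := fun t ht =>
    hK.isClosed.mem_of_tendsto (hγ t ht) (hc.mono fun i hi => (hi t ht).1)
  intro t ht
  refine ⟨hγK t ht, HasDerivAt.hasDerivWithinAt ?_⟩
  have hM0 : 0 ≤ M := (norm_nonneg _).trans (hM _ (hγK t ht))
  rw [hasDerivAt_iff_isLittleO, Asymptotics.isLittleO_iff]
  intro ε hε
  obtain ⟨δ, hδ, hδX⟩ := Metric.continuousWithinAt_iff.1 (hX _ (hγK t ht)) (ε / 2) (half_pos hε)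
  have hn : Metric.ball t (δ / (2 * (M + 1))) ∈ 𝓝 t := Metric.ball_mem_nhds t (by positivity)
  filter_upwards [isOpen_Ioo.mem_nhds ht, hn] with s hs hst
  have hsub : uIcc t s ⊆ Ioo a b := ordConnected_Ioo.uIcc_subset ht hs
  have hlim : Filter.Tendsto (fun i => ‖c i s - c i t - (s - t) • X (γ t)‖) l
      (𝓝 ‖γ s - γ t - (s - t) • X (γ t)‖) :=
    (((hγ s hs).sub (hγ t ht)).sub_const _).norm
  refine le_of_tendsto hlim ?_
  filter_upwards [hc, hY (ε / 2) (half_pos hε), hY 1 one_pos,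
    (hγ t ht).eventually (Metric.ball_mem_nhds _ (half_pos hδ))] with i hi hi1 hi2 hi3
  rw [Real.norm_eq_abs]
  refine hi.norm_sub_sub_le hs ht fun u hu => ?_
  have huI := hsub hu
  have h1 : ‖c i u - c i t‖ ≤ (M + 1) * |u - t| := by
    have := hi.norm_sub_sub_le (v := 0) (C := M + 1) huI ht (fun w hw => ?_)
    · simpa using this
    · have hwK := (hi w (ordConnected_Ioo.uIcc_subset ht huI hw)).1
      have := norm_add_le (Y i (c i w) - X (c i w)) (X (c i w))
      rw [sub_add_cancel] at this
      rw [sub_zero]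
      linarith [hi2 _ hwK, hM _ hwK]
  have h2 : |u - t| ≤ |s - t| := by
    rw [mem_uIcc] at hu
    rcases hu with hu | hu
    · rw [abs_of_nonneg (by linarith), abs_of_nonneg (by linarith)]
      linarith
    · rw [abs_of_nonpos (by linarith), abs_of_nonpos (by linarith)]
      linarith
  have h3 : (M + 1) * |s - t| < δ / 2 := by
    rw [Metric.mem_ball, Real.dist_eq, lt_div_iff₀ (by positivity)] at hst
    linarith
  have h4 : dist (c i u) (γ t) < δ := by
    have := dist_triangle (c i u) (c i t) (γ t)
    rw [dist_eq_norm (c i u) (c i t)] at this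
    have h5 : (M + 1) * |u - t| ≤ (M + 1) * |s - t| := by gcongr
    linarith
  have h6 := hδX (hi u huI).1 h4
  rw [dist_eq_norm] at h6
  have h7 := norm_add_le (Y i (c i u) - X (c i u)) (X (c i u) - X (γ t))
  rw [sub_add_sub_cancel] at h7
  linarith [hi1 _ (hi u huI).1]

/-- Ultrafilters replace Arzelà–Ascoli: by compactness of `K` the pointwise limits exist. This
serves both for sequences of fields and for varying initial points. -/
theorem exists_isIntegralCurve_of_ultrafilter {ι : Type*} (l : Ultrafilter ι) {K : Set (Euc d)}
    (hK : IsCompact K) {X : Euc d → Euc d} (hX : ContinuousOn X K) {Y : ι → Euc d → Euc d}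
    (hY : ∀ ε > 0, ∀ᶠ i in l, ∀ x ∈ K, ‖Y i x - X x‖ < ε) {c : ι → ℝ → Euc d} {a b : ℝ}
    (hc : ∀ᶠ i in l, IsIntegralCurve K (Y i) (Ioo a b) (c i)) :
    ∃ γ : ℝ → Euc d, IsIntegralCurve K X (Ioo a b) γ ∧
      ∀ t ∈ Ioo a b, Filter.Tendsto (fun i => c i t) l (𝓝 (γ t)) := by
  have hlim : ∀ t, ∃ y, t ∈ Ioo a b → Filter.Tendsto (fun i => c i t) l (𝓝 y) := by
    intro t
    by_cases ht : t ∈ Ioo a b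
    · obtain ⟨y, -, hy⟩ := hK.ultrafilter_le_nhds (l.map fun i => c i t)
        (Filter.le_principal_iff.2 (hc.mono fun i hi => (hi t ht).1))
      exact ⟨y, fun _ => hy⟩
    · exact ⟨0, fun h => absurd h ht⟩
  choose γ hγ using hlim
  exact ⟨γ, isIntegralCurve_of_tendsto hK hX hY hc hγ, hγ⟩

open ODE in
-- The solution is a fixed point in a space of curves confined to the ball; the confinement is
-- recorded because limits of solutions require a compact set.
lemma exists_picard_solution_mem_closedBall {E : Type*} [NormedAddCommGroup E] [NormedSpace ℝ E]
    [CompleteSpace E] {f : ℝ → E → E} {tmin tmax : ℝ} {t₀ : Icc tmin tmax} {x₀ x : E}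
    {a r L K : NNReal} (hf : IsPicardLindelof f t₀ x₀ a r L K) (hx : x ∈ Metric.closedBall x₀ r) :
    ∃ α : ℝ → E, α t₀ = x ∧ ∀ t ∈ Icc tmin tmax, α t ∈ Metric.closedBall x₀ a ∧
      HasDerivWithinAt α (f t (α t)) (Icc tmin tmax) t := by
  obtain ⟨α, hα⟩ := FunSpace.exists_isFixedPt_next hf hx
  refine ⟨α.compProj, by rw [FunSpace.compProj_val, ← hα, FunSpace.next_apply₀],
    fun t ht => ⟨α.compProj_mem_closedBall hf.mul_max_le, ?_⟩⟩
  apply hasDerivWithinAt_picard_Icc t₀.2 hf.continuousOn_uncurry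
    α.continuous_compProj.continuousOn (fun _ ht' => α.compProj_mem_closedBall hf.mul_max_le)
    x ht |>.congr_of_mem _ ht
  intro t' ht'
  nth_rw 1 [← hα]
  rw [FunSpace.compProj_of_mem ht', FunSpace.next_apply]

/-- Uniform existence time for smooth vector fields. -/
lemma exists_curve_in_closedBall {x₀ : Euc d} {r M a : ℝ} (hr : 0 ≤ r) (hM : 0 ≤ M) (ha : 0 ≤ a)
    (hMa : M * a ≤ r / 2) {Y : Euc d → Euc d} (hY : ContDiffOn ℝ 1 Y (Metric.closedBall x₀ r))
    (hYM : ∀ x ∈ Metric.closedBall x₀ r, ‖Y x‖ ≤ M) {x : Euc d}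
    (hx : x ∈ Metric.closedBall x₀ (r / 2)) :
    ∃ γ : ℝ → Euc d, γ 0 = x ∧ IsIntegralCurve (Metric.closedBall x₀ r) Y (Ioo (-a) a) γ := by
  obtain ⟨K, hK⟩ := hY.exists_lipschitzOnWith one_ne_zero (convex_closedBall _ _)
    (isCompact_closedBall _ _)
  have hPL : IsPicardLindelof (fun _ => Y) (tmin := -a) (tmax := a) ⟨0, by linarith, ha⟩ x₀
      (.mk r hr) (.mk (r / 2) (by linarith)) (.mk M hM) K :=
    IsPicardLindelof.of_time_independent hYM hK (by
      change M * max (a - 0) (0 - -a) ≤ r - r / 2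
      rw [sub_zero, zero_sub, neg_neg, max_self]
      linarith)
  obtain ⟨γ, h0, hγ⟩ := exists_picard_solution_mem_closedBall hPL hx
  exact ⟨γ, h0, fun t ht => ⟨(hγ t (Ioo_subset_Icc_self ht)).1,
    (hγ t (Ioo_subset_Icc_self ht)).2.mono Ioo_subset_Icc_self⟩⟩

/-- `X` is a uniform limit, on `U`, of members of the family `𝓕`. -/
def IsUniformLimit (U : Set (Euc d)) (𝓕 : Set (Euc d → Euc d)) (X : Euc d → Euc d) : Prop :=
  ∀ ε > 0, ∃ Y ∈ 𝓕, ∀ x ∈ U, ‖Y x - X x‖ < ε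

/-- Integral curves of a continuous field obtained as limits of integral curves of smooth fields. -/
theorem IsUniformLimit.exists_curve {U : Set (Euc d)} {𝓕 : Set (Euc d → Euc d)}
    (h𝓕 : ∀ Y ∈ 𝓕, ContDiffOn ℝ 1 Y U) {X : Euc d → Euc d} (hX : ContinuousOn X U)
    (hlim : IsUniformLimit U 𝓕 X) {x₀ : Euc d} {r : ℝ} (hr : 0 < r)
    (hball : Metric.closedBall x₀ r ⊆ U) :
    ∃ a > 0, ∀ x ∈ Metric.closedBall x₀ (r / 2), ∀ Z : Set (Euc d), IsClosed Z →
      (∀ Y ∈ 𝓕, ∀ γ : ℝ → Euc d, γ 0 = x →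
        IsIntegralCurve (Metric.closedBall x₀ r) Y (Ioo (-a) a) γ → ∀ t ∈ Ioo (-a) a, γ t ∈ Z) →
      ∃ γ : ℝ → Euc d, γ 0 = x ∧ IsIntegralCurve (Metric.closedBall x₀ r) X (Ioo (-a) a) γ ∧
        ∀ t ∈ Ioo (-a) a, γ t ∈ Z := by
  have hK := isCompact_closedBall x₀ r
  obtain ⟨M, hM⟩ := hK.exists_bound_of_continuousOn (hX.mono hball)
  have hM0 : 0 ≤ M := (norm_nonneg _).trans (hM x₀ (Metric.mem_closedBall_self hr.le))
  -- `M + 1` bounds every field at distance at most `1` from `X`. At that speed a curve starting in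
  -- the half ball stays in the ball for the time `r / (2 (M + 1))`, whatever the field and the
  -- starting point.
  have hapos : 0 < r / (2 * (M + 1)) := by positivity
  refine ⟨r / (2 * (M + 1)), hapos, fun x hx Z hZ hstay => ?_⟩
  set a := r / (2 * (M + 1))
  have hMa : (M + 1) * a ≤ r / 2 := by
    have : (M + 1) * a = r / 2 := by
      simp only [a]
      field_simp
    exact this.le
  choose Y hY𝓕 hYX using fun n : ℕ => hlim (1 / ((n : ℝ) + 1)) Nat.one_div_pos_of_nat
  have hone : ∀ n : ℕ, 1 / ((n : ℝ) + 1) ≤ 1 := fun n => by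
    rw [div_le_one (by positivity)]
    linarith [(Nat.cast_nonneg n : (0 : ℝ) ≤ n)]
  have hYM : ∀ n, ∀ y ∈ Metric.closedBall x₀ r, ‖Y n y‖ ≤ M + 1 := fun n y hy => by
    have := norm_add_le (Y n y - X y) (X y)
    rw [sub_add_cancel] at this
    linarith [hYX n y (hball hy), hM y hy, hone n]
  choose c hc0 hc using fun n : ℕ => exists_curve_in_closedBall hr.le (by linarith) hapos.le hMa
    ((h𝓕 _ (hY𝓕 n)).mono hball) (hYM n) hx
  obtain ⟨γ, hγ, hγlim⟩ := exists_isIntegralCurve_of_ultrafilter (Filter.hyperfilter ℕ) hK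
    (hX.mono hball) (Y := Y) (c := c) (a := -a) (b := a) (fun ε hε => by
      have := (tendsto_one_div_add_atTop_nhds_zero_nat (𝕜 := ℝ)).eventually (gt_mem_nhds hε)
      rw [← Nat.cofinite_eq_atTop] at this
      exact (this.filter_mono Filter.hyperfilter_le_cofinite).mono
        fun n hn y hy => (hYX n y (hball hy)).trans hn)
    (Filter.Eventually.of_forall hc)
  have h0 : (0 : ℝ) ∈ Ioo (-a) a := ⟨by linarith, hapos⟩
  refine ⟨γ, ?_, hγ, fun t ht => hZ.mem_of_tendsto (hγlim t ht)
    (Filter.Eventually.of_forall fun n => hstay _ (hY𝓕 n) _ (hc0 n) (hc n) t ht)⟩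
  have := hγlim 0 h0
  simp only [hc0] at this
  exact tendsto_nhds_unique this tendsto_const_nhds

/-- The flow of a uniform limit of smooth fields, if it exists, is continuous for small times. -/
theorem IsUniformLimit.flowBox_zero {U : Set (Euc d)} (hU : IsOpen U) {𝓕 : Set (Euc d → Euc d)}
    (h𝓕 : ∀ Y ∈ 𝓕, ContDiffOn ℝ 1 Y U) {X : Euc d → Euc d} (hX : ContinuousOn X U)
    (hlim : IsUniformLimit U 𝓕 X) (hflow : HasFlow U X) {x₀ : Euc d} (hx₀ : x₀ ∈ U) :
    FlowBox 0 U X 0 x₀ := by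
  obtain ⟨r, hr, hball⟩ := Metric.nhds_basis_closedBall.mem_iff.1 (hU.mem_nhds hx₀)
  obtain ⟨a, ha, hex⟩ := hlim.exists_curve h𝓕 hX hr hball
  have hK := isCompact_closedBall x₀ r
  obtain ⟨M, hM⟩ := hK.exists_bound_of_continuousOn (hX.mono hball)
  have hM0 : 0 ≤ M := (norm_nonneg _).trans (hM x₀ (Metric.mem_closedBall_self hr.le))
  have hex' : ∀ x, ∃ γ : ℝ → Euc d, x ∈ Metric.ball x₀ (r / 2) →
      γ 0 = x ∧ IsIntegralCurve (Metric.closedBall x₀ r) X (Ioo (-a) a) γ := fun x => by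
    by_cases hx : x ∈ Metric.ball x₀ (r / 2)
    · obtain ⟨γ, h0, h, -⟩ := hex x (Metric.ball_subset_closedBall hx) univ isClosed_univ
        (fun _ _ _ _ _ _ _ => mem_univ _)
      exact ⟨γ, fun _ => ⟨h0, h⟩⟩
    · exact ⟨0, fun h => absurd h hx⟩
  choose c hc using hex'
  have h0 : (0 : ℝ) ∈ Ioo (-a) a := ⟨by linarith, ha⟩
  have hU' : ∀ {γ : ℝ → Euc d}, IsIntegralCurve (Metric.closedBall x₀ r) X (Ioo (-a) a) γ →
      IsIntegralCurve U X (Ioo (-a) a) γ := fun h t ht => ⟨hball (h t ht).1, (h t ht).2⟩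
  refine ⟨Ioo (-a) a ×ˢ Metric.ball x₀ (r / 2), isOpen_Ioo.prod Metric.isOpen_ball,
    ⟨h0, Metric.mem_ball_self (half_pos hr)⟩, fun p => c p.2 p.1, contDiffOn_zero.2 ?_, ?_⟩
  -- Joint continuity follows from the Lipschitz property in time, the speed being at most `M`, and
  -- continuity in the initial point at each fixed time.
  · refine continuousOn_prod_of_continuousOn_lipschitzOnWith _ ⟨M, hM0⟩ (fun t ht => ?_)
      (fun x hx => ?_)
    · intro x hx
      rw [ContinuousWithinAt, Filter.tendsto_iff_ultrafilter]
      intro l hl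
      have hlball : ∀ᶠ y in (l : Filter (Euc d)), y ∈ Metric.ball x₀ (r / 2) :=
        hl self_mem_nhdsWithin
      -- Along any ultrafilter converging to `x` the curves converge to an integral curve issued
      -- from `x`; uniqueness leaves only one candidate.
      obtain ⟨γ, hγ, hγlim⟩ := exists_isIntegralCurve_of_ultrafilter l hK (hX.mono hball)
        (Y := fun _ => X) (c := c) (a := -a) (b := a)
        (fun ε hε => Filter.Eventually.of_forall fun _ y _ => by simpa using hε)
        (hlball.mono fun y hy => (hc y hy).2)
      have hγ0 : γ 0 = x := by
        refine tendsto_nhds_unique (hγlim 0 h0) ?_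
        have hid : Filter.Tendsto (fun y : Euc d => y) l (𝓝 x) := hl.trans nhdsWithin_le_nhds
        exact hid.congr' (hlball.mono fun y hy => (hc y hy).1.symm)
      have := hflow.eqOn_Ioo (hU' hγ) (hU' (hc x hx).2) h0 (hγ0.trans (hc x hx).1.symm) ht
      exact this ▸ hγlim t ht
    · refine LipschitzOnWith.of_dist_le_mul fun s hs t ht => ?_
      have := (hc x hx).2.norm_sub_sub_le hs ht (v := 0) (C := M) (fun u hu => by
        rw [sub_zero]
        exact hM _ ((hc x hx).2 u (ordConnected_Ioo.uIcc_subset ht hs hu)).1)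
      rw [smul_zero, sub_zero] at this
      rw [dist_eq_norm, Real.dist_eq]
      exact this
  · rintro ⟨t, x⟩ ⟨ht, hx⟩
    have := (hU' (hc x hx).2).flowsTo h0 ht
    rwa [(hc x hx).1, sub_zero] at this

end Limits


/-! ### Compositions of flows indexed by lists -/

section Reaches

variable {d : ℕ}

/-- Following successively the flows of the fields in the list, starting with the last one, leads
from `x` to `y`. -/
def Reaches (U : Set (Euc d)) : List ((Euc d → Euc d) × ℝ) → Euc d → Euc d → Prop
  | [], x, y => x = y
  | e :: l, x, y => ∃ z, Reaches U l x z ∧ FlowsTo U e.1 e.2 z y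

variable {U : Set (Euc d)}

lemma concatTo_succ_iff {N : ℕ} {X : Fin (N + 1) → Euc d → Euc d} {t : Fin (N + 1) → ℝ}
    {x y : Euc d} : ConcatTo U X t x y ↔
      ∃ z, ConcatTo U (fun j => X j.succ) (fun j => t j.succ) x z ∧ FlowsTo U (X 0) (t 0) z y := by
  constructor
  · rintro ⟨p, hx, hy, hp⟩
    exact ⟨p (Fin.succ 0), ⟨fun j => p j.succ, hx, rfl, fun j => hp j.succ⟩, hy ▸ hp 0⟩
  · rintro ⟨z, ⟨p, hx, hz, hp⟩, h⟩
    refine ⟨Fin.cons y p, ?_, rfl, fun j => ?_⟩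
    · rw [← Fin.succ_last, Fin.cons_succ, hx]
    · refine Fin.cases ?_ (fun i => ?_) j
      · rw [Fin.cons_succ, Fin.castSucc_zero, Fin.cons_zero, hz]
        exact h
      · rw [Fin.cons_succ, ← Fin.succ_castSucc, Fin.cons_succ]
        exact hp i

lemma concatTo_iff_reaches {N : ℕ} {X : Fin N → Euc d → Euc d} {t : Fin N → ℝ} {x y : Euc d} :
    ConcatTo U X t x y ↔ Reaches U (List.ofFn fun j => (X j, t j)) x y := by
  induction N generalizing y with
  | zero =>
    constructor
    · rintro ⟨p, hx, hy, -⟩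
      exact hx.symm.trans hy
    · rintro (rfl : x = y)
      exact ⟨fun _ => x, rfl, rfl, fun j => j.elim0⟩
  | succ N ih =>
    rw [concatTo_succ_iff, List.ofFn_succ]
    exact exists_congr fun z => and_congr_left fun _ => ih

lemma reaches_iff_concatTo {l : List ((Euc d → Euc d) × ℝ)} {x y : Euc d} :
    Reaches U l x y ↔ ConcatTo U (fun j => (l.get j).1) (fun j => (l.get j).2) x y := by
  rw [concatTo_iff_reaches]
  simp

lemma reaches_append {l l' : List ((Euc d → Euc d) × ℝ)} {x y : Euc d} :
    Reaches U (l ++ l') x y ↔ ∃ z, Reaches U l' x z ∧ Reaches U l z y := by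
  induction l generalizing y with
  | nil => simp [Reaches]
  | cons e l ih =>
    simp only [List.cons_append, Reaches, ih]
    constructor
    · rintro ⟨z, ⟨w, hw, hwz⟩, h⟩
      exact ⟨w, hw, z, hwz, h⟩
    · rintro ⟨w, hw, z, hwz, h⟩
      exact ⟨z, ⟨w, hw, hwz⟩, h⟩

lemma reaches_singleton {e : (Euc d → Euc d) × ℝ} {x y : Euc d} :
    Reaches U [e] x y ↔ FlowsTo U e.1 e.2 x y := by
  simp [Reaches]

lemma Reaches.unique {l : List ((Euc d → Euc d) × ℝ)} (hl : ∀ e ∈ l, HasFlow U e.1)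
    {x y z : Euc d} (h : Reaches U l x y) (h' : Reaches U l x z) : y = z := by
  induction l generalizing y z with
  | nil => exact h.symm.trans h'
  | cons e l ih =>
    obtain ⟨w, hw, h⟩ := h
    obtain ⟨w', hw', h'⟩ := h'
    obtain rfl := ih (fun e he => hl e (List.mem_cons_of_mem _ he)) hw hw'
    exact h.unique (hl _ List.mem_cons_self) h'

/-- The list describing the inverse of a composition of flows. -/
def inverseList (l : List ((Euc d → Euc d) × ℝ)) : List ((Euc d → Euc d) × ℝ) :=
  (l.map fun e => (e.1, -e.2)).reverse

lemma mem_inverseList {l : List ((Euc d → Euc d) × ℝ)} {e : (Euc d → Euc d) × ℝ} :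
    e ∈ inverseList l ↔ (e.1, -e.2) ∈ l := by
  simp only [inverseList, List.mem_reverse, List.mem_map]
  constructor
  · rintro ⟨e', he', rfl⟩
    simpa using he'
  · intro h
    exact ⟨_, h, by simp⟩

lemma Reaches.symm {l : List ((Euc d → Euc d) × ℝ)} (hl : ∀ e ∈ l, HasFlow U e.1)
    {x y : Euc d} (h : Reaches U l x y) : Reaches U (inverseList l) y x := by
  induction l generalizing y with
  | nil => exact Eq.symm h
  | cons e l ih =>
    obtain ⟨w, hw, h⟩ := h
    have := ih (fun e he => hl e (List.mem_cons_of_mem _ he)) hw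
    simp only [inverseList, List.map_cons, List.reverse_cons]
    exact reaches_append.2 ⟨w, reaches_singleton.2 (h.symm (hl _ List.mem_cons_self)), this⟩

lemma Reaches.mem_right {l : List ((Euc d → Euc d) × ℝ)} (hne : l ≠ []) {x y : Euc d}
    (h : Reaches U l x y) : y ∈ U := by
  cases l with
  | nil => exact absurd rfl hne
  | cons e l =>
    obtain ⟨z, -, h⟩ := h
    exact h.mem_right

lemma Reaches.mem_right_of_mem {l : List ((Euc d → Euc d) × ℝ)} {x y : Euc d}
    (hx : x ∈ U) (h : Reaches U l x y) : y ∈ U := by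
  cases l with
  | nil => exact (show x = y from h) ▸ hx
  | cons e l => exact h.mem_right (List.cons_ne_nil _ _)

end Reaches

/-! ### Orbits and the orbit topology -/

section OrbitBasics

variable {d : ℕ} {U : Set (Euc d)} {𝓕 : Set (Euc d → Euc d)} {m : Euc d}

lemma mem_orbit_iff {y : Euc d} : y ∈ orbit U 𝓕 m ↔
    ∃ l : List ((Euc d → Euc d) × ℝ), l ≠ [] ∧ (∀ e ∈ l, e.1 ∈ 𝓕) ∧ Reaches U l m y := by
  constructor
  · rintro ⟨N, hN, X, hX, t, h⟩
    refine ⟨List.ofFn fun j => (X j, t j), ?_, ?_, concatTo_iff_reaches.1 h⟩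
    · rw [Ne, List.ofFn_eq_nil_iff]
      exact hN.ne'
    · intro e he
      obtain ⟨j, rfl⟩ := List.mem_ofFn.1 he
      exact hX j
  · rintro ⟨l, hne, hl, h⟩
    exact ⟨l.length, List.length_pos_iff.2 hne, _, fun j => hl _ (List.get_mem _ _), _,
      reaches_iff_concatTo.1 h⟩

lemma orbit_subset : orbit U 𝓕 m ⊆ U := fun y hy => by
  obtain ⟨l, hne, -, h⟩ := mem_orbit_iff.1 hy
  exact h.mem_right hne

lemma orbit_mono {𝓖 : Set (Euc d → Euc d)} (h : 𝓕 ⊆ 𝓖) : orbit U 𝓕 m ⊆ orbit U 𝓖 m := by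
  rintro y ⟨N, hN, X, hX, t, h'⟩
  exact ⟨N, hN, X, fun j => h (hX j), t, h'⟩

/-- Orbit points use at least one flow; a zero-time flow of some member of `𝓕` is prefixed, so that
the empty list is allowed. -/
lemma Reaches.mem_orbit (hne : 𝓕.Nonempty) (hm : m ∈ U) {l : List ((Euc d → Euc d) × ℝ)}
    (hl : ∀ e ∈ l, e.1 ∈ 𝓕) {y : Euc d} (h : Reaches U l m y) : y ∈ orbit U 𝓕 m := by
  obtain ⟨X, hX⟩ := hne
  refine mem_orbit_iff.2 ⟨(X, 0) :: l, List.cons_ne_nil _ _, ?_, y, h,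
    FlowsTo.zero (h.mem_right_of_mem hm)⟩
  intro e he
  rcases List.mem_cons.1 he with rfl | he
  · exact hX
  · exact hl e he

lemma mem_orbit_self (hne : 𝓕.Nonempty) (hm : m ∈ U) : m ∈ orbit U 𝓕 m :=
  Reaches.mem_orbit (l := []) hne hm (by simp) rfl

lemma orbit_trans {x y : Euc d} (hx : x ∈ orbit U 𝓕 m) (hy : y ∈ orbit U 𝓕 x) :
    y ∈ orbit U 𝓕 m := by
  obtain ⟨l, hne, hl, h⟩ := mem_orbit_iff.1 hx
  obtain ⟨l', hne', hl', h'⟩ := mem_orbit_iff.1 hy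
  refine mem_orbit_iff.2 ⟨l' ++ l, by simp [hne], fun e he => ?_, reaches_append.2 ⟨x, h, h'⟩⟩
  rcases List.mem_append.1 he with he | he
  · exact hl' e he
  · exact hl e he

lemma orbit_symm (hF : ∀ X ∈ 𝓕, HasFlow U X) {x : Euc d} (hx : x ∈ orbit U 𝓕 m) :
    m ∈ orbit U 𝓕 x := by
  obtain ⟨l, hne, hl, h⟩ := mem_orbit_iff.1 hx
  exact mem_orbit_iff.2 ⟨inverseList l, by simpa [inverseList] using hne,
    fun e he => hl (e.1, -e.2) (mem_inverseList.1 he), h.symm fun e he => hF _ (hl e he)⟩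

lemma OrbitSpace.incl_injective :
    Function.Injective (OrbitSpace.incl (U := U) (𝓕 := 𝓕) (m := m)) :=
  Subtype.val_injective

lemma OrbitSpace.range_incl : range (OrbitSpace.incl (U := U) (𝓕 := 𝓕) (m := m)) = orbit U 𝓕 m :=
  Subtype.range_val

lemma continuous_concatMap {N : ℕ} (hN : 0 < N) (X : Fin N → Euc d → Euc d) (hX : ∀ j, X j ∈ 𝓕) :
    Continuous (concatMap U 𝓕 m hN X hX) :=
  continuous_iff_coinduced_le.2 (le_iSup_of_le N (le_iSup_of_le hN (le_iSup_of_le X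
    (le_iSup_of_le hX le_rfl))))

lemma OrbitSpace.continuous_dom {Z : Type*} [TopologicalSpace Z] {g : OrbitSpace U 𝓕 m → Z}
    (h : ∀ (N : ℕ) (hN : 0 < N) (X : Fin N → Euc d → Euc d) (hX : ∀ j, X j ∈ 𝓕),
      Continuous (g ∘ concatMap U 𝓕 m hN X hX)) : Continuous g := by
  refine continuous_iSup_dom.2 fun N => continuous_iSup_dom.2 fun hN =>
    continuous_iSup_dom.2 fun X => continuous_iSup_dom.2 fun hX => continuous_coinduced_dom.2 ?_
  exact h N hN X hX

lemma concatTo_concatMap {N : ℕ} (hN : 0 < N) (X : Fin N → Euc d → Euc d) (hX : ∀ j, X j ∈ 𝓕)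
    (t : concatDom U X m) : ConcatTo U X t.1 m (concatMap U 𝓕 m hN X hX t).incl :=
  t.2.choose_spec

lemma ConcatTo.unique {N : ℕ} {X : Fin N → Euc d → Euc d} (hX : ∀ j, HasFlow U (X j))
    {t : Fin N → ℝ} {x y z : Euc d} (h : ConcatTo U X t x y) (h' : ConcatTo U X t x z) : y = z := by
  refine (concatTo_iff_reaches.1 h).unique ?_ (concatTo_iff_reaches.1 h')
  intro e he
  obtain ⟨j, rfl⟩ := List.mem_ofFn.1 he
  exact hX j

end OrbitBasics

/-! ### Parametrised compositions of flows -/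

section Families

variable {d : ℕ} {U : Set (Euc d)}

/-- A list of vector fields with times depending on a parameter, evaluated at a parameter. -/
def evalList {P : Type*} (L : List ((Euc d → Euc d) × (P → ℝ))) (p : P) :
    List ((Euc d → Euc d) × ℝ) :=
  L.map fun e => (e.1, e.2 p)

/-- Reparametrisation of a list of vector fields with times depending on a parameter. -/
def reparam {P Q : Type*} (g : Q → P) (L : List ((Euc d → Euc d) × (P → ℝ))) :
    List ((Euc d → Euc d) × (Q → ℝ)) :=
  L.map fun e => (e.1, e.2 ∘ g)

@[simp] lemma evalList_reparam {P Q : Type*} (g : Q → P) (L : List ((Euc d → Euc d) × (P → ℝ)))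
    (q : Q) : evalList (reparam g L) q = evalList L (g q) := by
  simp [evalList, reparam]

@[simp] lemma evalList_append {P : Type*} (L L' : List ((Euc d → Euc d) × (P → ℝ))) (p : P) :
    evalList (L ++ L') p = evalList L p ++ evalList L' p := List.map_append

lemma forall_mem_evalList {P : Type*} {L : List ((Euc d → Euc d) × (P → ℝ))}
    {R : (Euc d → Euc d) → Prop} (hL : ∀ e ∈ L, R e.1) (p : P) : ∀ e ∈ evalList L p, R e.1 := by
  intro e he
  obtain ⟨e', he', rfl⟩ := List.mem_map.1 he
  exact hL e' he'

/-- A family of points of the orbit reached by flows with continuously varying times is continuous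
for the orbit topology. -/
theorem continuous_of_reaches {𝓕 : Set (Euc d → Euc d)} {m : Euc d}
    (hF : ∀ X ∈ 𝓕, HasFlow U X) {P : Type*} [TopologicalSpace P]
    {L : List ((Euc d → Euc d) × (P → ℝ))} (hne : L ≠ [])
    (hL : ∀ e ∈ L, e.1 ∈ 𝓕 ∧ Continuous e.2) {h : P → OrbitSpace U 𝓕 m}
    (hh : ∀ p, Reaches U (evalList L p) m (h p).incl) : Continuous h := by
  set X : Fin L.length → Euc d → Euc d := fun j => (L.get j).1
  set t : P → Fin L.length → ℝ := fun p j => (L.get j).2 p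
  have hX : ∀ j, X j ∈ 𝓕 := fun j => (hL _ (List.get_mem _ _)).1
  have ht : Continuous t := continuous_pi fun j => (hL _ (List.get_mem _ _)).2
  have hc : ∀ p, ConcatTo U X (t p) m (h p).incl := fun p => by
    rw [concatTo_iff_reaches]
    convert hh p using 1
    rw [evalList]
    conv_rhs => rw [← List.ofFn_get L, List.map_ofFn]
    rfl
  have : h = concatMap U 𝓕 m (List.length_pos_iff.2 hne) X hX ∘ fun p => ⟨t p, _, hc p⟩ := by
    funext p
    exact OrbitSpace.incl_injective ((hc p).unique (fun j => hF _ (hX j))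
      (concatTo_concatMap _ X hX ⟨t p, _, hc p⟩))
  rw [this]
  exact (continuous_concatMap _ X hX).comp (ht.subtype_mk _)

/-- Letting the time of the flow applied last run from `0` to its value gives a path, continuous for
the orbit topology, from a point reached by a shorter list; induction on the list joins every point
to `m`. -/
theorem orbitSpace_connectedSpace {𝓕 : Set (Euc d → Euc d)} {m : Euc d}
    (hF : ∀ X ∈ 𝓕, HasFlow U X) (hne : 𝓕.Nonempty) (hm : m ∈ U) :
    ConnectedSpace (OrbitSpace U 𝓕 m) := by
  set o : OrbitSpace U 𝓕 m := ⟨m, mem_orbit_self hne hm⟩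
  have key : ∀ l : List ((Euc d → Euc d) × ℝ), (∀ e ∈ l, e.1 ∈ 𝓕) →
      ∀ q : OrbitSpace U 𝓕 m, Reaches U l m q.incl → q ∈ connectedComponent o := by
    intro l
    induction l with
    | nil =>
      intro _ q hq
      have : o = q := OrbitSpace.incl_injective hq
      exact this ▸ mem_connectedComponent
    | cons e l ih =>
      rintro hl q ⟨z, hz, γ, h0, h1, hγ⟩
      have hl' : ∀ e ∈ l, e.1 ∈ 𝓕 := fun e he => hl e (List.mem_cons_of_mem _ he)
      have hez : ∀ s ∈ uIcc 0 e.2, FlowsTo U e.1 s z (γ s) := fun s hs =>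
        ⟨γ, h0, rfl, hγ.mono (uIcc_subset_uIcc_left hs)⟩
      have hreach : ∀ s ∈ uIcc 0 e.2, Reaches U ((e.1, s) :: l) m (γ s) := fun s hs =>
        ⟨z, hz, hez s hs⟩
      have hmem : ∀ s : uIcc 0 e.2, γ s ∈ orbit U 𝓕 m := fun s =>
        (hreach s s.2).mem_orbit hne hm fun e' he' => by
          rcases List.mem_cons.1 he' with rfl | he'
          · exact hl e List.mem_cons_self
          · exact hl' e' he'
      set c : uIcc 0 e.2 → OrbitSpace U 𝓕 m := fun s => ⟨γ s, hmem s⟩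
      have hc : Continuous c := by
        refine continuous_of_reaches hF (h := c)
          (L := (e.1, fun s : uIcc 0 e.2 => (s : ℝ)) :: l.map fun e => (e.1, fun _ => e.2)) (by simp) ?_ ?_
        · intro e' he'
          rcases List.mem_cons.1 he' with rfl | he'
          · exact ⟨hl e List.mem_cons_self, continuous_subtype_val⟩
          · obtain ⟨e'', he'', rfl⟩ := List.mem_map.1 he'
            exact ⟨hl' e'' he'', continuous_const⟩
        · intro s
          have : Reaches U ((e.1, (s : ℝ)) :: l) m (c s).incl := hreach s s.2
          simpa [evalList, Function.comp_def] using this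
      have hpre : IsPreconnected (range c) := by
        have : PreconnectedSpace (uIcc 0 e.2) :=
          Subtype.preconnectedSpace isPreconnected_uIcc
        exact isPreconnected_range hc
      have hz0 : c ⟨0, left_mem_uIcc⟩ ∈ connectedComponent o :=
        ih hl' _ (by change Reaches U l m (γ 0); rwa [h0])
      have hsub := hpre.subset_connectedComponent (mem_range_self ⟨0, left_mem_uIcc⟩)
      rw [← connectedComponent_eq hz0] at hsub
      have hq : c ⟨e.2, right_mem_uIcc⟩ = q := OrbitSpace.incl_injective h1
      exact hq ▸ hsub (mem_range_self _)
  refine connectedSpace_iff_connectedComponent.2 ⟨o, eq_univ_of_forall fun q => ?_⟩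
  obtain ⟨l, -, hl, h⟩ := mem_orbit_iff.1 (show q.incl ∈ orbit U 𝓕 m from q.2)
  exact key l hl q h

end Families


/-! ### Arcs: parametrised compositions of flows tangent to a distribution -/

section Arcs

variable {d : ℕ}

/-- `Θ` is, on the open set `A`, the map which associates with `(p, x)` the point reached from `x`
by the flows listed in `L` at the parameter `p`; if it is differentiable, its derivative maps
the parameter directions and the distribution `D` to the distribution `D`. -/
structure IsArc (n : WithTop ℕ∞) (U : Set (Euc d)) (D : Euc d → Submodule ℝ (Euc d))
    {P : Type} [NormedAddCommGroup P] [NormedSpace ℝ P]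
    (L : List ((Euc d → Euc d) × (P → ℝ))) (A : Set (P × Euc d)) (Θ : P × Euc d → Euc d) :
    Prop where
  isOpen : IsOpen A
  contDiffOn : ContDiffOn ℝ n Θ A
  reaches : ∀ q ∈ A, Reaches U (evalList L q.1) q.2 (Θ q)
  horizontal : n ≠ 0 → ∀ q ∈ A, ∀ v : P, ∀ w ∈ D q.2, fderiv ℝ Θ q (v, w) ∈ D (Θ q)

variable {n : WithTop ℕ∞} {U : Set (Euc d)} {D : Euc d → Submodule ℝ (Euc d)}
  {P Q R : Type} [NormedAddCommGroup P] [NormedSpace ℝ P] [NormedAddCommGroup Q]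
  [NormedSpace ℝ Q] [NormedAddCommGroup R] [NormedSpace ℝ R]

lemma IsArc.differentiableAt {L : List ((Euc d → Euc d) × (P → ℝ))} {A : Set (P × Euc d)}
    {Θ : P × Euc d → Euc d} (h : IsArc n U D L A Θ) (hn : n ≠ 0) {q : P × Euc d} (hq : q ∈ A) :
    DifferentiableAt ℝ Θ q :=
  (h.contDiffOn.contDiffAt (h.isOpen.mem_nhds hq)).differentiableAt hn

/-- The domain of the composition of two arcs. -/
def compDomain (A : Set (P × Euc d)) (A' : Set (Q × Euc d)) (Θ' : Q × Euc d → Euc d)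
    (g : R → P) (g' : R → Q) : Set (R × Euc d) :=
  {q | (g' q.1, q.2) ∈ A' ∧ (g q.1, Θ' (g' q.1, q.2)) ∈ A}

lemma IsArc.comp_hasFDerivAt {L : List ((Euc d → Euc d) × (P → ℝ))} {A : Set (P × Euc d)}
    {Θ : P × Euc d → Euc d} (h : IsArc n U D L A Θ) {L' : List ((Euc d → Euc d) × (Q → ℝ))}
    {A' : Set (Q × Euc d)} {Θ' : Q × Euc d → Euc d} (h' : IsArc n U D L' A' Θ')
    {g : R → P} (hg : ContDiff ℝ n g) {g' : R → Q} (hg' : ContDiff ℝ n g') (hn : n ≠ 0)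
    {q : R × Euc d} (hq : q ∈ compDomain A A' Θ' g g') (v : R) (w : Euc d) :
    fderiv ℝ (fun q : R × Euc d => Θ (g q.1, Θ' (g' q.1, q.2))) q (v, w) =
      fderiv ℝ Θ (g q.1, Θ' (g' q.1, q.2)) (fderiv ℝ g q.1 v,
        fderiv ℝ Θ' (g' q.1, q.2) (fderiv ℝ g' q.1 v, w)) := by
  have dg : HasFDerivAt (fun q : R × Euc d => g q.1)
      ((fderiv ℝ g q.1).comp (ContinuousLinearMap.fst ℝ R (Euc d))) q :=
    ((hg.differentiable hn) q.1).hasFDerivAt.comp q hasFDerivAt_fst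
  have dg' : HasFDerivAt (fun q : R × Euc d => g' q.1)
      ((fderiv ℝ g' q.1).comp (ContinuousLinearMap.fst ℝ R (Euc d))) q :=
    ((hg'.differentiable hn) q.1).hasFDerivAt.comp q hasFDerivAt_fst
  have d1 := ((h'.differentiableAt hn hq.1).hasFDerivAt).comp q (dg'.prodMk hasFDerivAt_snd)
  have d2 := ((h.differentiableAt hn hq.2).hasFDerivAt).comp q (dg.prodMk d1)
  exact congrArg (fun A : R × Euc d →L[ℝ] Euc d => A (v, w)) d2.fderiv

theorem IsArc.comp {L : List ((Euc d → Euc d) × (P → ℝ))} {A : Set (P × Euc d)}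
    {Θ : P × Euc d → Euc d} (h : IsArc n U D L A Θ) {L' : List ((Euc d → Euc d) × (Q → ℝ))}
    {A' : Set (Q × Euc d)} {Θ' : Q × Euc d → Euc d} (h' : IsArc n U D L' A' Θ')
    {g : R → P} (hg : ContDiff ℝ n g) {g' : R → Q} (hg' : ContDiff ℝ n g') :
    IsArc n U D (reparam g L ++ reparam g' L') (compDomain A A' Θ' g g')
      (fun q => Θ (g q.1, Θ' (g' q.1, q.2))) := by
  have c1 : ContDiff ℝ n fun q : R × Euc d => (g' q.1, q.2) :=
    (hg'.comp contDiff_fst).prodMk contDiff_snd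
  have o1 : IsOpen ((fun q : R × Euc d => (g' q.1, q.2)) ⁻¹' A') := h'.isOpen.preimage c1.continuous
  have c2 : ContDiffOn ℝ n (fun q : R × Euc d => (g q.1, Θ' (g' q.1, q.2)))
      ((fun q : R × Euc d => (g' q.1, q.2)) ⁻¹' A') :=
    (hg.comp contDiff_fst).contDiffOn.prodMk (h'.contDiffOn.comp c1.contDiffOn fun q hq => hq)
  refine ⟨c2.continuousOn.isOpen_inter_preimage o1 h.isOpen,
    h.contDiffOn.comp (c2.mono fun q hq => hq.1) fun q hq => hq.2, fun q hq => ?_,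
    fun hn q hq v w hw => ?_⟩
  · rw [evalList_append, evalList_reparam, evalList_reparam]
    exact reaches_append.2 ⟨_, h'.reaches _ hq.1, h.reaches _ hq.2⟩
  · rw [h.comp_hasFDerivAt h' hg hg' hn hq]
    exact h.horizontal hn _ hq.2 _ _ (h'.horizontal hn _ hq.1 _ _ hw)

/-- The flow of `X` is of class `Cⁿ`, and preserves `D` if `n ≠ 0`. -/
structure IsFlowAdapted (n : WithTop ℕ∞) (U : Set (Euc d)) (D : Euc d → Submodule ℝ (Euc d))
    (X : Euc d → Euc d) : Prop where
  hasFlow : HasFlow U X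
  flowBox : ∀ x ∈ U, FlowBox n U X 0 x
  mem : n ≠ 0 → ∀ x ∈ U, X x ∈ D x
  map_mem : n ≠ 0 → ∀ (t : ℝ) (A : Set (Euc d)) (θ : Euc d → Euc d), IsOpen A →
    ContDiffOn ℝ n θ A → (∀ x ∈ A, FlowsTo U X t x (θ x)) →
      ∀ x ∈ A, ∀ w ∈ D x, fderiv ℝ θ x w ∈ D (θ x)

/-- The flow map is, in the time variable, an integral curve. -/
lemma hasDerivAt_flow {X : Euc d → Euc d} (hX : HasFlow U X) {A : Set (ℝ × Euc d)} (hA : IsOpen A)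
    {Θ : ℝ × Euc d → Euc d} (hΘ : ∀ p ∈ A, FlowsTo U X p.1 p.2 (Θ p)) {q : ℝ × Euc d}
    (hq : q ∈ A) : HasDerivAt (fun t => Θ (t, q.2)) (X (Θ q)) q.1 := by
  obtain ⟨a, b, h0, ht, γ, hγ, hγ0, hγt⟩ := (hΘ q hq).exists_Ioo hX
  have := hγ.hasDerivAt (isOpen_Ioo.mem_nhds ht)
  rw [hγt] at this
  refine this.congr_of_eventuallyEq ?_
  have hc : Continuous fun t : ℝ => (t, q.2) := by fun_prop
  filter_upwards [isOpen_Ioo.mem_nhds ht, (hA.preimage hc).mem_nhds hq] with t ht' htA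
  refine (hΘ _ htA).unique hX ?_
  have := hγ.flowsTo h0 ht'
  rwa [hγ0, sub_zero] at this

/-- The time derivative of the flow map is `X`, with values in `D`, and its space derivative is that
of a fixed-time map, which preserves `D`. -/
theorem IsFlowAdapted.isArc {X : Euc d → Euc d} (hX : IsFlowAdapted n U D X) {t : ℝ} {x y : Euc d}
    (h : FlowsTo U X t x y) :
    ∃ (A : Set (ℝ × Euc d)) (Θ : ℝ × Euc d → Euc d), (t, x) ∈ A ∧ IsArc n U D [(X, id)] A Θ := by
  obtain ⟨A, hA, hmem, Θ, hΘ, hfl⟩ := h.flowBox hX.hasFlow hX.flowBox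
  refine ⟨A, Θ, hmem, hA, hΘ, fun q hq => reaches_singleton.2 (hfl q hq), fun hn q hq v w hw => ?_⟩
  have hd : DifferentiableAt ℝ Θ q := (hΘ.contDiffAt (hA.mem_nhds hq)).differentiableAt hn
  have h1 : HasDerivAt (fun t => Θ (t, q.2)) (fderiv ℝ Θ q (1, 0)) q.1 :=
    hd.hasFDerivAt.comp_hasDerivAt q.1 ((hasDerivAt_id q.1).prodMk (hasDerivAt_const q.1 q.2))
  have h2 := h1.unique (hasDerivAt_flow hX.hasFlow hA hfl hq)
  have hc : ContDiff ℝ n fun x : Euc d => (q.1, x) := contDiff_const.prodMk contDiff_id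
  have h3 := hX.map_mem hn q.1 ((fun x : Euc d => (q.1, x)) ⁻¹' A) (fun x => Θ (q.1, x))
    (hA.preimage hc.continuous) (hΘ.comp hc.contDiffOn fun x hx => hx) (fun x hx => hfl _ hx)
    q.2 hq w hw
  have h4 : HasFDerivAt (fun x => Θ (q.1, x))
      ((fderiv ℝ Θ q).comp ((0 : Euc d →L[ℝ] ℝ).prod (ContinuousLinearMap.id ℝ (Euc d)))) q.2 :=
    hd.hasFDerivAt.comp q.2 ((hasFDerivAt_const q.1 q.2).prodMk (hasFDerivAt_id q.2))
  rw [h4.fderiv] at h3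
  have h5 : ((v, w) : ℝ × Euc d) = v • ((1 : ℝ), (0 : Euc d)) + ((0 : ℝ), w) := by simp
  rw [h5, map_add, map_smul, h2]
  exact (D (Θ q)).add_mem ((D (Θ q)).smul_mem _ (hX.mem hn _ (hfl q hq).mem_right)) h3

lemma isArc_nil : IsArc n U D (P := P) [] univ Prod.snd :=
  ⟨isOpen_univ, contDiff_snd.contDiffOn, fun _ _ => rfl, fun _ q _ v w hw => by
    rw [fderiv_snd]
    exact hw⟩

/-- Near a point where a parametrised composition of flows is defined, it is an arc. -/
theorem exists_isArc {L : List ((Euc d → Euc d) × (P → ℝ))}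
    (hL : ∀ e ∈ L, IsFlowAdapted n U D e.1 ∧ ContDiff ℝ n e.2) {p : P} {x y : Euc d}
    (h : Reaches U (evalList L p) x y) :
    ∃ (A : Set (P × Euc d)) (Θ : P × Euc d → Euc d), (p, x) ∈ A ∧ IsArc n U D L A Θ := by
  induction L generalizing y with
  | nil => exact ⟨univ, Prod.snd, mem_univ _, isArc_nil⟩
  | cons e L ih =>
    obtain ⟨z, hz, hzy⟩ := h
    obtain ⟨A', Θ', hmem', h'⟩ := ih (fun e he => hL e (List.mem_cons_of_mem _ he)) hz
    obtain ⟨he, hτ⟩ := hL e List.mem_cons_self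
    obtain ⟨A, Θ, hmem, h⟩ := he.isArc hzy
    have hz' : Θ' (p, x) = z := (h'.reaches _ hmem').unique (forall_mem_evalList (fun e he =>
      (hL e (List.mem_cons_of_mem _ he)).1.hasFlow) p) hz
    have hcomp := h.comp h' (g := e.2) (g' := id) hτ contDiff_id
    have hL' : reparam e.2 [(e.1, id)] ++ reparam id L = e :: L := by simp [reparam]
    rw [hL'] at hcomp
    refine ⟨_, _, ?_, hcomp⟩
    exact ⟨hmem', by simpa [hz'] using hmem⟩

end Arcs

/-! ### The distribution spanned by push-forwards -/

section Distribution

variable {d : ℕ} {U : Set (Euc d)} {𝓕 : Set (Euc d → Euc d)}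

lemma isPushforward_mono {𝓖 : Set (Euc d → Euc d)} (h : 𝓕 ⊆ 𝓖) {D : Set (Euc d)}
    {Y : Euc d → Euc d} (hY : IsPushforward U 𝓕 D Y) : IsPushforward U 𝓖 D Y := by
  obtain ⟨X₀, hX₀, N, hN, X, hX, t, φ, h'⟩ := hY
  exact ⟨X₀, h hX₀, N, hN, X, fun j => h (hX j), t, φ, h'⟩

lemma pushforwardSpan_mono {𝓖 : Set (Euc d → Euc d)} (h : 𝓕 ⊆ 𝓖) (x : Euc d) :
    pushforwardSpan U 𝓕 x ≤ pushforwardSpan U 𝓖 x := by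
  refine Submodule.span_mono ?_
  rintro v ⟨D, Y, hY, hx, rfl⟩
  exact ⟨D, Y, isPushforward_mono h hY, hx, rfl⟩

/-- `X` is its own push-forward through its flow at time `0`. -/
lemma mem_pushforwardSpan {X : Euc d → Euc d} (hX : X ∈ 𝓕) (hU : IsOpen U) {x : Euc d}
    (hx : x ∈ U) : X x ∈ pushforwardSpan U 𝓕 x := by
  refine Submodule.subset_span ⟨U, X, ⟨X, hX, 1, one_pos, fun _ => X, fun _ => hX, fun _ => 0,
    OpenPartialHomeomorph.ofSet U hU, fun y hy => ?_, Subset.rfl, contDiffOn_id, contDiffOn_id,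
    rfl, fun y _ => ?_⟩, hx, rfl⟩
  · rw [concatTo_succ_iff]
    exact ⟨y, ⟨fun _ => y, rfl, rfl, fun j => j.elim0⟩, FlowsTo.zero hy⟩
  · simp

/-- The flow of a field, at a given time, is a local diffeomorphism. -/
theorem exists_flow_diffeo {n : WithTop ℕ∞} {X : Euc d → Euc d} (hX : HasFlow U X)
    (hbox : ∀ x ∈ U, FlowBox n U X 0 x) {t : ℝ} {x y : Euc d} (h : FlowsTo U X t x y) :
    ∃ ψ : OpenPartialHomeomorph (Euc d) (Euc d), x ∈ ψ.source ∧
      (∀ z ∈ ψ.source, FlowsTo U X t z (ψ z)) ∧ ContDiffOn ℝ n ψ ψ.source ∧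
      ContDiffOn ℝ n ψ.symm ψ.target := by
  obtain ⟨A, hA, hmem, Θ, hΘ, hfl⟩ := h.flowBox hX hbox
  obtain ⟨A', hA', hmem', Θ', hΘ', hfl'⟩ := (h.symm hX).flowBox hX hbox
  have c1 : ContDiff ℝ n fun z : Euc d => (t, z) := contDiff_const.prodMk contDiff_id
  have c2 : ContDiff ℝ n fun z : Euc d => (-t, z) := contDiff_const.prodMk contDiff_id
  have d1 : ContDiffOn ℝ n (fun z => Θ (t, z)) ((fun z => (t, z)) ⁻¹' A) :=
    hΘ.comp c1.contDiffOn fun z hz => hz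
  have d2 : ContDiffOn ℝ n (fun z => Θ' (-t, z)) ((fun z => (-t, z)) ⁻¹' A') :=
    hΘ'.comp c2.contDiffOn fun z hz => hz
  have inv : ∀ z, (t, z) ∈ A → (-t, Θ (t, z)) ∈ A' → Θ' (-t, Θ (t, z)) = z := fun z hz hz' =>
    (hfl' _ hz').unique hX ((hfl _ hz).symm hX)
  have inv' : ∀ z, (-t, z) ∈ A' → (t, Θ' (-t, z)) ∈ A → Θ (t, Θ' (-t, z)) = z := fun z hz hz' =>
    (hfl _ hz').unique hX (by simpa using (hfl' _ hz).symm hX)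
  refine ⟨{ toFun := fun z => Θ (t, z), invFun := fun z => Θ' (-t, z),
            source := {z | (t, z) ∈ A} ∩ {z | (-t, Θ (t, z)) ∈ A'},
            target := {z | (-t, z) ∈ A'} ∩ {z | (t, Θ' (-t, z)) ∈ A},
            map_source' := fun z hz => ⟨hz.2, by
              simpa only [mem_ofPred_eq, inv z hz.1 hz.2] using hz.1⟩,
            map_target' := fun z hz => ⟨hz.2, by
              simpa only [mem_ofPred_eq, inv' z hz.1 hz.2] using hz.1⟩,
            left_inv' := fun z hz => inv z hz.1 hz.2,
            right_inv' := fun z hz => inv' z hz.1 hz.2,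
            open_source := ?_, open_target := ?_, continuousOn_toFun := ?_,
            continuousOn_invFun := ?_ }, ⟨hmem, ?_⟩, fun z hz => hfl _ hz.1, ?_, ?_⟩
  · exact d1.continuousOn.mono inter_subset_left
  · exact d2.continuousOn.mono inter_subset_left
  · exact (c2.continuous.comp_continuousOn d1.continuousOn).isOpen_inter_preimage
      (hA.preimage c1.continuous) hA'
  · exact (c1.continuous.comp_continuousOn d2.continuousOn).isOpen_inter_preimage
      (hA'.preimage c2.continuous) hA
  · have : Θ (t, x) = y := (hfl _ hmem).unique hX h
    simpa only [mem_ofPred_eq, this] using hmem'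
  · exact d1.mono inter_subset_left
  · exact d2.mono inter_subset_left

/-- The members of a family of smooth fields preserve the distribution spanned by the
push-forwards. -/
theorem isFlowAdapted_pushforwardSpan (hU : IsOpen U) (hF : ∀ X ∈ 𝓕, ContDiffOn ℝ ∞ X U)
    {X : Euc d → Euc d} (hX : X ∈ 𝓕) : IsFlowAdapted ∞ U (pushforwardSpan U 𝓕) X := by
  have hflow : HasFlow U X := hasFlow_of_contDiffOn hU ((hF X hX).of_le (by simp))
  have hbox : ∀ x ∈ U, FlowBox ∞ U X 0 x := fun x hx => flowBox_zero_of_contDiffOn hU (hF X hX) hx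
  refine ⟨hflow, hbox, fun _ x hx => mem_pushforwardSpan hX hU hx, ?_⟩
  intro _ t A θ hA hθ hfl x hx w hw
  obtain ⟨ψ, hxψ, hψ, hψs, hψt⟩ := exists_flow_diffeo hflow hbox (hfl x hx)
  -- Uniqueness of the flow makes any local version of the time-`t` map agree with the
  -- diffeomorphism `ψ` near `x`.
  have heq : θ =ᶠ[𝓝 x] ψ := by
    filter_upwards [hA.mem_nhds hx, ψ.open_source.mem_nhds hxψ] with z hz hz'
    exact (hfl z hz).unique hflow (hψ z hz')
  rw [heq.fderiv_eq, heq.self_of_nhds]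
  refine Submodule.span_induction (p := fun w _ => fderiv ℝ ψ x w ∈ pushforwardSpan U 𝓕 (ψ x))
    ?_ (by simp) (fun a b _ _ ha hb => by rw [map_add]; exact add_mem ha hb)
    (fun c a _ ha => by rw [map_smul]; exact Submodule.smul_mem _ c ha) hw
  rintro w ⟨D, Y, ⟨X₀, hX₀, N, hN, Xs, hXs, ts, φ, hφ, hφU, hφs, hφt, rfl, hY⟩, hxD, rfl⟩
  have hx₁ : φ.symm x ∈ φ.source := φ.map_target hxD
  have hx₁ψ : φ (φ.symm x) ∈ ψ.source := by rwa [φ.right_inv hxD]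
  -- Pushing `φ_⋆ X₀` forward by the flow of `X` is pushing `X₀` forward by `ψ ∘ φ`, one flow
  -- longer: the generators of the span are permuted.
  set χ := φ.trans ψ
  have hmem : φ.symm x ∈ χ.source := by
    rw [OpenPartialHomeomorph.trans_source]
    exact ⟨hx₁, hx₁ψ⟩
  have hχx : χ (φ.symm x) = ψ x := congrArg ψ (φ.right_inv hxD)
  have hsub : χ.source ⊆ φ.source := by
    rw [OpenPartialHomeomorph.trans_source]
    exact inter_subset_left
  have hχs : ∀ z ∈ χ.source, φ z ∈ ψ.source := fun z hz => by
    rw [OpenPartialHomeomorph.trans_source] at hz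
    exact hz.2
  refine Submodule.subset_span ⟨χ.target, fun z => fderiv ℝ χ (χ.symm z) (X₀ (χ.symm z)),
    ⟨X₀, hX₀, N + 1, Nat.succ_pos _, Fin.cons X Xs, ?_, Fin.cons t ts, χ, ?_,
      hsub.trans hφU, ?_, ?_, rfl, ?_⟩, hχx ▸ χ.map_source hmem, ?_⟩
  · intro j
    refine Fin.cases ?_ (fun i => ?_) j
    · simpa using hX
    · simpa using hXs i
  · intro z hz
    rw [concatTo_succ_iff]
    exact ⟨φ z, by simpa using hφ z (hsub hz), by
      simpa using (show FlowsTo U X t (φ z) (χ z) from hψ _ (hχs z hz))⟩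
  · exact (hψs.of_le (by simp)).comp (hφs.mono hsub) hχs
  · have ht : ∀ z ∈ χ.target, z ∈ ψ.target ∧ ψ.symm z ∈ φ.target := fun z hz => by
      rwa [OpenPartialHomeomorph.trans_target] at hz
    exact hφt.comp ((hψt.of_le (by simp)).mono fun z hz => (ht z hz).1) fun z hz => (ht z hz).2
  · intro z hz
    simp only [χ.left_inv hz]
  · have h1 : χ.symm (ψ x) = φ.symm x := by rw [← hχx, χ.left_inv hmem]
    simp only [h1]
    have d1 : DifferentiableAt ℝ φ (φ.symm x) :=
      (hφs.contDiffAt (φ.open_source.mem_nhds hx₁)).differentiableAt one_ne_zero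
    have d2 : DifferentiableAt ℝ ψ (φ (φ.symm x)) :=
      (hψs.contDiffAt (ψ.open_source.mem_nhds hx₁ψ)).differentiableAt (by simp)
    have h2 : fderiv ℝ χ (φ.symm x) = (fderiv ℝ ψ (φ (φ.symm x))).comp (fderiv ℝ φ (φ.symm x)) :=
      fderiv_comp _ d2 d1
    rw [h2, ContinuousLinearMap.comp_apply, ← hY _ hx₁, φ.right_inv hxD]

end Distribution


/-! ### Local coordinates adapted to the orbits of a family of smooth fields -/

section Blocks

variable {d : ℕ} {U : Set (Euc d)} {𝓕 : Set (Euc d → Euc d)}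

/-- A one-parameter arc issued from the identity, with a prescribed push-forward as its velocity. -/
theorem exists_arc_velocity (hU : IsOpen U) (hF : ∀ X ∈ 𝓕, ContDiffOn ℝ ∞ X U)
    {m : Euc d} {D : Set (Euc d)} {Y : Euc d → Euc d} (hY : IsPushforward U 𝓕 D Y)
    (hm : m ∈ D) :
    ∃ (L : List ((Euc d → Euc d) × (ℝ → ℝ))) (A : Set (ℝ × Euc d)) (Θ : ℝ × Euc d → Euc d),
      (∀ e ∈ L, e.1 ∈ 𝓕 ∧ ContDiff ℝ ∞ e.2) ∧ (0, m) ∈ A ∧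
      IsArc ∞ U (pushforwardSpan U 𝓕) L A Θ ∧ (∀ x, (0, x) ∈ A → Θ (0, x) = x) ∧
      fderiv ℝ Θ (0, m) (1, 0) = Y m := by
  have hflow : ∀ X ∈ 𝓕, HasFlow U X := fun X hX => hasFlow_of_contDiffOn hU ((hF X hX).of_le (by simp))
  obtain ⟨X₀, hX₀, N, hN, X, hX, t, φ, hφ, hφU, hφs, hφt, rfl, hYφ⟩ := hY
  set l := List.ofFn fun j => (X j, t j)
  have hl : ∀ e ∈ l, e.1 ∈ 𝓕 := by
    intro e he
    obtain ⟨j, rfl⟩ := List.mem_ofFn.1 he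
    exact hX j
  have hφl : ∀ x ∈ φ.source, Reaches U l x (φ x) := fun x hx => concatTo_iff_reaches.1 (hφ x hx)
  have hli : ∀ e ∈ inverseList l, e.1 ∈ 𝓕 := fun e he => hl (e.1, -e.2) (mem_inverseList.1 he)
  let const : List ((Euc d → Euc d) × ℝ) → List ((Euc d → Euc d) × (ℝ → ℝ)) := fun l =>
    l.map fun e => (e.1, fun _ => e.2)
  have hconst : ∀ l s, evalList (const l) s = l := fun l s => by
    simp [evalList, const, Function.comp_def]
  -- The conjugate `φ ∘ X₀_s ∘ φ⁻¹`, with `φ⁻¹` written as the reversed flows: it is the identity at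
  -- `s = 0` and its velocity there is the push-forward.
  set L := const l ++ [(X₀, id)] ++ const (inverseList l)
  have hLs : ∀ s, evalList L s = l ++ [(X₀, s)] ++ inverseList l := fun s => by
    simp only [L, evalList_append, hconst]
    rfl
  have hmemconst : ∀ l, (∀ e ∈ l, e.1 ∈ 𝓕) → ∀ e ∈ const l, e.1 ∈ 𝓕 ∧ ContDiff ℝ ∞ e.2 := by
    intro l hl e he
    obtain ⟨e', he', rfl⟩ := List.mem_map.1 he
    exact ⟨hl e' he', contDiff_const⟩
  have hL : ∀ e ∈ L, e.1 ∈ 𝓕 ∧ ContDiff ℝ ∞ e.2 := by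
    intro e he
    simp only [L, List.mem_append, List.mem_singleton] at he
    rcases he with (he | rfl) | he
    · exact hmemconst l hl e he
    · exact ⟨hX₀, contDiff_id⟩
    · exact hmemconst _ hli e he
  have hLflow : ∀ s, ∀ e ∈ evalList L s, HasFlow U e.1 := fun s =>
    forall_mem_evalList (fun e he => hflow _ (hL e he).1) s
  have hm₁ := φ.map_target hm
  have hlm : Reaches U l (φ.symm m) m := by simpa [φ.right_inv hm] using hφl _ hm₁
  have hlflow : ∀ e ∈ l, HasFlow U e.1 := fun e he => hflow _ (hl e he)
  have hm₁U : φ.symm m ∈ U := hφU hm₁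
  have hreach0 : Reaches U (evalList L 0) m m := by
    rw [hLs]
    exact reaches_append.2 ⟨_, hlm.symm hlflow, reaches_append.2
      ⟨_, reaches_singleton.2 (FlowsTo.zero hm₁U), hlm⟩⟩
  obtain ⟨A, Θ, hmem, hΘ⟩ := exists_isArc (fun e he =>
    ⟨isFlowAdapted_pushforwardSpan hU hF (hL e he).1, (hL e he).2⟩) hreach0
  refine ⟨L, A, Θ, hL, hmem, hΘ, fun x hx => ?_, ?_⟩
  · have := hΘ.reaches _ hx
    rw [hLs] at this
    obtain ⟨z, hz, h⟩ := reaches_append.1 this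
    obtain ⟨w, hw, h'⟩ := reaches_append.1 h
    rw [reaches_singleton] at hw
    have hzx : Reaches U l z x := by
      have := hz.symm fun e he => hflow _ (hli e he)
      simpa [inverseList, Function.comp_def] using this
    -- As `N ≥ 1`, the intermediate point `z` is the end of a flow, hence lies in `U`, so that the
    -- zero-time flow of `X₀` fixes it.
    have hne : inverseList l ≠ [] := by
      simp only [inverseList, Ne, List.reverse_eq_nil_iff, List.map_eq_nil_iff, l,
        List.ofFn_eq_nil_iff]
      exact hN.ne'
    have hwz : w = z := hw.unique (hflow _ hX₀) (FlowsTo.zero (hz.mem_right hne))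
    subst hwz
    exact h'.unique hlflow hzx
  · obtain ⟨ε, hε, γ, hγ0, hγ⟩ := (hflow _ hX₀).exists_curve hm₁U 0
    rw [zero_sub, zero_add] at hγ
    have h0 : (0 : ℝ) ∈ Ioo (-ε) ε := ⟨by linarith, hε⟩
    have hγd := hγ.hasDerivAt (isOpen_Ioo.mem_nhds h0)
    have d1 : HasFDerivAt φ (fderiv ℝ φ (γ 0)) (γ 0) := by
      rw [hγ0]
      exact ((hφs.contDiffAt (φ.open_source.mem_nhds hm₁)).differentiableAt one_ne_zero).hasFDerivAt
    have d2 := d1.comp_hasDerivAt 0 hγd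
    have d3 : HasDerivAt (fun s => Θ (s, m)) (fderiv ℝ Θ (0, m) (1, 0)) 0 :=
      (hΘ.differentiableAt (by simp) hmem).hasFDerivAt.comp_hasDerivAt 0
        ((hasDerivAt_id (0 : ℝ)).prodMk (hasDerivAt_const (0 : ℝ) m))
    -- `Θ` comes from smoothness of flows and knows nothing of `φ`; uniqueness identifies it with
    -- `φ` along the integral curve `γ` of `X₀`, which gives its velocity.
    have hev : (fun s => Θ (s, m)) =ᶠ[𝓝 0] φ ∘ γ := by
      have hc : Continuous fun s : ℝ => (s, m) := by fun_prop
      filter_upwards [isOpen_Ioo.mem_nhds h0, (hΘ.isOpen.preimage hc).mem_nhds hmem,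
        hγd.continuousAt.preimage_mem_nhds
          (by rw [hγ0]; exact φ.open_source.mem_nhds hm₁)] with s hs hsA hsφ
      refine (hΘ.reaches _ hsA).unique (hLflow s) ?_
      rw [hLs]
      refine reaches_append.2 ⟨_, hlm.symm hlflow, reaches_append.2
        ⟨γ s, reaches_singleton.2 ?_, hφl _ hsφ⟩⟩
      have := hγ.flowsTo h0 hs
      rwa [hγ0, sub_zero] at this
    rw [d3.unique (d2.congr_of_eventuallyEq hev), hγ0, ← hYφ _ hm₁, φ.right_inv hm]

/-- A multi-parameter arc issued from the identity, with prescribed push-forwards as its partial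
velocities. -/
theorem exists_arc_velocities (hU : IsOpen U) (hF : ∀ X ∈ 𝓕, ContDiffOn ℝ ∞ X U) {m : Euc d}
    {k : ℕ} (v : Fin k → Euc d)
    (hv : ∀ i, ∃ (D : Set (Euc d)) (Y : Euc d → Euc d), IsPushforward U 𝓕 D Y ∧ m ∈ D ∧
      v i = Y m) :
    ∃ (L : List ((Euc d → Euc d) × ((Fin k → ℝ) → ℝ))) (A : Set ((Fin k → ℝ) × Euc d))
      (Θ : (Fin k → ℝ) × Euc d → Euc d),
      (∀ e ∈ L, e.1 ∈ 𝓕 ∧ ContDiff ℝ ∞ e.2) ∧ (0, m) ∈ A ∧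
      IsArc ∞ U (pushforwardSpan U 𝓕) L A Θ ∧ (∀ x, (0, x) ∈ A → Θ (0, x) = x) ∧
      ∀ s w, fderiv ℝ Θ (0, m) (s, w) = ∑ i, s i • v i + w := by
  induction k with
  | zero =>
    refine ⟨[], univ, Prod.snd, by simp, mem_univ _, isArc_nil, fun _ _ => rfl, fun s w => ?_⟩
    rw [fderiv_snd]
    simp
  | succ k ih =>
    obtain ⟨L', A', Θ', hL', hmem', hΘ', hid', hd'⟩ := ih (fun i => v i.succ) fun i => hv i.succ
    obtain ⟨D, Y, hY, hm, hvY⟩ := hv 0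
    obtain ⟨L, A, Θ, hL, hmem, hΘ, hid, hd⟩ := exists_arc_velocity hU hF hY hm
    let g : (Fin (k + 1) → ℝ) →L[ℝ] ℝ := ContinuousLinearMap.proj 0
    let g' : (Fin (k + 1) → ℝ) →L[ℝ] (Fin k → ℝ) :=
      ContinuousLinearMap.pi fun i => ContinuousLinearMap.proj i.succ
    have hg' : ∀ s, g' s = fun i => s i.succ := fun s => rfl
    have h0 : ((0 : Fin (k + 1) → ℝ), m) ∈ compDomain A A' Θ' g g' := by
      refine ⟨by simpa using hmem', ?_⟩
      simp only [map_zero]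
      rwa [hid' _ hmem']
    -- The arc of velocity `v 0` is composed with the arc for the other vectors; both are the
    -- identity at parameter `0`, so the velocities add up.
    refine ⟨reparam g L ++ reparam g' L', compDomain A A' Θ' g g', _, ?_, h0,
      hΘ.comp hΘ' g.contDiff g'.contDiff, ?_, ?_⟩
    · intro e he
      rcases List.mem_append.1 he with he | he
      · obtain ⟨e', he', rfl⟩ := List.mem_map.1 he
        exact ⟨(hL e' he').1, (hL e' he').2.comp g.contDiff⟩
      · obtain ⟨e', he', rfl⟩ := List.mem_map.1 he
        exact ⟨(hL' e' he').1, (hL' e' he').2.comp g'.contDiff⟩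
    · rintro x ⟨h1, h2⟩
      simp only [map_zero] at h1 h2 ⊢
      rw [hid' _ h1] at h2 ⊢
      exact hid _ h2
    · intro s w
      rw [hΘ.comp_hasFDerivAt hΘ' g.contDiff g'.contDiff (by simp) h0]
      simp only [map_zero, ContinuousLinearMap.fderiv]
      rw [hid' _ hmem', hd']
      have hid1 : ∀ w, fderiv ℝ Θ (0, m) (0, w) = w := fun w => by
        have d1 : HasFDerivAt (fun x => Θ (0, x)) ((fderiv ℝ Θ (0, m)).comp
            ((0 : Euc d →L[ℝ] ℝ).prod (ContinuousLinearMap.id ℝ (Euc d)))) m :=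
          (hΘ.differentiableAt (by simp) hmem).hasFDerivAt.comp m
            ((hasFDerivAt_const (0 : ℝ) m).prodMk (hasFDerivAt_id m))
        have hc : Continuous fun x : Euc d => ((0 : ℝ), x) := by fun_prop
        have d2 : HasFDerivAt (fun x => Θ (0, x)) (ContinuousLinearMap.id ℝ (Euc d)) m := by
          refine (hasFDerivAt_id m).congr_of_eventuallyEq ?_
          filter_upwards [(hΘ.isOpen.preimage hc).mem_nhds hmem] with x hx
          exact hid x hx
        exact congrArg (fun A : Euc d →L[ℝ] Euc d => A w) (d1.unique d2)
      have hsplit : ∀ (a : ℝ) (w : Euc d), (a, w) = a • ((1 : ℝ), (0 : Euc d)) + ((0 : ℝ), w) := by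
        intro a w
        simp
      rw [hsplit (g s), map_add, map_smul, hd, hid1, Fin.sum_univ_succ, hvY, add_assoc]
      rfl

end Blocks

/-! ### Head and tail coordinates, and linear coordinates completing given vectors. -/

section LinearAlgebra

variable {d : ℕ}

lemma card_tail_index {q : ℕ} (hq : q ≤ d) : Fintype.card {i : Fin d // q ≤ i.1} = d - q := by
  have h1 : Fintype.card {i : Fin d // i.1 < q} = q := by
    rw [← Fintype.card_congr (Fin.castLEOrderIso hq).toEquiv, Fintype.card_fin]
  have h2 := Fintype.card_subtype_compl fun i : Fin d => i.1 < q
  rw [h1, Fintype.card_fin] at h2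
  rw [← h2]
  exact Fintype.card_congr (Equiv.subtypeEquivRight fun i => by simp)

/-- The coordinates of index `< q`, numbered by `Fin q`. -/
def headVec {q : ℕ} (hq : q ≤ d) : Euc d →L[ℝ] (Fin q → ℝ) :=
  ContinuousLinearMap.pi fun i => EuclideanSpace.proj (𝕜 := ℝ) (Fin.castLE hq i)

/-- The coordinates of index `≥ q`, as a continuous linear map. -/
def tailCoordL (q : ℕ) : Euc d →L[ℝ] ({i : Fin d // q ≤ i.1} → ℝ) :=
  ContinuousLinearMap.pi fun i => EuclideanSpace.proj (𝕜 := ℝ) i.1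

/-- The coordinates of index `< q`, as a continuous linear map. -/
def headCoordL (q : ℕ) : Euc d →L[ℝ] ({i : Fin d // i.1 < q} → ℝ) :=
  ContinuousLinearMap.pi fun i => EuclideanSpace.proj (𝕜 := ℝ) i.1

lemma tailCoordL_apply (q : ℕ) (v : Euc d) : tailCoordL q v = tailCoord q v := rfl

/-- Linear coordinates whose first vectors are prescribed. -/
theorem exists_linear_coordinates {q : ℕ} (v : Fin q → Euc d) (hv : LinearIndependent ℝ v) :
    ∃ (hq : q ≤ d) (c : ({i : Fin d // q ≤ i.1} → ℝ) →L[ℝ] Euc d) (e : Euc d ≃L[ℝ] Euc d),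
      ∀ x, e x = ∑ i, headVec hq x i • v i + c (tailCoordL q x) := by
  have hq : q ≤ d := by simpa using hv.fintype_card_le_finrank
  obtain ⟨C, hC⟩ := (Submodule.span ℝ (range v)).exists_isCompl
  have hfin := Submodule.finrank_add_eq_of_isCompl hC
  rw [finrank_span_eq_card hv, Fintype.card_fin, finrank_euclideanSpace_fin] at hfin
  have hfr : Module.finrank ℝ ({i : Fin d // q ≤ i.1} → ℝ) = Module.finrank ℝ C := by
    rw [Module.finrank_fintype_fun_eq_card, card_tail_index hq]
    omega
  let c₀ := LinearEquiv.ofFinrankEq ({i : Fin d // q ≤ i.1} → ℝ) C hfr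
  let c : ({i : Fin d // q ≤ i.1} → ℝ) →L[ℝ] Euc d :=
    LinearMap.toContinuousLinearMap (C.subtype ∘ₗ c₀.toLinearMap)
  let ℓ : Euc d →ₗ[ℝ] Euc d := (Fintype.linearCombination ℝ v) ∘ₗ (headVec hq).toLinearMap +
    c.toLinearMap ∘ₗ (tailCoordL q).toLinearMap
  have hℓ : ∀ x, ℓ x = ∑ i, headVec hq x i • v i + c (tailCoordL q x) := fun x => by
    simp [ℓ, Fintype.linearCombination_apply]
  have hinj : Function.Injective ℓ := by
    rw [injective_iff_map_eq_zero]
    intro x hx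
    rw [hℓ] at hx
    have h1 : ∑ i, headVec hq x i • v i ∈ Submodule.span ℝ (range v) :=
      Submodule.sum_mem _ fun i _ => Submodule.smul_mem _ _ (Submodule.subset_span ⟨i, rfl⟩)
    have h2 : c (tailCoordL q x) ∈ C := (c₀ (tailCoordL q x)).2
    have h3 : ∑ i, headVec hq x i • v i ∈ C := by
      rw [eq_neg_of_add_eq_zero_left hx]
      exact neg_mem h2
    have h4 := (Submodule.disjoint_def.1 hC.disjoint) _ h1 h3
    rw [h4, zero_add] at hx
    have h5 : tailCoordL q x = 0 := by
      have : c₀ (tailCoordL q x) = 0 := Subtype.ext hx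
      simpa using this
    have h6 := Fintype.linearIndependent_iff.1 hv _ h4
    ext i
    by_cases hi : i.1 < q
    · exact h6 ⟨i, hi⟩
    · exact congrFun h5 ⟨i, not_lt.1 hi⟩
  exact ⟨hq, c, (LinearEquiv.ofInjectiveEndo ℓ hinj).toContinuousLinearEquiv, hℓ⟩

/-- The cube `(-η, η)ᵈ`. -/
def cube (d : ℕ) (η : ℝ) : Set (Euc d) := {v | ∀ i, v i ∈ Ioo (-η) η}

lemma isOpen_cube (η : ℝ) : IsOpen (cube d η) := by
  have : cube d η = ⋂ i, (fun v : Euc d => v i) ⁻¹' Ioo (-η) η := by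
    ext v
    simp [cube]
  rw [this]
  exact isOpen_iInter_of_finite fun i => isOpen_Ioo.preimage (by fun_prop)

lemma zero_mem_cube {η : ℝ} (hη : 0 < η) : (0 : Euc d) ∈ cube d η := fun i => by
  simpa using hη

lemma exists_cube_subset {V : Set (Euc d)} (hV : V ∈ 𝓝 (0 : Euc d)) :
    ∃ η > 0, cube d η ⊆ V := by
  have hc : ContinuousAt (WithLp.toLp 2 : (Fin d → ℝ) → Euc d) 0 :=
    (PiLp.continuous_toLp 2 _).continuousAt
  obtain ⟨η, hη, hsub⟩ := Metric.mem_nhds_iff.1 (hc.preimage_mem_nhds (by simpa using hV))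
  refine ⟨η, hη, fun v hv => ?_⟩
  have : WithLp.ofLp v ∈ Metric.ball (0 : Fin d → ℝ) η := by
    rw [mem_ball_zero_iff, pi_norm_lt_iff hη]
    intro i
    rw [Real.norm_eq_abs, abs_lt]
    exact hv i
  simpa using hsub this

/-- The vector with its coordinates of index `< q` replaced by zero. -/
def tailPart (q : ℕ) (v : Euc d) : Euc d := WithLp.toLp 2 fun i => if i.1 < q then 0 else v i

lemma tailPart_mem_cube {q : ℕ} {η : ℝ} {v : Euc d} (hv : v ∈ cube d η) :
    tailPart q v ∈ cube d η := by
  intro i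
  simp only [tailPart]
  split_ifs
  · have := hv i
    constructor <;> linarith [this.1, this.2]
  · exact hv i

lemma tailCoord_tailPart {q : ℕ} {v : Euc d} : tailCoord q (tailPart q v) = tailCoord q v := by
  funext i
  simp [tailCoord, tailPart, i.2.not_gt]

lemma headVec_tailPart {q : ℕ} (hq : q ≤ d) {v : Euc d} : headVec hq (tailPart q v) = 0 := by
  funext i
  simp [headVec, tailPart]

lemma tailPart_eq_of_tailCoord_eq {q : ℕ} {v v' : Euc d} (h : tailCoord q v = tailCoord q v') :
    tailPart q v = tailPart q v' := by
  ext i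
  simp only [tailPart]
  split_ifs with hi
  · rfl
  · exact congrFun h ⟨i, not_lt.1 hi⟩

end LinearAlgebra

/-! ### Coordinates swept out by flows. -/

section Chart

variable {d : ℕ}

/-- Coordinates `ξ` whose first `q` coordinate fields are tangent to the orbits of `𝓕`, each slice
`tailCoord = const` being connected by flows of members of `𝓕`. -/
structure IsFlowChart (U : Set (Euc d)) (𝓕 : Set (Euc d → Euc d)) (q : ℕ)
    (ξ : OpenPartialHomeomorph (Euc d) (Euc d)) (η : ℝ) : Prop where
  source_subset : ξ.source ⊆ U
  pos : 0 < η
  target_eq : ξ.target = cube d η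
  contDiffOn : ContDiffOn ℝ ∞ ξ ξ.source
  contDiffOn_symm : ContDiffOn ℝ ∞ ξ.symm ξ.target
  coordField_mem : ∀ x ∈ ξ.source, ∀ i : Fin d, i.1 < q →
    coordField ξ i x ∈ pushforwardSpan U 𝓕 x
  reaches : ∃ L : List ((Euc d → Euc d) × (Euc d → ℝ)),
    (∀ e ∈ L, e.1 ∈ 𝓕 ∧ Continuous e.2) ∧
    ∀ v ∈ cube d η, Reaches U (evalList L v) (ξ.symm (tailPart q v)) (ξ.symm v)

/-- Take an arc `Θ` whose `q` velocities at `m` form a basis of `P_𝓕(m)`, and let it start from the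
affine transversal `m + c(tail)`: the map `x ↦ Θ (head x, m + c (tail x))` has the invertible
derivative `e` at `0`, and `ξ` is its inverse. A slice is the set of points reached by `Θ` from one
point of the transversal. -/
theorem exists_isFlowChart {U : Set (Euc d)} (hU : IsOpen U) {𝓕 : Set (Euc d → Euc d)}
    (hF : ∀ X ∈ 𝓕, ContDiffOn ℝ ∞ X U) {m : Euc d} (hm : m ∈ U) :
    ∃ ξ η, IsFlowChart U 𝓕 (Module.finrank ℝ (pushforwardSpan U 𝓕 m)) ξ η ∧ m ∈ ξ.source ∧
      ξ m = 0 := by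
  set q := Module.finrank ℝ (pushforwardSpan U 𝓕 m)
  obtain ⟨v, hv, hli⟩ : ∃ v : Fin q → Euc d,
      (∀ i, ∃ (D : Set (Euc d)) (Y : Euc d → Euc d), IsPushforward U 𝓕 D Y ∧ m ∈ D ∧ v i = Y m) ∧
      LinearIndependent ℝ v := by
    obtain ⟨v, hv, -, hli⟩ := Submodule.exists_fun_fin_finrank_span_eq ℝ
      {v | ∃ (D : Set (Euc d)) (Y : Euc d → Euc d), IsPushforward U 𝓕 D Y ∧ m ∈ D ∧ v = Y m}
    exact ⟨v, hv, hli⟩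
  obtain ⟨L, A, Θ, hL, hmem, hΘ, hid, hd⟩ := exists_arc_velocities hU hF v hv
  obtain ⟨hq, c, e, he⟩ := exists_linear_coordinates v hli
  set σ : Euc d → (Fin q → ℝ) × Euc d := fun x => (headVec hq x, m + c (tailCoordL q x))
  have hσ : ContDiff ℝ ∞ σ :=
    (headVec hq).contDiff.prodMk (contDiff_const.add (c.contDiff.comp (tailCoordL q).contDiff))
  have hσ0 : σ 0 = (0, m) := by simp [σ]
  have hσd : ∀ x, HasFDerivAt σ ((headVec hq).prod (c.comp (tailCoordL q))) x := fun x =>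
    (headVec hq).hasFDerivAt.prodMk ((c.comp (tailCoordL q)).hasFDerivAt.const_add m)
  have hB : IsOpen (σ ⁻¹' (A ∩ Prod.snd ⁻¹' U)) :=
    (hΘ.isOpen.inter (hU.preimage continuous_snd)).preimage hσ.continuous
  have hΨ : ContDiffOn ℝ ∞ (fun x => Θ (σ x)) (σ ⁻¹' (A ∩ Prod.snd ⁻¹' U)) :=
    hΘ.contDiffOn.comp hσ.contDiffOn fun x hx => hx.1
  have hΨd : ∀ x, σ x ∈ A → HasFDerivAt (fun x => Θ (σ x))
      ((fderiv ℝ Θ (σ x)).comp ((headVec hq).prod (c.comp (tailCoordL q)))) x := fun x hx =>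
    (hΘ.differentiableAt (by simp) hx).hasFDerivAt.comp x (hσd x)
  have hσ0A : σ 0 ∈ A := by rwa [hσ0]
  have hΨ0 : HasFDerivAt (fun x => Θ (σ x)) (e : Euc d →L[ℝ] Euc d) 0 := by
    refine (hΨd 0 hσ0A).congr_fderiv (ContinuousLinearMap.ext fun x => ?_)
    rw [hσ0]
    exact (hd _ _).trans (he x).symm
  obtain ⟨φ, h0φ, hφB, hφΨ, hφs⟩ := exists_openPartialHomeomorph_of_contDiffOn hB hΨ (a := 0)
    ⟨hσ0A, by simpa [hσ0] using hm⟩ e hΨ0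
  obtain ⟨η, hη, hcube⟩ := exists_cube_subset (φ.open_source.mem_nhds h0φ)
  set ψ := φ.restrOpen (cube d η) (isOpen_cube η)
  have hψs : ψ.source = cube d η := inter_eq_right.2 hcube
  have hψΨ : ∀ x, ψ x = Θ (σ x) := fun x => congrFun hφΨ x
  have hcubeA : ∀ x ∈ cube d η, σ x ∈ A := fun x hx => (hφB (hcube hx)).1
  have htail : ∀ x ∈ cube d η, ψ (tailPart q x) = m + c (tailCoordL q x) := fun x hx => by
    have h1 : σ (tailPart q x) = (0, m + c (tailCoordL q x)) := by
      simp only [σ, headVec_tailPart, tailCoordL_apply, tailCoord_tailPart]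
    have h2 := hcubeA _ (tailPart_mem_cube (q := q) hx)
    rw [hψΨ, h1]
    rw [h1] at h2
    exact hid _ h2
  have hreach : ∀ x ∈ cube d η,
      Reaches U (evalList L (headVec hq x)) (ψ (tailPart q x)) (ψ x) := fun x hx => by
    rw [htail x hx, hψΨ]
    exact hΘ.reaches _ (hcubeA x hx)
  have h0 : ψ 0 = m := by
    rw [hψΨ, hσ0, hid m hmem]
  have h0s : (0 : Euc d) ∈ ψ.source := hψs ▸ zero_mem_cube hη
  have hψsource : ∀ y ∈ ψ.target, y ∈ φ.target ∧ φ.symm y ∈ cube d η := by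
    intro y hy
    have h1 := ψ.map_target hy
    rw [hψs] at h1
    refine ⟨?_, h1⟩
    have h2 := φ.map_source (hcube h1)
    have h3 : φ (ψ.symm y) = y := ψ.right_inv hy
    rwa [h3] at h2
  refine ⟨ψ.symm, η, ⟨fun y hy => ?_, hη, hψs, ?_, ?_, fun y hy i hi => ?_, ?_⟩, ?_, ?_⟩
  · have h1 := ψ.map_target hy
    rw [hψs] at h1
    have h2 := (hreach _ h1).mem_right_of_mem (by
      rw [htail _ h1]
      exact (hφB (hcube h1)).2)
    rwa [ψ.right_inv hy] at h2
  · exact hφs.mono fun y hy => (hψsource y hy).1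
  · rw [OpenPartialHomeomorph.symm_symm, OpenPartialHomeomorph.symm_target, hψs]
    exact (hΨ.mono fun x hx => hφB (hcube hx)).congr fun x _ => hψΨ x
  · have h1 := ψ.map_target hy
    rw [hψs] at h1
    have hyv : Θ (σ (ψ.symm y)) = y := by rw [← hψΨ, ψ.right_inv hy]
    have h2 : fderiv ℝ ψ (ψ.symm y) = fderiv ℝ (fun x => Θ (σ x)) (ψ.symm y) := by
      rw [show (ψ : Euc d → Euc d) = fun x => Θ (σ x) from funext hψΨ]
    rw [coordField, OpenPartialHomeomorph.symm_symm, h2, (hΨd _ (hcubeA _ h1)).fderiv]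
    -- For `i < q` the direction moves only the times, not the starting point, so horizontality of
    -- the arc applies with the zero vector in the space component. It holds in the whole chart, off
    -- the orbit of `m` too.
    have h3 := hΘ.horizontal (by simp) _ (hcubeA _ h1)
      (headVec hq (EuclideanSpace.single i 1)) 0 (zero_mem _)
    rw [hyv] at h3
    have h4 : tailCoordL q (EuclideanSpace.single i (1 : ℝ)) = 0 := by
      funext j
      have : j.1 ≠ i := fun h => absurd hi (by rw [← h]; exact j.2.not_gt)
      simp [tailCoordL, this]
    simpa [h4] using h3
  · refine ⟨reparam (headVec hq) L, fun e he => ?_, fun x hx => ?_⟩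
    · obtain ⟨e', he', rfl⟩ := List.mem_map.1 he
      exact ⟨(hL e' he').1, (hL e' he').2.continuous.comp (headVec hq).continuous⟩
    · rw [evalList_reparam]
      exact hreach x hx
  · rw [← h0]
    exact ψ.map_source h0s
  · rw [← h0]
    exact ψ.left_inv h0s

end Chart


/-! ### The orbits of a family of smooth fields are foliated by plaques -/

section PlaqueCharts

variable {d : ℕ}

/-- In the coordinates `ξ`, the image of `ι` is a union of slices `tailCoord = const`, and the
topology of `M` is near each point the one induced by the slice through this point. -/
structure IsPlaqueChart {M : Type} [TopologicalSpace M] (ι : M → Euc d) (q : ℕ)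
    (ξ : OpenPartialHomeomorph (Euc d) (Euc d)) (η : ℝ) : Prop where
  pos : 0 < η
  target_eq : ξ.target = cube d η
  contDiffOn : ContDiffOn ℝ ∞ ξ ξ.source
  contDiffOn_symm : ContDiffOn ℝ ∞ ξ.symm ξ.target
  saturated : ∀ x ∈ ξ.source, ∀ y ∈ ξ.source, tailCoord q (ξ x) = tailCoord q (ξ y) →
    x ∈ range ι → y ∈ range ι
  nhds_eq : ∀ p : M, ι p ∈ ξ.source → 𝓝 p = Filter.comap ι (𝓝 (ι p)) ⊓
    Filter.principal {p' | ι p' ∈ ξ.source ∧ tailCoord q (ξ (ι p')) = tailCoord q (ξ (ι p))}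

variable {ξ : OpenPartialHomeomorph (Euc d) (Euc d)}

lemma differentiableAt_of_smooth {φ : OpenPartialHomeomorph (Euc d) (Euc d)}
    (h : ContDiffOn ℝ ∞ φ φ.source) {x : Euc d} (hx : x ∈ φ.source) : DifferentiableAt ℝ φ x :=
  (h.contDiffAt (φ.open_source.mem_nhds hx)).differentiableAt (by simp)

/-- The derivatives of a diffeomorphism and of its inverse are inverse of each other. -/
lemma fderiv_symm_fderiv {φ : OpenPartialHomeomorph (Euc d) (Euc d)}
    (h : ContDiffOn ℝ ∞ φ φ.source) (h' : ContDiffOn ℝ ∞ φ.symm φ.target) {x : Euc d}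
    (hx : x ∈ φ.source) (w : Euc d) : fderiv ℝ φ.symm (φ x) (fderiv ℝ φ x w) = w := by
  have d1 := (differentiableAt_of_smooth h hx).hasFDerivAt
  have d2 := (differentiableAt_of_smooth (φ := φ.symm) h' (φ.map_source hx)).hasFDerivAt
  have d3 : HasFDerivAt (φ.symm ∘ φ) (ContinuousLinearMap.id ℝ (Euc d)) x := by
    refine (hasFDerivAt_id x).congr_of_eventuallyEq ?_
    filter_upwards [φ.open_source.mem_nhds hx] with y hy
    exact φ.left_inv hy
  exact congrArg (fun A : Euc d →L[ℝ] Euc d => A w) ((d2.comp x d1).unique d3)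

lemma fderiv_fderiv_symm {φ : OpenPartialHomeomorph (Euc d) (Euc d)}
    (h : ContDiffOn ℝ ∞ φ φ.source) (h' : ContDiffOn ℝ ∞ φ.symm φ.target) {x : Euc d}
    (hx : x ∈ φ.source) (w : Euc d) : fderiv ℝ φ x (fderiv ℝ φ.symm (φ x) w) = w := by
  have := fderiv_symm_fderiv (φ := φ.symm) h' h (φ.map_source hx) w
  rwa [OpenPartialHomeomorph.symm_symm, φ.left_inv hx] at this

/-- The span of the `q` first coordinate fields. -/
def coordSpan (ξ : OpenPartialHomeomorph (Euc d) (Euc d)) (q : ℕ) (x : Euc d) :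
    Submodule ℝ (Euc d) :=
  Submodule.span ℝ {v | ∃ i : Fin d, i.1 < q ∧ v = coordField ξ i x}

/-- Read in the coordinates, the span is the kernel of the tail; tangency thus becomes vanishing of
the derivative of the tail coordinates. -/
lemma mem_coordSpan_iff (h : ContDiffOn ℝ ∞ ξ ξ.source) (h' : ContDiffOn ℝ ∞ ξ.symm ξ.target)
    {q : ℕ} {x : Euc d} (hx : x ∈ ξ.source) {w : Euc d} :
    w ∈ coordSpan ξ q x ↔ tailCoordL q (fderiv ℝ ξ x w) = 0 := by
  constructor
  · intro hw
    have hle : coordSpan ξ q x ≤ LinearMap.ker ((tailCoordL q).comp (fderiv ℝ ξ x)).toLinearMap := by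
      refine Submodule.span_le.2 ?_
      rintro v ⟨i, hi, rfl⟩
      change tailCoordL q (fderiv ℝ ξ x (coordField ξ i x)) = 0
      rw [coordField, fderiv_fderiv_symm h h' hx]
      funext j
      have : j.1 ≠ i := fun h => absurd hi (by rw [← h]; exact j.2.not_gt)
      simp [tailCoordL, this]
    exact hle hw
  · intro hw
    rw [← fderiv_symm_fderiv h h' hx w]
    set u := fderiv ℝ ξ x w
    have hu : u = ∑ i, u i • EuclideanSpace.single i (1 : ℝ) := by
      ext j
      simp [Finset.sum_apply, Pi.single_apply]
    rw [hu, map_sum]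
    refine Submodule.sum_mem _ fun i _ => ?_
    rw [map_smul]
    by_cases hi : i.1 < q
    · exact Submodule.smul_mem _ _ (Submodule.subset_span ⟨i, hi, rfl⟩)
    · have : u i = 0 := congrFun hw ⟨i, not_lt.1 hi⟩
      rw [this, zero_smul]
      exact zero_mem _

lemma finrank_coordSpan (h : ContDiffOn ℝ ∞ ξ ξ.source) (h' : ContDiffOn ℝ ∞ ξ.symm ξ.target)
    {q : ℕ} (hq : q ≤ d) {x : Euc d} (hx : x ∈ ξ.source) :
    Module.finrank ℝ (coordSpan ξ q x) = q := by
  have hli : LinearIndependent ℝ fun i : Fin q => coordField ξ (Fin.castLE hq i) x := by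
    have h1 : LinearIndependent ℝ fun i : Fin q =>
        (EuclideanSpace.single (Fin.castLE hq i) (1 : ℝ) : Euc d) := by
      have := (EuclideanSpace.basisFun (Fin d) ℝ).toBasis.linearIndependent.comp (Fin.castLE hq)
        (Fin.castLE_injective hq)
      simpa [Function.comp_def] using this
    refine h1.map' (fderiv ℝ ξ.symm (ξ x)).toLinearMap (LinearMap.ker_eq_bot.2 ?_)
    exact Function.LeftInverse.injective (g := fderiv ℝ ξ x) fun w => fderiv_fderiv_symm h h' hx w
  have hr : {v | ∃ i : Fin d, i.1 < q ∧ v = coordField ξ i x} =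
      range fun i : Fin q => coordField ξ (Fin.castLE hq i) x := by
    ext v
    constructor
    · rintro ⟨i, hi, rfl⟩
      exact ⟨⟨i, hi⟩, rfl⟩
    · rintro ⟨i, rfl⟩
      exact ⟨Fin.castLE hq i, i.2, rfl⟩
  rw [coordSpan, hr, finrank_span_eq_card hli, Fintype.card_fin]

end PlaqueCharts

/-! ### Constant rank along orbits; the orbit topology is the slice topology. -/

section SmoothOrbits

variable {d : ℕ} {U : Set (Euc d)} {𝓕 : Set (Euc d → Euc d)}

/-- The differential of the flow is injective and carries `P_𝓕(x)` into `P_𝓕(y)`. -/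
lemma finrank_le_of_flowsTo (hU : IsOpen U) (hF : ∀ X ∈ 𝓕, ContDiffOn ℝ ∞ X U)
    {X : Euc d → Euc d} (hX : X ∈ 𝓕) {t : ℝ} {x y : Euc d} (h : FlowsTo U X t x y) :
    Module.finrank ℝ (pushforwardSpan U 𝓕 x) ≤ Module.finrank ℝ (pushforwardSpan U 𝓕 y) := by
  have hXa := isFlowAdapted_pushforwardSpan hU hF hX
  obtain ⟨ψ, hx, hψ, hψs, hψt⟩ := exists_flow_diffeo hXa.hasFlow hXa.flowBox h
  have hy : ψ x = y := (hψ x hx).unique hXa.hasFlow h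
  have hmap := hXa.map_mem (by simp) t ψ.source ψ ψ.open_source hψs hψ x hx
  rw [hy] at hmap
  have hinj : Function.Injective (fderiv ℝ ψ x) :=
    Function.LeftInverse.injective (g := fderiv ℝ ψ.symm (ψ x)) fun w =>
      fderiv_symm_fderiv hψs hψt hx w
  refine LinearMap.finrank_le_finrank_of_injective
    (f := (fderiv ℝ ψ x).toLinearMap.restrict hmap) ?_
  exact fun a b hab => Subtype.ext (hinj (congrArg Subtype.val hab))

/-- Flows do not decrease the rank, and they can be reversed. -/
lemma finrank_eq_of_mem_orbit (hU : IsOpen U) (hF : ∀ X ∈ 𝓕, ContDiffOn ℝ ∞ X U)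
    {m x : Euc d} (hx : x ∈ orbit U 𝓕 m) :
    Module.finrank ℝ (pushforwardSpan U 𝓕 x) = Module.finrank ℝ (pushforwardSpan U 𝓕 m) := by
  have hflow : ∀ X ∈ 𝓕, HasFlow U X := fun X hX => hasFlow_of_contDiffOn hU ((hF X hX).of_le (by simp))
  have key : ∀ l : List ((Euc d → Euc d) × ℝ), (∀ e ∈ l, e.1 ∈ 𝓕) → ∀ x y, Reaches U l x y →
      Module.finrank ℝ (pushforwardSpan U 𝓕 x) ≤ Module.finrank ℝ (pushforwardSpan U 𝓕 y) := by
    intro l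
    induction l with
    | nil =>
      rintro - x y (rfl : x = y)
      rfl
    | cons e l ih =>
      rintro hl x y ⟨z, hz, h⟩
      exact (ih (fun e he => hl e (List.mem_cons_of_mem _ he)) x z hz).trans
        (finrank_le_of_flowsTo hU hF (hl e List.mem_cons_self) h)
  have key' : ∀ {x y}, y ∈ orbit U 𝓕 x →
      Module.finrank ℝ (pushforwardSpan U 𝓕 x) ≤ Module.finrank ℝ (pushforwardSpan U 𝓕 y) := by
    intro x y hy
    obtain ⟨l, -, hl, h⟩ := mem_orbit_iff.1 hy
    exact key l hl x y h
  exact le_antisymm (key' (orbit_symm hflow hx)) (key' hx)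

/-- On the orbit, the distribution is spanned by the first coordinate fields. -/
theorem IsFlowChart.pushforwardSpan_eq {m : Euc d}
    {ξ : OpenPartialHomeomorph (Euc d) (Euc d)} {η : ℝ}
    (hξ : IsFlowChart U 𝓕 (Module.finrank ℝ (pushforwardSpan U 𝓕 m)) ξ η)
    {x : Euc d} (hx : Module.finrank ℝ (pushforwardSpan U 𝓕 x) =
      Module.finrank ℝ (pushforwardSpan U 𝓕 m)) (hxξ : x ∈ ξ.source) :
    coordSpan ξ (Module.finrank ℝ (pushforwardSpan U 𝓕 m)) x = pushforwardSpan U 𝓕 x := by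
  -- The inclusion holds throughout the chart; equality comes from the dimensions and needs the rank
  -- at `x` not to exceed `q`.
  refine Submodule.eq_of_le_of_finrank_eq (Submodule.span_le.2 ?_) ?_
  · rintro v ⟨i, hi, rfl⟩
    exact hξ.coordField_mem x hxξ i hi
  · rw [finrank_coordSpan hξ.contDiffOn hξ.contDiffOn_symm ?_ hxξ, hx]
    exact (Submodule.finrank_le _).trans (by simp)

/-- The parametrised list of fields, the times being the coordinates of the parameter. -/
def coordList {N : ℕ} (X : Fin N → Euc d → Euc d) :
    List ((Euc d → Euc d) × ((Fin N → ℝ) → ℝ)) :=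
  List.ofFn fun j => (X j, fun t => t j)

lemma evalList_coordList {N : ℕ} (X : Fin N → Euc d → Euc d) (t : Fin N → ℝ) :
    evalList (coordList X) t = List.ofFn fun j => (X j, t j) := by
  simp only [evalList, coordList, List.map_ofFn]
  rfl

/-- The map `(t₁, …, t_N) ↦ X¹_{t₁}(⋯ X^N_{t_N}(x) ⋯)` is an arc. -/
theorem exists_isArc_concat {n : WithTop ℕ∞} {D : Euc d → Submodule ℝ (Euc d)} {N : ℕ}
    {X : Fin N → Euc d → Euc d} (hX : ∀ j, IsFlowAdapted n U D (X j)) {t : Fin N → ℝ} {x y : Euc d}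
    (h : ConcatTo U X t x y) :
    ∃ (A : Set ((Fin N → ℝ) × Euc d)) (Θ : (Fin N → ℝ) × Euc d → Euc d), (t, x) ∈ A ∧
      IsArc n U D (coordList X) A Θ ∧ ∀ q ∈ A, ConcatTo U X q.1 q.2 (Θ q) := by
  obtain ⟨A, Θ, hmem, hΘ⟩ := exists_isArc (L := coordList X) (p := t) (x := x) (y := y)
    (n := n) (D := D) (U := U) (fun e he => by
      obtain ⟨j, rfl⟩ := List.mem_ofFn.1 he
      exact ⟨hX j, contDiff_apply ℝ ℝ j⟩) (by
      rw [evalList_coordList]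
      exact concatTo_iff_reaches.1 h)
  refine ⟨A, Θ, hmem, hΘ, fun q hq => ?_⟩
  have := hΘ.reaches q hq
  rw [evalList_coordList] at this
  exact concatTo_iff_reaches.2 this

/-- Around any admissible times the composition of flows is defined on an open set. Openness makes
the domain locally connected and lets smoothness be tested locally. -/
lemma isOpen_concatDom {n : WithTop ℕ∞} {D : Euc d → Submodule ℝ (Euc d)} {N : ℕ}
    {X : Fin N → Euc d → Euc d} (hX : ∀ j, IsFlowAdapted n U D (X j)) (m : Euc d) :
    IsOpen (concatDom U X m) := by
  rw [isOpen_iff_mem_nhds]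
  rintro t ⟨y, hy⟩
  obtain ⟨A, Θ, hmem, hΘ, hc⟩ := exists_isArc_concat hX hy
  have hcont : Continuous fun t : Fin N → ℝ => (t, m) := by fun_prop
  filter_upwards [(hΘ.isOpen.preimage hcont).mem_nhds hmem] with s hs
  exact ⟨_, hc _ hs⟩

/-- Every map `F` is locally given by a map of class `Cⁿ`. -/
lemma exists_concatMap_eq {n : WithTop ℕ∞} {D : Euc d → Submodule ℝ (Euc d)} {m : Euc d} {N : ℕ}
    (hN : 0 < N) {X : Fin N → Euc d → Euc d} (hXF : ∀ j, X j ∈ 𝓕)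
    (hX : ∀ j, IsFlowAdapted n U D (X j)) (t : concatDom U X m) :
    ∃ (V : Set (Fin N → ℝ)) (G : (Fin N → ℝ) → Euc d), IsOpen V ∧ t.1 ∈ V ∧ ContDiffOn ℝ n G V ∧
      (∀ s : concatDom U X m, s.1 ∈ V → (concatMap U 𝓕 m hN X hXF s).incl = G s.1) ∧
      (n ≠ 0 → ∀ s ∈ V, ∀ v, fderiv ℝ G s v ∈ D (G s)) := by
  obtain ⟨y, hy⟩ := t.2
  obtain ⟨A, Θ, hmem, hΘ, hc⟩ := exists_isArc_concat hX hy
  have hcont : ContDiff ℝ n fun t : Fin N → ℝ => (t, m) := contDiff_id.prodMk contDiff_const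
  refine ⟨(fun t => (t, m)) ⁻¹' A, fun t => Θ (t, m), hΘ.isOpen.preimage hcont.continuous, hmem,
    hΘ.contDiffOn.comp hcont.contDiffOn fun s hs => hs, fun s hs => ?_, fun hn s hs v => ?_⟩
  · exact (concatTo_concatMap hN X hXF s).unique (fun j => (hX j).hasFlow) (hc _ hs)
  · have h0 : HasFDerivAt (fun t : Fin N → ℝ => (t, m))
        ((ContinuousLinearMap.id ℝ (Fin N → ℝ)).prod 0) s :=
      (hasFDerivAt_id s).prodMk (hasFDerivAt_const m s)
    have h1 : HasFDerivAt (fun t => Θ (t, m)) _ s :=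
      (hΘ.differentiableAt hn hs).hasFDerivAt.comp s h0
    rw [h1.fderiv]
    exact hΘ.horizontal hn _ hs v 0 (zero_mem _)

lemma continuous_incl_concatMap {n : WithTop ℕ∞} {D : Euc d → Submodule ℝ (Euc d)} {m : Euc d}
    {N : ℕ} (hN : 0 < N) {X : Fin N → Euc d → Euc d} (hXF : ∀ j, X j ∈ 𝓕)
    (hX : ∀ j, IsFlowAdapted n U D (X j)) :
    Continuous fun t => (concatMap U 𝓕 m hN X hXF t).incl := by
  rw [continuous_iff_continuousAt]
  intro t
  obtain ⟨V, G, hV, htV, hG, hGc, -⟩ := exists_concatMap_eq hN hXF hX t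
  have h1 : ContinuousAt (fun s : concatDom U X m => G s.1) t :=
    (hG.continuousOn.continuousAt (hV.mem_nhds htV)).comp continuousAt_subtype_val
  refine h1.congr ?_
  filter_upwards [continuousAt_subtype_val.preimage_mem_nhds (hV.mem_nhds htV)] with s hs
  exact (hGc s hs).symm

lemma continuous_incl {n : WithTop ℕ∞} {D : Euc d → Submodule ℝ (Euc d)}
    (hF : ∀ X ∈ 𝓕, IsFlowAdapted n U D X) (m : Euc d) :
    Continuous (OrbitSpace.incl (U := U) (𝓕 := 𝓕) (m := m)) :=
  OrbitSpace.continuous_dom fun _ hN _ hX => continuous_incl_concatMap hN hX fun j => hF _ (hX j)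

/-- The adapted coordinates are plaque charts of the orbits of points where the distribution has
the right dimension. -/
theorem IsFlowChart.isPlaqueChart (hU : IsOpen U) (hF : ∀ X ∈ 𝓕, ContDiffOn ℝ ∞ X U)
    {m : Euc d} (hm : m ∈ U) (hne : 𝓕.Nonempty)
    {ξ : OpenPartialHomeomorph (Euc d) (Euc d)} {η : ℝ}
    (hξ : IsFlowChart U 𝓕 (Module.finrank ℝ (pushforwardSpan U 𝓕 m)) ξ η) :
    IsPlaqueChart (OrbitSpace.incl (U := U) (𝓕 := 𝓕) (m := m))
      (Module.finrank ℝ (pushforwardSpan U 𝓕 m)) ξ η := by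
  have hflow : ∀ X ∈ 𝓕, HasFlow U X := fun X hX => hasFlow_of_contDiffOn hU ((hF X hX).of_le (by simp))
  have hadapt := fun X hX => isFlowAdapted_pushforwardSpan (X := X) hU hF hX
  have hspan : ∀ x ∈ orbit U 𝓕 m, x ∈ ξ.source → _ := fun x hx hxξ =>
    hξ.pushforwardSpan_eq (finrank_eq_of_mem_orbit hU hF hx) hxξ
  set q := Module.finrank ℝ (pushforwardSpan U 𝓕 m)
  obtain ⟨L, hL, hreach⟩ := hξ.reaches
  have hLflow : ∀ v, ∀ e ∈ evalList L v, e.1 ∈ 𝓕 := fun v =>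
    forall_mem_evalList (R := fun X => X ∈ 𝓕) (fun e he => (hL e he).1) v
  -- Back from a point of the slice to the transversal, then forward to another point: a slice lies
  -- in a single orbit.
  have hslice : ∀ v ∈ cube d η, ∀ v' ∈ cube d η, tailCoord q v = tailCoord q v' →
      Reaches U (evalList L v' ++ inverseList (evalList L v)) (ξ.symm v) (ξ.symm v') := by
    intro v hv v' hv' h
    refine reaches_append.2 ⟨_, (hreach v hv).symm fun e he => hflow _ (hLflow v e he), ?_⟩
    rw [tailPart_eq_of_tailCoord_eq h]
    exact hreach v' hv'
  have hmemL : ∀ v v', ∀ e ∈ evalList L v' ++ inverseList (evalList L v), e.1 ∈ 𝓕 := by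
    intro v v' e he
    rcases List.mem_append.1 he with he | he
    · exact hLflow v' e he
    · exact hLflow v (e.1, -e.2) (mem_inverseList.1 he)
  have hcube : ∀ x ∈ ξ.source, ξ x ∈ cube d η := fun x hx => hξ.target_eq ▸ ξ.map_source hx
  refine ⟨hξ.pos, hξ.target_eq, hξ.contDiffOn, hξ.contDiffOn_symm, ?_, fun p hp => ?_⟩
  · intro x hx y hy h hxr
    rw [OrbitSpace.range_incl] at hxr ⊢
    have := hslice _ (hcube x hx) _ (hcube y hy) h
    rw [ξ.left_inv hx, ξ.left_inv hy] at this
    exact orbit_trans hxr (this.mem_orbit hne (orbit_subset hxr) (hmemL _ _))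
  set z := tailCoord q (ξ p.incl)
  refine le_antisymm (le_inf ?_ ?_) ?_
  · exact (continuous_incl hadapt m).continuousAt.tendsto.le_comap
  · rw [Filter.le_principal_iff]
    refine IsOpen.mem_nhds ?_ ⟨hp, rfl⟩
    -- Openness of the plaque is continuity of its indicator into the Sierpiński space `Prop`, which
    -- may be tested on each map (1).
    have hind : Continuous fun p : OrbitSpace U 𝓕 m =>
        (p.incl ∈ ξ.source ∧ tailCoord q (ξ p.incl) = z : Prop) := by
      refine OrbitSpace.continuous_dom fun N hN X hX => ?_
      refine continuous_Prop.2 (isOpen_iff_mem_nhds.2 fun t ht => ?_)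
      obtain ⟨V, G, hV, htV, hG, hGc, hGd⟩ :=
        exists_concatMap_eq hN hX (fun j => hadapt _ (hX j)) t
      have hGt : G t.1 ∈ ξ.source := (hGc t htV) ▸ ht.1
      have hdom := isOpen_concatDom (fun j => hadapt _ (hX j)) m
      have hVo : IsOpen (V ∩ concatDom U X m) := hV.inter hdom
      have hW : IsOpen ((V ∩ concatDom U X m) ∩ G ⁻¹' ξ.source) :=
        (hG.continuousOn.mono inter_subset_left).isOpen_inter_preimage hVo ξ.open_source
      obtain ⟨r, hr, hball⟩ := Metric.isOpen_iff.1 hW t.1 ⟨⟨htV, t.2⟩, hGt⟩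
      -- The derivative of a map (1) takes values in `P_𝓕`, which on the orbit is spanned by the
      -- slice directions; hence the tail coordinates are constant on balls of times.
      have hderiv : ∀ s ∈ Metric.ball t.1 r,
          HasFDerivAt (fun s => tailCoordL q (ξ (G s)))
            (0 : (Fin N → ℝ) →L[ℝ] ({i : Fin d // q ≤ i.1} → ℝ)) s := by
        intro s hs
        obtain ⟨⟨hsV, hsd⟩, hsξ⟩ := hball hs
        have d1 := ((hG.contDiffAt (hV.mem_nhds hsV)).differentiableAt (by simp)).hasFDerivAt
        have d2 := (differentiableAt_of_smooth hξ.contDiffOn hsξ).hasFDerivAt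
        refine ((tailCoordL q).hasFDerivAt.comp s (d2.comp s d1)).congr_fderiv ?_
        ext1 v
        have hGs := hGc ⟨s, hsd⟩ hsV
        have hGo : G s ∈ orbit U 𝓕 m := by
          rw [← hGs]
          exact (concatMap U 𝓕 m hN X hX ⟨s, hsd⟩).2
        have h1 := hGd (by simp) s hsV v
        rw [← hspan _ hGo hsξ] at h1
        exact (mem_coordSpan_iff hξ.contDiffOn hξ.contDiffOn_symm hsξ).1 h1
      have hconst : ∀ s ∈ Metric.ball t.1 r, tailCoordL q (ξ (G s)) = tailCoordL q (ξ (G t.1)) := by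
        intro s hs
        exact (convex_ball t.1 r).is_const_of_fderivWithin_eq_zero
          (fun s hs => (hderiv s hs).differentiableAt.differentiableWithinAt)
          (fun s hs => by
            rw [fderivWithin_of_isOpen Metric.isOpen_ball hs, (hderiv s hs).fderiv]) hs
          (Metric.mem_ball_self hr)
      filter_upwards [continuousAt_subtype_val.preimage_mem_nhds
        (Metric.ball_mem_nhds t.1 hr)] with s hs
      have hsV := (hball hs).1.1
      have h2 := hconst s hs
      rw [← hGc s hsV, ← hGc t htV] at h2
      exact ⟨by rw [hGc s hsV]; exact (hball hs).2, h2.trans ht.2⟩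
    exact continuous_Prop.1 hind
  -- Conversely, the slice through `p` is parametrized by flows whose times depend continuously on
  -- the point. The parametrization is therefore continuous for the orbit topology, which is no
  -- finer than the slice topology near `p`.
  · let P := {v : Euc d // v ∈ cube d η ∧ tailCoord q v = z}
    obtain ⟨l, hlne, hl, hlp⟩ := mem_orbit_iff.1 (show p.incl ∈ orbit U 𝓕 m from p.2)
    have hr : ∀ v : P, Reaches U
        ((evalList L v.1 ++ inverseList (evalList L (ξ p.incl))) ++ l) m (ξ.symm v.1) := fun v => by
      have := hslice _ (hcube _ hp) v.1 v.2.1 v.2.2.symm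
      rw [ξ.left_inv hp] at this
      exact reaches_append.2 ⟨_, hlp, this⟩
    let c : P → OrbitSpace U 𝓕 m := fun v => ⟨ξ.symm v.1, (hr v).mem_orbit hne hm fun e he => by
      rcases List.mem_append.1 he with he | he
      · exact hmemL _ _ e he
      · exact hl e he⟩
    have hc : Continuous c := by
      refine continuous_of_reaches hflow (h := c)
        (L := reparam (fun v : P => v.1) L ++
          (inverseList (evalList L (ξ p.incl)) ++ l).map fun e => (e.1, fun _ => e.2)) (by
            simp [hlne]) ?_ ?_
      · intro e he
        rcases List.mem_append.1 he with he | he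
        · obtain ⟨e', he', rfl⟩ := List.mem_map.1 he
          exact ⟨(hL e' he').1, (hL e' he').2.comp continuous_subtype_val⟩
        · obtain ⟨e', he', rfl⟩ := List.mem_map.1 he
          refine ⟨?_, continuous_const⟩
          rcases List.mem_append.1 he' with he' | he'
          · exact hmemL _ (ξ p.incl) _ (List.mem_append_right _ he')
          · exact hl _ he'
      · intro v
        have h1 := hr v
        rw [evalList_append, evalList_reparam]
        have h2 : evalList ((inverseList (evalList L (ξ p.incl)) ++ l).map
            fun e => (e.1, fun _ : P => e.2)) v = inverseList (evalList L (ξ p.incl)) ++ l := by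
          simp [evalList, Function.comp_def]
        rw [h2, ← List.append_assoc]
        exact h1
    intro V hV
    have hcp : c ⟨ξ p.incl, hcube _ hp, rfl⟩ = p := OrbitSpace.incl_injective (ξ.left_inv hp)
    have h1 : c ⁻¹' V ∈ 𝓝 (⟨ξ p.incl, hcube _ hp, rfl⟩ : P) :=
      hc.continuousAt.preimage_mem_nhds (by rwa [hcp])
    obtain ⟨W, hW, hWV⟩ := mem_nhds_subtype _ _ _ |>.1 h1
    have h2 : ξ ⁻¹' W ∈ 𝓝 p.incl := (ξ.continuousAt hp).preimage_mem_nhds hW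
    refine Filter.mem_of_superset (Filter.inter_mem_inf (Filter.preimage_mem_comap h2)
      (Filter.mem_principal_self _)) ?_
    rintro p' ⟨hp'W, hp'ξ, hp't⟩
    have h3 := @hWV ⟨ξ p'.incl, hcube _ hp'ξ, hp't⟩ hp'W
    have h4 : c ⟨ξ p'.incl, hcube _ hp'ξ, hp't⟩ = p' := OrbitSpace.incl_injective (ξ.left_inv hp'ξ)
    rw [mem_preimage, h4] at h3
    exact h3

end SmoothOrbits


/-! ### The topology of a space with plaque charts -/

section ChainCover

/-- A connected space covered by countably many families of pairwise disjoint open second countable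
sets is second countable. -/
theorem secondCountableTopology_of_disjoint_families {M : Type*} [TopologicalSpace M]
    [ConnectedSpace M] {C Z : Type*} [Countable C] (P : C → Z → Set M)
    (hopen : ∀ c z, IsOpen (P c z)) (hsc : ∀ c z, SecondCountableTopology (P c z))
    (hdisj : ∀ c, Pairwise (Function.onFun Disjoint (P c))) (hcov : ∀ x, ∃ c z, x ∈ P c z) :
    SecondCountableTopology M := by
  obtain ⟨x₀⟩ := (inferInstance : Nonempty M)
  obtain ⟨c₀, z₀, hx₀⟩ := hcov x₀
  -- `B n` consists of the sets joined to the initial one by a chain of length `n`. A second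
  -- countable set meets only countably many members of each disjoint family, so each `B n` is
  -- countable.
  let step : Set (C × Z) → Set (C × Z) := fun B =>
    {e | ∃ b ∈ B, (P e.1 e.2 ∩ P b.1 b.2).Nonempty}
  let B : ℕ → Set (C × Z) := fun n => step^[n] {(c₀, z₀)}
  have hBsucc : ∀ n, B (n + 1) = step (B n) := fun n => Function.iterate_succ_apply' _ _ _
  have hcount : ∀ n, (B n).Countable := by
    intro n
    induction n with
    | zero => exact countable_singleton _
    | succ n ih =>
      rw [hBsucc]
      have : step (B n) ⊆ ⋃ b ∈ B n, ⋃ c, (fun z => (c, z)) ''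
          {z | (P c z ∩ P b.1 b.2).Nonempty} := by
        rintro ⟨c, z⟩ ⟨b, hb, h⟩
        simp only [mem_iUnion]
        exact ⟨b, hb, c, z, h, rfl⟩
      refine Countable.mono this (ih.biUnion fun b _ => countable_iUnion fun c =>
        Countable.image ?_ _)
      have := hsc b.1 b.2
      refine PairwiseDisjoint.countable_of_isOpen (α := P b.1 b.2)
        (s := fun z => Subtype.val ⁻¹' P c z) ?_ (fun z _ => (hopen c z).preimage
          continuous_subtype_val) ?_
      · intro z _ z' _ hne
        exact (hdisj c hne).preimage _
      · rintro z ⟨x, hx, hxb⟩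
        exact ⟨⟨x, hxb⟩, hx⟩
  let B' : Set (C × Z) := ⋃ n, B n
  have hB' : B'.Countable := countable_iUnion hcount
  let W : Set M := ⋃ b : B', P b.1.1 b.1.2
  have hWo : IsOpen W := isOpen_iUnion fun b => hopen _ _
  have hmem : ∀ c z x, x ∈ P c z → x ∈ W → P c z ⊆ W := by
    intro c z x hx hxW
    obtain ⟨⟨b, hb⟩, hxb⟩ := mem_iUnion.1 hxW
    obtain ⟨n, hn⟩ := mem_iUnion.1 hb
    have : (c, z) ∈ B' := mem_iUnion.2 ⟨n + 1, by
      rw [hBsucc]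
      exact ⟨b, hn, x, hx, hxb⟩⟩
    exact subset_iUnion (fun b : B' => P b.1.1 b.1.2) ⟨(c, z), this⟩
  -- A set of the cover that meets `W` lies in `W`, so the complement of `W` is open as well.
  have hWc : IsClosed W := by
    rw [← isOpen_compl_iff, isOpen_iff_mem_nhds]
    intro x hx
    obtain ⟨c, z, hxc⟩ := hcov x
    filter_upwards [(hopen c z).mem_nhds hxc] with y hy hyW
    exact hx (hmem c z y hy hyW hxc)
  have hWu : W = univ := by
    refine IsClopen.eq_univ ⟨hWc, hWo⟩ ⟨x₀, mem_iUnion.2 ⟨⟨(c₀, z₀), mem_iUnion.2 ⟨0, rfl⟩⟩, hx₀⟩⟩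
  have := hB'.to_subtype
  have := fun b : B' => hsc b.1.1 b.1.2
  exact TopologicalSpace.secondCountableTopology_of_countable_cover
    (fun b : B' => hopen b.1.1 b.1.2) hWu

end ChainCover

/-! ### Splitting a vector into head and tail, and putting it together again. -/

section Join

variable {d : ℕ}

/-- The first `q` coordinates, as a vector of `ℝ^q`. -/
def headPart {q : ℕ} (hq : q ≤ d) : Euc d →L[ℝ] Euc q :=
  (EuclideanSpace.equiv (Fin q) ℝ).symm.toContinuousLinearMap.comp (headVec hq)

/-- The vector with given first coordinates and given last coordinates. -/
def join (q : ℕ) (u : Euc q) (z : {i : Fin d // q ≤ i.1} → ℝ) : Euc d :=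
  WithLp.toLp 2 fun i => if h : i.1 < q then u ⟨i.1, h⟩ else z ⟨i, not_lt.1 h⟩

lemma headPart_apply {q : ℕ} (hq : q ≤ d) (v : Euc d) (i : Fin q) :
    headPart hq v i = v (Fin.castLE hq i) := rfl

lemma tailCoord_join {q : ℕ} (u : Euc q) (z : {i : Fin d // q ≤ i.1} → ℝ) :
    tailCoord q (join q u z) = z := by
  funext i
  simp [tailCoord, join, i.2.not_gt]

lemma headPart_join {q : ℕ} (hq : q ≤ d) (u : Euc q) (z : {i : Fin d // q ≤ i.1} → ℝ) :
    headPart hq (join q u z) = u := by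
  ext i
  simp [headPart_apply, join]

lemma join_headPart_tailCoord {q : ℕ} (hq : q ≤ d) (v : Euc d) :
    join q (headPart hq v) (tailCoord q v) = v := by
  ext i
  by_cases h : i.1 < q <;> simp [join, headPart_apply, tailCoord]

lemma continuous_join (q : ℕ) :
    Continuous fun p : Euc q × ({i : Fin d // q ≤ i.1} → ℝ) => join q p.1 p.2 := by
  refine (PiLp.continuous_toLp 2 _).comp (continuous_pi fun i => ?_)
  by_cases h : i.1 < q
  · simp only [h, dite_true]
    fun_prop
  · simp only [h, dite_false]
    fun_prop

lemma contDiff_join (q : ℕ) (z : {i : Fin d // q ≤ i.1} → ℝ) :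
    ContDiff ℝ ∞ fun u : Euc q => join q u z := by
  rw [contDiff_euclidean]
  intro i
  by_cases h : i.1 < q
  · simp only [join, h, dite_true]
    fun_prop
  · simp only [join, h, dite_false]
    fun_prop

lemma join_mem_cube_iff {q : ℕ} (hq : q ≤ d) {η : ℝ} {u : Euc q} {v : Euc d}
    (hv : v ∈ cube d η) : join q u (tailCoord q v) ∈ cube d η ↔ u ∈ cube q η := by
  constructor
  · intro h i
    have := h (Fin.castLE hq i)
    simpa [join] using this
  · intro h i
    by_cases hi : i.1 < q
    · simpa [join, hi] using h ⟨i, hi⟩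
    · simpa [join, hi, tailCoord] using hv i

lemma headPart_mem_cube {q : ℕ} (hq : q ≤ d) {η : ℝ} {v : Euc d} (hv : v ∈ cube d η) :
    headPart hq v ∈ cube q η := fun i => hv (Fin.castLE hq i)

end Join

/-! ### Plaques: charts, countability, lifting of continuity. -/

section Plaques

variable {d q : ℕ} {M : Type} [TopologicalSpace M] {ι : M → Euc d}
  {ξ : OpenPartialHomeomorph (Euc d) (Euc d)} {η : ℝ}

/-- `M` has plaque charts of dimension `q`, centred at each of its points. -/
structure IsPlaqueManifold (ι : M → Euc d) (q : ℕ) : Prop where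
  injective : Function.Injective ι
  le : q ≤ d
  exists_chart : ∀ p, ∃ ξ η, IsPlaqueChart ι q ξ η ∧ ι p ∈ ξ.source

/-- The plaque of level `z`. -/
def plaque (ι : M → Euc d) (q : ℕ) (ξ : OpenPartialHomeomorph (Euc d) (Euc d))
    (z : {i : Fin d // q ≤ i.1} → ℝ) : Set M :=
  {p | ι p ∈ ξ.source ∧ tailCoord q (ξ (ι p)) = z}

lemma IsPlaqueChart.isOpen_plaque (h : IsPlaqueChart ι q ξ η) (z) :
    IsOpen (plaque ι q ξ z) := by
  rw [isOpen_iff_mem_nhds]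
  rintro p ⟨hp, hz⟩
  rw [h.nhds_eq p hp, ← hz]
  exact Filter.mem_inf_of_right (Filter.mem_principal_self _)

lemma IsPlaqueManifold.continuous (hM : IsPlaqueManifold ι q) : Continuous ι := by
  rw [continuous_iff_continuousAt]
  intro p
  obtain ⟨ξ, η, hξ, hp⟩ := hM.exists_chart p
  refine Filter.map_le_iff_le_comap.2 ?_
  rw [hξ.nhds_eq p hp]
  exact inf_le_left

lemma IsPlaqueManifold.t2Space (hM : IsPlaqueManifold ι q) : T2Space M :=
  T2Space.of_injective_continuous hM.injective hM.continuous

lemma IsPlaqueChart.map_mem_cube (h : IsPlaqueChart ι q ξ η) {x : Euc d} (hx : x ∈ ξ.source) :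
    ξ x ∈ cube d η := h.target_eq ▸ ξ.map_source hx

lemma IsPlaqueChart.exists_preimage (h : IsPlaqueChart ι q ξ η) (hq : q ≤ d) {p : M}
    (hp : ι p ∈ ξ.source) {u : Euc q} (hu : u ∈ cube q η) :
    ∃ p', ι p' = ξ.symm (join q u (tailCoord q (ξ (ι p)))) := by
  have hc := (join_mem_cube_iff hq (h.map_mem_cube hp)).2 hu
  rw [← h.target_eq] at hc
  refine h.saturated _ hp _ (ξ.map_target hc) ?_ ⟨p, rfl⟩
  rw [ξ.right_inv hc, tailCoord_join]

open Classical in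
/-- The chart of the plaque through `p`, given by the first coordinates. -/
def plaqueChart (hM : IsPlaqueManifold ι q) (h : IsPlaqueChart ι q ξ η) (p : M)
    (hp : ι p ∈ ξ.source) : OpenPartialHomeomorph M (Euc q) where
  toFun p' := headPart hM.le (ξ (ι p'))
  invFun u := if hu : u ∈ cube q η then (h.exists_preimage hM.le hp hu).choose else p
  source := plaque ι q ξ (tailCoord q (ξ (ι p)))
  target := cube q η
  map_source' p' hp' := headPart_mem_cube _ (h.map_mem_cube hp'.1)
  map_target' u hu := by
    have hc := (join_mem_cube_iff hM.le (h.map_mem_cube hp)).2 hu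
    rw [← h.target_eq] at hc
    have he := (h.exists_preimage hM.le hp hu).choose_spec
    rw [dif_pos hu]
    refine ⟨by rw [he]; exact ξ.map_target hc, ?_⟩
    rw [he, ξ.right_inv hc, tailCoord_join]
  left_inv' p' hp' := by
    have hu := headPart_mem_cube hM.le (h.map_mem_cube hp'.1)
    have he := (h.exists_preimage hM.le hp hu).choose_spec
    rw [dif_pos hu]
    refine hM.injective (he.trans ?_)
    rw [← hp'.2, join_headPart_tailCoord, ξ.left_inv hp'.1]
  right_inv' u hu := by
    have hc := (join_mem_cube_iff hM.le (h.map_mem_cube hp)).2 hu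
    rw [← h.target_eq] at hc
    have he := (h.exists_preimage hM.le hp hu).choose_spec
    rw [dif_pos hu, he, ξ.right_inv hc, headPart_join]
  open_source := h.isOpen_plaque _
  open_target := isOpen_cube η
  continuousOn_toFun := (headPart hM.le).continuous.comp_continuousOn
    (ξ.continuousOn.comp hM.continuous.continuousOn fun _ hp' => hp'.1)
  continuousOn_invFun := by
    intro u hu
    have hc : ∀ u ∈ cube q η, join q u (tailCoord q (ξ (ι p))) ∈ ξ.target := fun u hu => by
      rw [h.target_eq]
      exact (join_mem_cube_iff hM.le (h.map_mem_cube hp)).2 hu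
    have he : ∀ u ∈ cube q η, ι (if hu : u ∈ cube q η then
        (h.exists_preimage hM.le hp hu).choose else p) =
          ξ.symm (join q u (tailCoord q (ξ (ι p)))) := fun u hu => by
      rw [dif_pos hu, (h.exists_preimage hM.le hp hu).choose_spec]
    have hs : ι (if hu : u ∈ cube q η then
        (h.exists_preimage hM.le hp hu).choose else p) ∈ ξ.source := by
      rw [he u hu]
      exact ξ.map_target (hc u hu)
    rw [ContinuousWithinAt, h.nhds_eq _ hs, Filter.tendsto_inf, Filter.tendsto_comap_iff,
      Filter.tendsto_principal]
    constructor
    · have h1 : ContinuousWithinAt (fun u => ξ.symm (join q u (tailCoord q (ξ (ι p)))))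
          (cube q η) u :=
        (ξ.continuousOn_symm.comp (contDiff_join q _).continuous.continuousOn hc) u hu
      exact h1.congr (fun v hv => he v hv) (he u hu)
    · filter_upwards [self_mem_nhdsWithin] with v hv
      rw [he v hv, he u hu, ξ.right_inv (hc v hv), ξ.right_inv (hc u hu), tailCoord_join,
        tailCoord_join]
      exact ⟨ξ.map_target (hc v hv), rfl⟩

lemma incl_plaqueChart_symm (hM : IsPlaqueManifold ι q) (h : IsPlaqueChart ι q ξ η) {p : M}
    (hp : ι p ∈ ξ.source) {u : Euc q} (hu : u ∈ cube q η) :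
    ι ((plaqueChart hM h p hp).symm u) = ξ.symm (join q u (tailCoord q (ξ (ι p)))) := by
  change ι (@dite _ _ (Classical.propDecidable _) _ _) = _
  rw [dif_pos hu, (h.exists_preimage hM.le hp hu).choose_spec]

lemma IsPlaqueChart.secondCountableTopology_plaque (hM : IsPlaqueManifold ι q)
    (h : IsPlaqueChart ι q ξ η) (z) : SecondCountableTopology (plaque ι q ξ z) := by
  rcases (plaque ι q ξ z).eq_empty_or_nonempty with he | ⟨p, hp, hz⟩
  · rw [he]
    infer_instance
  · subst hz
    exact (plaqueChart hM h p hp).toHomeomorphSourceTarget.secondCountableTopology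

omit [TopologicalSpace M] in
lemma pairwise_disjoint_plaque :
    Pairwise (Function.onFun Disjoint (plaque ι q ξ)) := by
  intro z z' hne
  refine disjoint_left.2 ?_
  rintro p ⟨-, hz⟩ ⟨-, hz'⟩
  exact hne (hz.symm.trans hz')

/-- By the Lindelöf property of `ℝᵈ`, countably many ambient charts suffice. The plaques of one
chart are disjoint, open, and homeomorphic to a cube or empty, so the chain argument applies. -/
theorem IsPlaqueManifold.secondCountableTopology [ConnectedSpace M]
    (hM : IsPlaqueManifold ι q) : SecondCountableTopology M := by
  choose ξ η hξ hp using hM.exists_chart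
  obtain ⟨C, hC, hcov⟩ := TopologicalSpace.isOpen_iUnion_countable (fun p => (ξ p).source)
    fun p => (ξ p).open_source
  have := hC.to_subtype
  refine secondCountableTopology_of_disjoint_families (C := C)
    (fun c z => plaque ι q (ξ c) z) (fun c z => (hξ c).isOpen_plaque z)
    (fun c z => (hξ c).secondCountableTopology_plaque hM z)
    (fun c => pairwise_disjoint_plaque) fun x => ?_
  have hx : ι x ∈ ⋃ p ∈ C, (ξ p).source := hcov ▸ mem_iUnion.2 ⟨x, hp x⟩
  obtain ⟨c, hc, hxc⟩ := mem_iUnion₂.1 hx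
  exact ⟨⟨c, hc⟩, _, hxc, rfl⟩

/-- The levels of the plaques. -/
def levels (ι : M → Euc d) (q : ℕ) (ξ : OpenPartialHomeomorph (Euc d) (Euc d)) :
    Set ({i : Fin d // q ≤ i.1} → ℝ) :=
  {z | (plaque ι q ξ z).Nonempty}

/-- Disjoint nonempty open sets are countably many in a second countable space. This is what
prevents curves from jumping between plaques. -/
lemma IsPlaqueChart.countable_levels [SecondCountableTopology M] (h : IsPlaqueChart ι q ξ η) :
    (levels ι q ξ).Countable :=
  PairwiseDisjoint.countable_of_isOpen (s := plaque ι q ξ)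
    (fun _ _ _ _ hne => pairwise_disjoint_plaque hne) (fun z _ => h.isOpen_plaque z) fun _ hz => hz

/-- A map with values in the image of `ι`, continuous on a preconnected set, stays in a plaque. -/
lemma IsPlaqueChart.tailCoord_eq_of_isPreconnected [SecondCountableTopology M]
    (h : IsPlaqueChart ι q ξ η) {A : Type*} [TopologicalSpace A] {g : A → Euc d} {V : Set A}
    (hV : IsPreconnected V) (hg : ContinuousOn g V) (hgξ : ∀ a ∈ V, g a ∈ ξ.source)
    (hgι : ∀ a ∈ V, g a ∈ range ι) {a b : A} (ha : a ∈ V) (hb : b ∈ V) :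
    tailCoord q (ξ (g a)) = tailCoord q (ξ (g b)) := by
  have hc : ContinuousOn (fun a => tailCoord q (ξ (g a))) V :=
    (tailCoordL q).continuous.comp_continuousOn (ξ.continuousOn.comp hg hgξ)
  have hsub : (fun a => tailCoord q (ξ (g a))) '' V ⊆ levels ι q ξ := by
    rintro - ⟨a, ha, rfl⟩
    obtain ⟨p, hp⟩ := hgι a ha
    exact ⟨p, by rw [hp]; exact hgξ a ha, by rw [hp]⟩
  -- The tail coordinates have a connected image inside a countable set, which is totally
  -- disconnected.
  exact h.countable_levels.isTotallyDisconnected _ hsub (hV.image _ hc) ⟨a, ha, rfl⟩ ⟨b, hb, rfl⟩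

/-- Lifting of continuity from the ambient space. -/
theorem IsPlaqueManifold.continuous_of_comp [SecondCountableTopology M]
    (hM : IsPlaqueManifold ι q) {A : Type*} [TopologicalSpace A] [LocallyConnectedSpace A]
    {g : A → M} (hg : Continuous (ι ∘ g)) : Continuous g := by
  rw [continuous_iff_continuousAt]
  intro a
  obtain ⟨ξ, η, hξ, hp⟩ := hM.exists_chart (g a)
  rw [ContinuousAt, hξ.nhds_eq _ hp, Filter.tendsto_inf, Filter.tendsto_comap_iff,
    Filter.tendsto_principal]
  refine ⟨hg.continuousAt, ?_⟩
  -- On a connected neighbourhood mapped into the chart `ι ∘ g` cannot change plaque, so ambient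
  -- convergence is convergence in `M`.
  obtain ⟨V, hV, hVo, haV, hVc⟩ := locallyConnectedSpace_iff_subsets_isOpen_isConnected.1
    inferInstance a _ (hg.continuousAt.preimage_mem_nhds (ξ.open_source.mem_nhds hp))
  filter_upwards [hVo.mem_nhds haV] with b hb
  exact ⟨hV hb, hξ.tailCoord_eq_of_isPreconnected hVc.isPreconnected hg.continuousOn
    (fun a ha => hV ha) (fun a _ => mem_range_self (g a)) hb haV⟩

/-- The product structure of the topology in the domain of a plaque chart. -/
theorem IsPlaqueChart.isInducing (hM : IsPlaqueManifold ι q) (h : IsPlaqueChart ι q ξ η) :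
    @IsInducing {p : M // ι p ∈ ξ.source}
      (({i : Fin d // i.1 < q} → ℝ) × ({i : Fin d // q ≤ i.1} → ℝ))
      _ (@instTopologicalSpaceProd _ _ _ ⊥)
      (fun p => (headCoord q (ξ (ι p.1)), tailCoord q (ξ (ι p.1)))) := by
  rw [@isInducing_iff_nhds _ _ _ (@instTopologicalSpaceProd _ _ _ ⊥)]
  intro p
  rw [@nhds_prod_eq _ _ _ ⊥, @nhds_discrete _ ⊥ (@DiscreteTopology.mk _ ⊥ rfl), Filter.prod_eq_inf, Filter.comap_inf, Filter.comap_comap,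
    Filter.comap_comap]
  set z := tailCoord q (ξ (ι p.1))
  have hcont : Continuous fun p : {p : M // ι p ∈ ξ.source} => ξ (ι p.1) :=
    ξ.continuousOn.comp_continuous (hM.continuous.comp continuous_subtype_val) fun p => p.2
  refine le_antisymm (le_inf ?_ ?_) ?_
  · exact ((headCoordL q).continuous.comp hcont).continuousAt.tendsto.le_comap
  · refine Filter.Tendsto.le_comap ?_
    rw [Filter.tendsto_pure]
    filter_upwards [((h.isOpen_plaque z).preimage continuous_subtype_val).mem_nhds
      (show p.1 ∈ plaque ι q ξ z from ⟨p.2, rfl⟩)] with p' hp'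
    exact hp'.2
  · rw [nhds_subtype_eq_comap, h.nhds_eq p.1 p.2, Filter.comap_inf, Filter.comap_comap,
      Filter.comap_principal]
    have hz : Filter.Tendsto (fun p : {p : M // ι p ∈ ξ.source} => tailCoord q (ξ (ι p.1)))
        (Filter.comap (Prod.fst ∘ fun p : {p : M // ι p ∈ ξ.source} =>
          (headCoord q (ξ (ι p.1)), tailCoord q (ξ (ι p.1)))) (𝓝 (headCoord q (ξ (ι p.1)))) ⊓
        Filter.comap (Prod.snd ∘ fun p : {p : M // ι p ∈ ξ.source} =>
          (headCoord q (ξ (ι p.1)), tailCoord q (ξ (ι p.1)))) (pure z)) (pure z) :=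
      Filter.tendsto_comap.mono_left inf_le_right
    refine le_inf ?_ ?_
    · refine Filter.Tendsto.le_comap ?_
      have hh : Filter.Tendsto (fun p : {p : M // ι p ∈ ξ.source} => headCoord q (ξ (ι p.1)))
          _ (𝓝 (headCoord q (ξ (ι p.1)))) :=
        Filter.tendsto_comap.mono_left (inf_le_left (b := Filter.comap (Prod.snd ∘
          fun p : {p : M // ι p ∈ ξ.source} =>
            (headCoord q (ξ (ι p.1)), tailCoord q (ξ (ι p.1)))) (pure z)))
      have hpart : ∀ v : Euc d, WithLp.toLp 2 (fun i : Fin q =>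
          headCoord q v ⟨Fin.castLE hM.le i, i.2⟩) = headPart hM.le v := fun v => rfl
      have h1 : Continuous fun u : {i : Fin d // i.1 < q} → ℝ =>
          (WithLp.toLp 2 fun i : Fin q => u ⟨Fin.castLE hM.le i, i.2⟩ : Euc q) :=
        (PiLp.continuous_toLp 2 _).comp (by fun_prop)
      have h2 := (h1.tendsto _).comp hh
      -- `ξ (ι p')` is rebuilt from its head, which converges, and its tail, which is eventually
      -- constant; `ξ.symm` then gives convergence of `ι p'`.
      have h3 := ((continuous_join q).tendsto (headPart hM.le (ξ (ι p.1)), z)).comp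
        (h2.prodMk_nhds (hz.mono_right (pure_le_nhds z)))
      rw [join_headPart_tailCoord] at h3
      have h4 := (ξ.continuousAt_symm (ξ.map_source p.2)).tendsto.comp h3
      rw [ξ.left_inv p.2] at h4
      refine h4.congr fun p' => ?_
      change ξ.symm (join q (headPart hM.le (ξ (ι p'.1))) (tailCoord q (ξ (ι p'.1)))) = _
      rw [join_headPart_tailCoord, ξ.left_inv p'.2]
      rfl
    · rw [Filter.le_principal_iff]
      filter_upwards [Filter.tendsto_pure.1 hz] with p' hp'
      exact ⟨p'.2, hp'⟩

end Plaques


/-! ### The differential structure of a space with plaque charts -/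

section Immersions

variable {d k : ℕ} {M : Type} [TopologicalSpace M] [ChartedSpace (Euc k) M] {ι : M → Euc d}

lemma mfderiv_eq_fderiv_chart {p : M} (h : MDifferentiableAt (𝓡 k) (𝓡 d) ι p) :
    mfderiv (𝓡 k) (𝓡 d) ι p =
      fderiv ℝ (ι ∘ (chartAt (Euc k) p).symm) (chartAt (Euc k) p p) := by
  rw [h.mfderiv]
  simp only [writtenInExtChartAt, mfld_simps]
  rw [fderivWithin_univ]
  rfl

lemma contDiffOn_comp_chart_symm [IsManifold (𝓡 k) ∞ M] (h : ContMDiff (𝓡 k) (𝓡 d) ∞ ι) (p : M) :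
    ContDiffOn ℝ ∞ (ι ∘ (chartAt (Euc k) p).symm) (chartAt (Euc k) p).target :=
  contMDiffOn_iff_contDiffOn.1 (h.comp_contMDiffOn (contMDiffOn_chart_symm (I := 𝓡 k)))

end Immersions

namespace IsPlaqueManifold

variable {d q : ℕ} {M : Type} [TopologicalSpace M] {ι : M → Euc d}

/-- The ambient coordinates chosen at `p`. -/
def coords (hM : IsPlaqueManifold ι q) (p : M) : OpenPartialHomeomorph (Euc d) (Euc d) :=
  (hM.exists_chart p).choose

lemma exists_isPlaqueChart_coords (hM : IsPlaqueManifold ι q) (p : M) :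
    ∃ η, IsPlaqueChart ι q (hM.coords p) η ∧ ι p ∈ (hM.coords p).source :=
  (hM.exists_chart p).choose_spec

/-- The chart chosen at `p`. -/
def chart (hM : IsPlaqueManifold ι q) (p : M) : OpenPartialHomeomorph M (Euc q) :=
  plaqueChart hM (hM.exists_isPlaqueChart_coords p).choose_spec.1 p
    (hM.exists_isPlaqueChart_coords p).choose_spec.2

lemma mem_coords (hM : IsPlaqueManifold ι q) (p : M) : ι p ∈ (hM.coords p).source :=
  (hM.exists_isPlaqueChart_coords p).choose_spec.2

lemma contDiffOn_coords (hM : IsPlaqueManifold ι q) (p : M) :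
    ContDiffOn ℝ ∞ (hM.coords p) (hM.coords p).source :=
  (hM.exists_isPlaqueChart_coords p).choose_spec.1.contDiffOn

lemma contDiffOn_coords_symm (hM : IsPlaqueManifold ι q) (p : M) :
    ContDiffOn ℝ ∞ (hM.coords p).symm (hM.coords p).target :=
  (hM.exists_isPlaqueChart_coords p).choose_spec.1.contDiffOn_symm

lemma mem_chart_source (hM : IsPlaqueManifold ι q) (p : M) : p ∈ (hM.chart p).source :=
  ⟨hM.mem_coords p, rfl⟩

/-- The inverse of the chart in ambient coordinates. -/
def param (hM : IsPlaqueManifold ι q) (p : M) (u : Euc q) : Euc d :=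
  (hM.coords p).symm (join q u (tailCoord q (hM.coords p (ι p))))

lemma join_mem_target (hM : IsPlaqueManifold ι q) (p : M) {u : Euc q}
    (hu : u ∈ (hM.chart p).target) :
    join q u (tailCoord q (hM.coords p (ι p))) ∈ (hM.coords p).target := by
  have h := (hM.exists_isPlaqueChart_coords p).choose_spec.1
  rw [h.target_eq]
  exact (join_mem_cube_iff hM.le (h.map_mem_cube (hM.mem_coords p))).2 hu

lemma incl_chart_symm (hM : IsPlaqueManifold ι q) (p : M) {u : Euc q}
    (hu : u ∈ (hM.chart p).target) : ι ((hM.chart p).symm u) = hM.param p u :=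
  incl_plaqueChart_symm hM _ _ hu

lemma contDiffOn_param (hM : IsPlaqueManifold ι q) (p : M) :
    ContDiffOn ℝ ∞ (hM.param p) (hM.chart p).target :=
  (hM.contDiffOn_coords_symm p).comp (contDiff_join q _).contDiffOn
    fun _ hu => hM.join_mem_target p hu

lemma headPart_coords_param (hM : IsPlaqueManifold ι q) (p : M) {u : Euc q}
    (hu : u ∈ (hM.chart p).target) : headPart hM.le (hM.coords p (hM.param p u)) = u := by
  rw [param, (hM.coords p).right_inv (hM.join_mem_target p hu), headPart_join]

/-- Reading off the head coordinates is a smooth left inverse of the parametrization. -/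
lemma fderiv_param_injective (hM : IsPlaqueManifold ι q) (p : M) {u : Euc q}
    (hu : u ∈ (hM.chart p).target) : Function.Injective (fderiv ℝ (hM.param p) u) := by
  have hmem := (hM.chart p).open_target.mem_nhds hu
  have d1 := (((hM.contDiffOn_param p).contDiffAt hmem).differentiableAt (by simp)).hasFDerivAt
  have hs : hM.param p u ∈ (hM.coords p).source :=
    (hM.coords p).map_target (hM.join_mem_target p hu)
  have d2 := (differentiableAt_of_smooth (hM.contDiffOn_coords p) hs).hasFDerivAt
  have d3 := (headPart hM.le).hasFDerivAt.comp u (d2.comp u d1)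
  have d4 : HasFDerivAt (headPart hM.le ∘ hM.coords p ∘ hM.param p)
      (ContinuousLinearMap.id ℝ (Euc q)) u := by
    refine (hasFDerivAt_id u).congr_of_eventuallyEq ?_
    filter_upwards [hmem] with v hv
    exact hM.headPart_coords_param p hv
  have d5 := d3.unique d4
  refine Function.LeftInverse.injective
    (g := fun w => headPart hM.le (fderiv ℝ (hM.coords p) (hM.param p u) w)) fun v => ?_
  exact congrArg (fun A : Euc q →L[ℝ] Euc q => A v) d5

/-- The charts of the plaques. -/
@[reducible]
def chartedSpace (hM : IsPlaqueManifold ι q) : ChartedSpace (Euc q) M where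
  atlas := range hM.chart
  chartAt := hM.chart
  mem_chart_source := hM.mem_chart_source
  chart_mem_atlas p := ⟨p, rfl⟩

/-- A change of charts is a parametrization followed by the head of other ambient coordinates, hence
smooth as a composition of maps between Euclidean spaces. -/
lemma isManifold (hM : IsPlaqueManifold ι q) :
    letI := hM.chartedSpace
    IsManifold (𝓡 q) ∞ M := by
  let _ := hM.chartedSpace
  refine isManifold_of_contDiffOn _ _ _ ?_
  rintro - - ⟨p, rfl⟩ ⟨p', rfl⟩
  simp only [mfld_simps]
  have h : ContDiffOn ℝ ∞ (fun u => headPart hM.le (hM.coords p' (hM.param p u)))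
      ((hM.chart p).target ∩ (hM.chart p).symm ⁻¹' (hM.chart p').source) := by
    refine (headPart hM.le).contDiff.comp_contDiffOn ((hM.contDiffOn_coords p').comp
      ((hM.contDiffOn_param p).mono inter_subset_left) fun u hu => ?_)
    rw [← hM.incl_chart_symm p hu.1]
    exact hu.2.1
  refine h.congr fun u hu => ?_
  rw [← hM.incl_chart_symm p hu.1]
  rfl

lemma contMDiff (hM : IsPlaqueManifold ι q) :
    letI := hM.chartedSpace
    ContMDiff (𝓡 q) (𝓡 d) ∞ ι := by
  let _ := hM.chartedSpace
  have := hM.isManifold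
  intro p
  have hp := hM.mem_chart_source p
  have h1 : ContMDiffAt (𝓡 q) (𝓡 q) ∞ (hM.chart p) p :=
    (contMDiffOn_chart (I := 𝓡 q) (x := p)).contMDiffAt ((hM.chart p).open_source.mem_nhds hp)
  have h2 : ContMDiffAt (𝓡 q) (𝓡 d) ∞ (hM.param p) (hM.chart p p) :=
    ((hM.contDiffOn_param p).contDiffAt
      ((hM.chart p).open_target.mem_nhds ((hM.chart p).map_source hp))).contMDiffAt
  refine (h2.comp p h1).congr_of_eventuallyEq ?_
  filter_upwards [(hM.chart p).open_source.mem_nhds hp] with p' hp'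
  rw [Function.comp_apply, ← hM.incl_chart_symm p ((hM.chart p).map_source hp'),
    (hM.chart p).left_inv hp']

/-- The differential structure defined by the plaques. -/
def toImmersedStructure (hM : IsPlaqueManifold ι q) : ImmersedStructure ι where
  dim := q
  charted := hM.chartedSpace
  isManifold := hM.isManifold
  contMDiff := hM.contMDiff
  injective_mfderiv p := by
    let _ := hM.chartedSpace
    have hp := (hM.chart p).map_source (hM.mem_chart_source p)
    rw [mfderiv_eq_fderiv_chart ((hM.contMDiff p).mdifferentiableAt (by simp))]
    have : (ι ∘ (chartAt (Euc q) p).symm) =ᶠ[𝓝 (chartAt (Euc q) p p)] hM.param p := by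
      filter_upwards [(hM.chart p).open_target.mem_nhds hp] with u hu
      exact hM.incl_chart_symm p hu
    rw [this.fderiv_eq]
    exact hM.fderiv_param_injective p hp

/-- Lifting of smoothness from the ambient space. -/
theorem contMDiffAt_of_comp (hM : IsPlaqueManifold ι q) {E H N : Type*} [NormedAddCommGroup E]
    [NormedSpace ℝ E] [TopologicalSpace H] {I : ModelWithCorners ℝ E H} [TopologicalSpace N]
    [ChartedSpace H N] {g : N → M} {x : N} (hg : ContinuousAt g x)
    (h : ContMDiffAt I (𝓡 d) ∞ (ι ∘ g) x) :
    letI := hM.chartedSpace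
    ContMDiffAt I (𝓡 q) ∞ g x := by
  let _ := hM.chartedSpace
  rw [contMDiffAt_iff_target]
  refine ⟨hg, ?_⟩
  -- The chart at `g x` is the restriction of a smooth function of the ambient point, so only `ι ∘
  -- g` has to be smooth.
  have h1 : ContDiffAt ℝ ∞ (fun y => headPart hM.le (hM.coords (g x) y)) (ι (g x)) :=
    (headPart hM.le).contDiff.contDiffAt.comp _ ((hM.contDiffOn_coords (g x)).contDiffAt
      ((hM.coords (g x)).open_source.mem_nhds (hM.mem_coords (g x))))
  exact ContMDiffAt.comp (g := fun y => headPart hM.le (hM.coords (g x) y)) (f := ι ∘ g) x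
    h1.contMDiffAt h

/-- Lifting of smoothness for maps defined on an open set of parameters. -/
theorem smoothOn_of_comp (hM : IsPlaqueManifold ι q) [Nonempty M] {N : ℕ} {A : Set (Fin N → ℝ)}
    (hA : IsOpen A) {g : A → M} (hg : Continuous g)
    (h : ∀ t : A, ∃ (V : Set (Fin N → ℝ)) (G : (Fin N → ℝ) → Euc d), IsOpen V ∧ t.1 ∈ V ∧
      ContDiffOn ℝ ∞ G V ∧ ∀ s : A, s.1 ∈ V → ι (g s) = G s.1) :
    hM.toImmersedStructure.SmoothOn A g := by
  classical
  let _ := hM.chartedSpace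
  let G : (Fin N → ℝ) → M := fun t => if ht : t ∈ A then g ⟨t, ht⟩ else Classical.arbitrary M
  have hG : ∀ t : A, G t = g t := fun t => dif_pos t.2
  refine ⟨G, hG, ?_⟩
  change ContMDiffOn 𝓘(ℝ, Fin N → ℝ) (𝓡 q) ∞ G A
  refine fun t ht => ContMDiffAt.contMDiffWithinAt ?_
  have hGc : ContinuousOn G A := by
    rw [continuousOn_iff_continuous_domRestrict]
    exact hg.congr fun t => (hG t).symm
  refine hM.contMDiffAt_of_comp (hGc.continuousAt (hA.mem_nhds ht)) ?_
  obtain ⟨V, G', hV, htV, hG', he⟩ := h ⟨t, ht⟩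
  refine (hG'.contDiffAt (hV.mem_nhds htV)).contMDiffAt.congr_of_eventuallyEq ?_
  filter_upwards [hV.mem_nhds htV, hA.mem_nhds ht] with s hsV hsA
  rw [Function.comp_apply, hG ⟨s, hsA⟩]
  exact he ⟨s, hsA⟩ hsV

end IsPlaqueManifold

/-! ### Tangent spaces of arbitrary compatible structures. -/

section Tangent

variable {d q : ℕ} {M : Type} [TopologicalSpace M] {ι : M → Euc d}
  {ξ : OpenPartialHomeomorph (Euc d) (Euc d)} {η : ℝ}

lemma ImmersedStructure.finrank_tangent (S : ImmersedStructure ι) (p : M) :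
    Module.finrank ℝ (S.tangent p) = S.dim := by
  let _ := S.charted
  have := LinearMap.finrank_range_of_inj
    (f := (show Euc S.dim →ₗ[ℝ] Euc d from (mfderiv (𝓡 S.dim) (𝓡 d) ι p).toLinearMap))
    (S.injective_mfderiv p)
  rw [ImmersedStructure.tangent, this, finrank_euclideanSpace_fin]

/-- Plaques are open in `M`, so the tail coordinates are locally constant on `M`, whatever structure
compatible with the topology is considered. -/
lemma IsPlaqueChart.tangent_le (h : IsPlaqueChart ι q ξ η) (S : ImmersedStructure ι) {p : M}
    (hp : ι p ∈ ξ.source) : S.tangent p ≤ coordSpan ξ q (ι p) := by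
  let _ := S.charted
  have := S.isManifold
  rintro - ⟨v, rfl⟩
  set e := chartAt (Euc S.dim) p
  have hpe : p ∈ e.source := ChartedSpace.mem_chart_source p
  rw [mem_coordSpan_iff h.contDiffOn h.contDiffOn_symm hp]
  change tailCoordL q (fderiv ℝ ξ (ι p) (mfderiv (𝓡 S.dim) (𝓡 d) ι p v)) = 0
  rw [mfderiv_eq_fderiv_chart ((S.contMDiff p).mdifferentiableAt (by simp))]
  have hmem := e.open_target.mem_nhds (e.map_source hpe)
  have d1 := (((contDiffOn_comp_chart_symm S.contMDiff p).contDiffAt hmem).differentiableAt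
    (by simp)).hasFDerivAt
  have hinv : (ι ∘ e.symm) (e p) = ι p := by rw [Function.comp_apply, e.left_inv hpe]
  have d2 := (differentiableAt_of_smooth h.contDiffOn hp).hasFDerivAt
  rw [← hinv] at d2
  have d3 := (tailCoordL q).hasFDerivAt.comp (e p) (d2.comp (e p) d1)
  have hconst : (tailCoordL q ∘ ξ ∘ ι ∘ e.symm) =ᶠ[𝓝 (e p)]
      fun _ => tailCoord q (ξ (ι p)) := by
    have := (e.continuousAt_symm (e.map_source hpe)).preimage_mem_nhds
      ((h.isOpen_plaque (tailCoord q (ξ (ι p)))).mem_nhds (by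
        rw [e.left_inv hpe]; exact ⟨hp, rfl⟩))
    filter_upwards [this] with u hu
    exact hu.2
  have d4 := d3.unique ((hasFDerivAt_const _ _).congr_of_eventuallyEq hconst)
  rw [hinv] at d4
  exact congrArg (fun A : Euc S.dim →L[ℝ] _ => A v) d4

lemma IsPlaqueChart.tangent_eq (h : IsPlaqueChart ι q ξ η) (hq : q ≤ d) (S : ImmersedStructure ι)
    (hS : S.dim = q) {p : M} (hp : ι p ∈ ξ.source) : S.tangent p = coordSpan ξ q (ι p) := by
  refine Submodule.eq_of_le_of_finrank_eq (h.tangent_le S hp) ?_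
  rw [S.finrank_tangent, finrank_coordSpan h.contDiffOn h.contDiffOn_symm hq hp, hS]

end Tangent

/-! ### Uniqueness of the differential structure. -/

section Uniqueness

variable {d q : ℕ} {M : Type} [TopologicalSpace M] {ι : M → Euc d}

/-- The change of charts between an arbitrary structure and the structure of plaques. -/
lemma IsPlaqueManifold.contDiffOn_transition (hM : IsPlaqueManifold ι q)
    (S : ImmersedStructure ι) (p : M) :
    letI := S.charted
    ContDiffOn ℝ ∞ ((chartAt (Euc S.dim) p).symm ≫ₕ hM.chart p)
      ((chartAt (Euc S.dim) p).symm ≫ₕ hM.chart p).source := by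
  let _ := S.charted
  have := S.isManifold
  refine (headPart hM.le).contDiff.comp_contDiffOn ((hM.contDiffOn_coords p).comp
    ((contDiffOn_comp_chart_symm S.contMDiff p).mono fun u hu => hu.1) fun u hu => hu.2.1)

/-- The tangent spaces give `S.dim ≤ q`. For the converse, a change of charts is a smooth
homeomorphism from an open set of `ℝ^{S.dim}` onto one of `ℝ^q`, and smooth maps do not raise
Hausdorff dimension. -/
lemma IsPlaqueManifold.dim_eq (hM : IsPlaqueManifold ι q) [Nonempty M] (S : ImmersedStructure ι) :
    S.dim = q := by
  let _ := S.charted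
  obtain ⟨p⟩ := (inferInstance : Nonempty M)
  obtain ⟨ξ, η, hξ, hp⟩ := hM.exists_chart p
  refine le_antisymm ?_ ?_
  · have := Submodule.finrank_mono (hξ.tangent_le S hp)
    rwa [S.finrank_tangent, finrank_coordSpan hξ.contDiffOn hξ.contDiffOn_symm hM.le hp] at this
  · set e := chartAt (Euc S.dim) p
    set φ := e.symm ≫ₕ hM.chart p
    have hpe : p ∈ e.source := ChartedSpace.mem_chart_source p
    have hpφ : e p ∈ φ.source := by
      refine ⟨e.map_source hpe, ?_⟩
      change e.symm (e p) ∈ (hM.chart p).source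
      rw [e.left_inv hpe]
      exact hM.mem_chart_source p
    obtain ⟨r, hr, hball⟩ := Metric.isOpen_iff.1 φ.open_source _ hpφ
    have h1 : dimH (φ '' Metric.ball (e p) r) ≤ dimH (Metric.ball (e p) r) :=
      (((hM.contDiffOn_transition S p).mono hball).of_le (by simp)).dimH_image_le
        (convex_ball _ _) subset_rfl
    have h2 : φ '' Metric.ball (e p) r ∈ 𝓝 (φ (e p)) :=
      φ.image_mem_nhds hpφ (Metric.ball_mem_nhds _ hr)
    rw [Real.dimH_of_mem_nhds h2, Real.dimH_of_mem_nhds (Metric.ball_mem_nhds _ hr),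
      finrank_euclideanSpace_fin, finrank_euclideanSpace_fin] at h1
    exact_mod_cast h1

/-- In one direction the identity is smooth because `ι` is. In the other, the change of charts is an
immersion between spaces of equal dimension, so its inverse is smooth by the inverse function
theorem. -/
theorem IsPlaqueManifold.same (hM : IsPlaqueManifold ι q) [Nonempty M] (S : ImmersedStructure ι) :
    S.Same hM.toImmersedStructure := by
  have hdim := hM.dim_eq S
  refine ⟨hdim, ?_, ?_⟩
  · let _ := S.charted
    intro p
    exact hM.contMDiffAt_of_comp continuousAt_id (S.contMDiff p)
  · let _ := S.charted
    let _ := hM.chartedSpace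
    have := S.isManifold
    have := hM.isManifold
    intro p
    change ContMDiffAt (𝓡 q) (𝓡 S.dim) ∞ id p
    set e := chartAt (Euc S.dim) p with he
    set φ := e.symm ≫ₕ hM.chart p with hφdef
    have hpe : p ∈ e.source := ChartedSpace.mem_chart_source p
    have hpφ : e p ∈ φ.source := by
      refine ⟨e.map_source hpe, ?_⟩
      change e.symm (e p) ∈ (hM.chart p).source
      rw [e.left_inv hpe]
      exact hM.mem_chart_source p
    have hφp : φ (e p) = hM.chart p p := by
      change hM.chart p (e.symm (e p)) = _
      rw [e.left_inv hpe]
    have hφs : φ.symm (hM.chart p p) = e p := by rw [← hφp, φ.left_inv hpφ]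
    have hφc := (hM.contDiffOn_transition S p).contDiffAt (φ.open_source.mem_nhds hpφ)
    have hφd := (hφc.differentiableAt (by simp)).hasFDerivAt
    -- Near `e p` the immersion `ι ∘ e.symm` factors through `φ`, which must then have an injective
    -- derivative.
    have hinj : Function.Injective (fderiv ℝ φ (e p)) := by
      rw [injective_iff_map_eq_zero]
      intro v hv
      have hpar := (((hM.contDiffOn_param p).contDiffAt ((hM.chart p).open_target.mem_nhds
        ((hM.chart p).map_source (hM.mem_chart_source p)))).differentiableAt (by simp)).hasFDerivAt
      rw [← hφp] at hpar
      have hcomp := hpar.comp (e p) hφd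
      have heq : (ι ∘ e.symm) =ᶠ[𝓝 (e p)] (hM.param p ∘ φ) := by
        filter_upwards [φ.open_source.mem_nhds hpφ] with u hu
        have hu' : e.symm u ∈ (hM.chart p).source := hu.2
        change ι (e.symm u) = hM.param p (hM.chart p (e.symm u))
        rw [← hM.incl_chart_symm p ((hM.chart p).map_source hu'), (hM.chart p).left_inv hu']
      have h1 := S.injective_mfderiv p
      rw [mfderiv_eq_fderiv_chart ((S.contMDiff p).mdifferentiableAt (by simp))] at h1
      have h2 : fderiv ℝ (ι ∘ e.symm) (e p) v = 0 := by
        rw [heq.fderiv_eq, hcomp.fderiv]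
        change fderiv ℝ (hM.param p) (φ (e p)) (fderiv ℝ φ (e p) v) = 0
        rw [hv, map_zero]
      exact h1 (h2.trans (map_zero (fderiv ℝ (ι ∘ e.symm) (e p))).symm)
    let ψ : Euc S.dim ≃L[ℝ] Euc q := (LinearEquiv.ofInjectiveOfFinrankEq
      (fderiv ℝ φ (e p)).toLinearMap hinj (by simp [hdim])).toContinuousLinearEquiv
    have hψ : HasFDerivAt φ (ψ : Euc S.dim →L[ℝ] Euc q) (φ.symm (hM.chart p p)) := by
      rw [hφs]
      exact hφd.congr_fderiv (by ext1 v; rfl)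
    have hsymm : ContDiffAt ℝ ∞ φ.symm (hM.chart p p) :=
      φ.contDiffAt_symm (hφp ▸ φ.map_source hpφ) hψ (by rw [hφs]; exact hφc)
    rw [contMDiffAt_iff]
    refine ⟨continuousAt_id, ?_⟩
    simp only [mfld_simps]
    exact hsymm.contDiffWithinAt

end Uniqueness


/-! ### Smooth approximation of feedbacks -/

section Approximation

variable {d r : ℕ} {f : Euc d × Euc r → Euc d} {Ω : Set (Euc d × Euc r)}

lemma isOpen_stateProj (hΩ : IsOpen Ω) : IsOpen (stateProj Ω) := isOpenMap_fst _ hΩ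

/-- A continuous map on an open set can be approximated by smooth ones within any neighbourhood
of its graph. -/
theorem exists_contDiffOn_mem_of_graph {U : Set (Euc d)} (hU : IsOpen U)
    {V : Set (Euc d × Euc r)} (hV : IsOpen V) {α : Euc d → Euc r} (hα : ContinuousOn α U)
    (hαV : ∀ x ∈ U, (x, α x) ∈ V) :
    ∃ β : Euc d → Euc r, ContDiffOn ℝ ∞ β U ∧ ∀ x ∈ U, (x, β x) ∈ V := by
  classical
  let O : TopologicalSpace.Opens (Euc d) := ⟨U, hU⟩
  have : LocallyCompactSpace O := hU.locallyCompactSpace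
  -- `t y` is a union of concentric balls around `α y`, hence convex; being in `t y` puts `(y, u)`
  -- in `V`. The constant `α x` is an admissible choice near `x`, and a partition of unity blends
  -- these choices.
  let t : O → Set (Euc r) := fun y =>
    {u | ∃ ρ > 0, Metric.ball (y.1, α y.1) ρ ⊆ V ∧ u ∈ Metric.ball (α y.1) ρ}
  have ht : ∀ y, Convex ℝ (t y) := by
    rintro y u ⟨ρ, hρ, hsub, hu⟩ v ⟨ρ', hρ', hsub', hv⟩ a b ha hb hab
    rcases le_total ρ ρ' with h | h
    · exact ⟨ρ', hρ', hsub', convex_ball _ _ (Metric.ball_subset_ball h hu) hv ha hb hab⟩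
    · exact ⟨ρ, hρ, hsub, convex_ball _ _ hu (Metric.ball_subset_ball h hv) ha hb hab⟩
  have hloc : ∀ x : O, ∃ c : Euc r, ∀ᶠ y in 𝓝 x, c ∈ t y := by
    intro x
    obtain ⟨ρ, hρ, hsub⟩ := Metric.isOpen_iff.1 hV _ (hαV x.1 x.2)
    refine ⟨α x.1, ?_⟩
    have hc : Continuous fun y : O => (y.1, α y.1) :=
      continuous_subtype_val.prodMk (continuousOn_iff_continuous_domRestrict.1 hα)
    filter_upwards [hc.continuousAt.preimage_mem_nhds
      (Metric.ball_mem_nhds (x.1, α x.1) (half_pos hρ))] with y hy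
    rw [mem_preimage, Metric.mem_ball] at hy
    -- For `y` within `ρ / 2` of `x` on the graph, the ball of radius `ρ / 2` around the graph point
    -- of `y` is still in `V`, and it contains `α x` in its second component.
    refine ⟨ρ / 2, half_pos hρ, (Metric.ball_subset_ball' ?_).trans hsub, ?_⟩
    · linarith
    · rw [Metric.mem_ball, dist_comm]
      exact (le_max_right _ _).trans_lt hy
  obtain ⟨g, hg⟩ := exists_contMDiffMap_forall_mem_convex_of_local_const
    (n := (⊤ : ℕ∞)) (𝓡 d) ht hloc
  let β : Euc d → Euc r := fun x => if hx : x ∈ U then g ⟨x, hx⟩ else 0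
  have hβ : ∀ x : O, β x.1 = g x := fun x => dif_pos x.2
  refine ⟨β, fun x hx => ContDiffAt.contDiffWithinAt ?_, fun x hx => ?_⟩
  · rw [← contMDiffAt_iff_contDiffAt]
    have h1 : ContMDiffAt (𝓡 d) (𝓡 r) ∞ (fun x : O => β x.1) ⟨x, hx⟩ := by
      simp only [hβ]
      exact g.contMDiff.contMDiffAt
    exact contMDiffAt_subtype_iff.1 h1
  · obtain ⟨ρ, hρ, hsub, hu⟩ := hg ⟨x, hx⟩
    refine hsub ?_
    rw [Metric.mem_ball, Prod.dist_eq]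
    change max (dist x x) (dist (β x) (α x)) < ρ
    rw [dist_self, hβ ⟨x, hx⟩]
    exact max_lt hρ hu

/-- The points of `Ω` where `f` differs from its value on the graph of `α` by less than `ε` form an
open neighbourhood of this graph; any smooth map with its graph in it will do. -/
lemma exists_isSmoothFeedback_near (hf : Continuous f) (hΩ : IsOpen Ω) {α : Euc d → Euc r}
    (hα : IsFeedback Ω α) {ε : ℝ} (hε : 0 < ε) :
    ∃ β, IsSmoothFeedback Ω β ∧ ∀ x ∈ stateProj Ω, ‖f (x, β x) - f (x, α x)‖ < ε := by
  have hcont : ContinuousOn (fun p : Euc d × Euc r => ‖f p - f (p.1, α p.1)‖) Ω := by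
    refine (hf.continuousOn.sub (hf.comp_continuousOn (continuousOn_fst.prodMk
      (hα.1.comp continuousOn_fst fun p hp => ⟨p, hp, rfl⟩)))).norm
  obtain ⟨β, hβ, hβV⟩ := exists_contDiffOn_mem_of_graph (isOpen_stateProj hΩ)
    (hcont.isOpen_inter_preimage hΩ (isOpen_Iio (a := ε))) hα.1
    fun x hx => ⟨hα.2 x hx, by simpa using hε⟩
  exact ⟨β, ⟨⟨hβ.continuousOn, fun x hx => (hβV x hx).1⟩, hβ⟩, fun x hx => (hβV x hx).2⟩

lemma isUniformLimit_of_mem_family' (hf : Continuous f) (hΩ : IsOpen Ω) {X : Euc d → Euc d}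
    (hX : X ∈ family' f Ω) : IsUniformLimit (stateProj Ω) (smoothFamily f Ω) X := by
  obtain ⟨α₁, α₂, h₁, h₂, rfl⟩ := hX
  intro ε hε
  obtain ⟨β₁, hβ₁, hn₁⟩ := exists_isSmoothFeedback_near hf hΩ h₁ (half_pos hε)
  obtain ⟨β₂, hβ₂, hn₂⟩ := exists_isSmoothFeedback_near hf hΩ h₂ (half_pos hε)
  refine ⟨_, ⟨β₁, β₂, hβ₁, hβ₂, rfl⟩, fun x hx => ?_⟩
  have : deltaField f β₁ β₂ x - deltaField f α₁ α₂ x =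
      (f (x, β₁ x) - f (x, α₁ x)) - (f (x, β₂ x) - f (x, α₂ x)) := by
    simp only [deltaField]
    abel
  rw [this]
  exact (norm_sub_le _ _).trans_lt (by linarith [hn₁ x hx, hn₂ x hx])

lemma continuousOn_of_mem_family' (hf : Continuous f) {X : Euc d → Euc d}
    (hX : X ∈ family' f Ω) : ContinuousOn X (stateProj Ω) := by
  obtain ⟨α₁, α₂, h₁, h₂, rfl⟩ := hX
  exact (hf.comp_continuousOn (continuousOn_id.prodMk h₁.1)).sub
    (hf.comp_continuousOn (continuousOn_id.prodMk h₂.1))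

lemma contDiffOn_of_mem_smoothFamily (hf : ContDiff ℝ ∞ f) {X : Euc d → Euc d}
    (hX : X ∈ smoothFamily f Ω) : ContDiffOn ℝ ∞ X (stateProj Ω) := by
  obtain ⟨α₁, α₂, h₁, h₂, rfl⟩ := hX
  exact (hf.comp_contDiffOn (contDiffOn_id.prodMk h₁.2)).sub
    (hf.comp_contDiffOn (contDiffOn_id.prodMk h₂.2))

lemma smoothFamily_subset_family'' (hf : ContDiff ℝ ∞ f) (hΩ : IsOpen Ω) :
    smoothFamily f Ω ⊆ family'' f Ω := by
  intro X hX
  refine ⟨?_, hasFlow_of_contDiffOn (isOpen_stateProj hΩ)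
    ((contDiffOn_of_mem_smoothFamily hf hX).of_le (by simp))⟩
  obtain ⟨α₁, α₂, h₁, h₂, rfl⟩ := hX
  exact ⟨α₁, α₂, h₁.1, h₂.1, rfl⟩

lemma smoothFamily_nonempty (hf : Continuous f) (hΩ : IsOpen Ω) (h : ∃ α, IsFeedback Ω α) :
    (smoothFamily f Ω).Nonempty := by
  obtain ⟨α, hα⟩ := h
  obtain ⟨β, hβ, -⟩ := exists_isSmoothFeedback_near hf hΩ hα one_pos
  exact ⟨_, β, β, hβ, hβ, rfl⟩

end Approximation

/-! ### The orbits of smooth fields contain the integral curves of their uniform limits -/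

section Limits

variable {d : ℕ} {U : Set (Euc d)} {𝓕 : Set (Euc d → Euc d)}

/-- Flow coordinates are built at each point `p` of the orbit; constancy of the rank makes them
plaque charts of the orbit of `m`, of the same dimension `q`. -/
theorem isPlaqueManifold_orbitSpace (hU : IsOpen U) (hF : ∀ X ∈ 𝓕, ContDiffOn ℝ ∞ X U)
    (hne : 𝓕.Nonempty) {m : Euc d} (hm : m ∈ U) :
    IsPlaqueManifold (OrbitSpace.incl (U := U) (𝓕 := 𝓕) (m := m))
      (Module.finrank ℝ (pushforwardSpan U 𝓕 m)) := by
  refine ⟨OrbitSpace.incl_injective, (Submodule.finrank_le _).trans (by simp), fun p => ?_⟩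
  have hp : p.incl ∈ orbit U 𝓕 m := p.2
  obtain ⟨ξ, η, hξ, hpξ, -⟩ := exists_isFlowChart hU hF (orbit_subset hp)
  rw [finrank_eq_of_mem_orbit hU hF hp] at hξ
  exact ⟨ξ, η, hξ.isPlaqueChart hU hF hm hne, hpξ⟩

lemma mem_of_isUniformLimit {X : Euc d → Euc d} (hlim : IsUniformLimit U 𝓕 X)
    {D : Submodule ℝ (Euc d)} {x : Euc d} (hx : x ∈ U) (hD : ∀ Y ∈ 𝓕, Y x ∈ D) : X x ∈ D := by
  have hcl : IsClosed (D : Set (Euc d)) := D.closed_of_finiteDimensional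
  refine hcl.closure_subset (Metric.mem_closure_iff.2 fun ε hε => ?_)
  obtain ⟨Y, hY, h⟩ := hlim ε hε
  refine ⟨Y x, hD Y hY, ?_⟩
  rw [dist_comm, dist_eq_norm]
  exact h x hx

lemma isFlowAdapted_zero_of_isUniformLimit (hU : IsOpen U) (hF : ∀ X ∈ 𝓕, ContDiffOn ℝ ∞ X U)
    {X : Euc d → Euc d} (hX : ContinuousOn X U) (hlim : IsUniformLimit U 𝓕 X)
    (hflow : HasFlow U X) (D : Euc d → Submodule ℝ (Euc d)) : IsFlowAdapted 0 U D X :=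
  ⟨hflow, fun _ hx => hlim.flowBox_zero hU (fun Y hY => (hF Y hY).of_le (by simp)) hX hflow hx,
    fun h => absurd rfl h, fun h => absurd rfl h⟩

/-- The integral curves from `x` of the members of `𝓕` are connected and lie in the orbit of `x`,
hence stay in its plaque as long as they stay in the chart. The slice is closed in a small ball, so
the limit curve stays in it, and slices through orbit points lie in the orbit. Uniqueness for `X`
plays no role yet. -/
lemma exists_curve_mem_orbit (hU : IsOpen U) (hF : ∀ X ∈ 𝓕, ContDiffOn ℝ ∞ X U)
    (hne : 𝓕.Nonempty) {X : Euc d → Euc d} (hX : ContinuousOn X U)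
    (hlim : IsUniformLimit U 𝓕 X) {x : Euc d} (hx : x ∈ U) :
    ∃ a > 0, ∃ γ : ℝ → Euc d, γ 0 = x ∧ IsIntegralCurve U X (Ioo (-a) a) γ ∧
      ∀ t ∈ Ioo (-a) a, γ t ∈ orbit U 𝓕 x := by
  have hflow : ∀ X ∈ 𝓕, HasFlow U X :=
    fun X hX => hasFlow_of_contDiffOn hU ((hF X hX).of_le (by simp))
  have hM := isPlaqueManifold_orbitSpace hU hF hne hx
  have := orbitSpace_connectedSpace hflow hne hx
  have := hM.secondCountableTopology
  obtain ⟨ξ, η, hξ, hxξ, -⟩ := exists_isFlowChart hU hF hx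
  have hplaque := hξ.isPlaqueChart hU hF hx hne
  set q := Module.finrank ℝ (pushforwardSpan U 𝓕 x)
  obtain ⟨r, hr, hball⟩ := Metric.nhds_basis_closedBall.mem_iff.1 (ξ.open_source.mem_nhds hxξ)
  have hballU := hball.trans hξ.source_subset
  obtain ⟨a, ha, hex⟩ := hlim.exists_curve (fun Y hY => (hF Y hY).of_le (by simp)) hX hr hballU
  have hZ : IsClosed (Metric.closedBall x r ∩
      (fun y => tailCoord q (ξ y)) ⁻¹' {tailCoord q (ξ x)}) :=
    ((tailCoordL q).continuous.comp_continuousOn (ξ.continuousOn.mono hball)).preimage_isClosed_of_isClosed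
      Metric.isClosed_closedBall isClosed_singleton
  obtain ⟨γ, h0, hγ, hγZ⟩ := hex x (Metric.mem_closedBall_self (by positivity)) _ hZ (by
    intro Y hY γ h0 hγ t ht
    have hγU : IsIntegralCurve U Y (Ioo (-a) a) γ := fun s hs => ⟨hballU (hγ s hs).1, (hγ s hs).2⟩
    have h0a : (0 : ℝ) ∈ Ioo (-a) a := ⟨by linarith, ha⟩
    have horb : ∀ s ∈ Ioo (-a) a, γ s ∈ range (OrbitSpace.incl (U := U) (𝓕 := 𝓕) (m := x)) := by
      intro s hs
      rw [OrbitSpace.range_incl]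
      have h1 := hγU.flowsTo h0a hs
      rw [h0] at h1
      exact Reaches.mem_orbit (l := [(Y, s - 0)]) hne hx (by simpa using hY)
        (reaches_singleton.2 h1)
    refine ⟨(hγ t ht).1, ?_⟩
    rw [mem_preimage, mem_singleton_iff, ← h0]
    exact hplaque.tailCoord_eq_of_isPreconnected isPreconnected_Ioo hγ.continuousOn
      (fun s hs => hball (hγ s hs).1) horb ht h0a)
  refine ⟨a, ha, γ, h0, fun s hs => ⟨hballU (hγ s hs).1, (hγ s hs).2⟩, fun t ht => ?_⟩
  rw [← OrbitSpace.range_incl]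
  refine hplaque.saturated x hxξ _ (hball (hγZ t ht).1) (hγZ t ht).2.symm ?_
  rw [OrbitSpace.range_incl]
  exact mem_orbit_self hne hx

/-- By uniqueness the given curve coincides, near each time, with the limit curve that stays in the
orbit. Lying in the same orbit is an equivalence relation, so connectedness of the interval
concludes. -/
theorem FlowsTo.mem_orbit_of_isUniformLimit (hU : IsOpen U)
    (hF : ∀ X ∈ 𝓕, ContDiffOn ℝ ∞ X U) (hne : 𝓕.Nonempty) {X : Euc d → Euc d}
    (hX : ContinuousOn X U) (hlim : IsUniformLimit U 𝓕 X) (hXflow : HasFlow U X) {t : ℝ}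
    {x y : Euc d} (h : FlowsTo U X t x y) : y ∈ orbit U 𝓕 x := by
  have hflow : ∀ X ∈ 𝓕, HasFlow U X :=
    fun X hX => hasFlow_of_contDiffOn hU ((hF X hX).of_le (by simp))
  obtain ⟨a, b, h0, ht, γ, hγ, rfl, rfl⟩ := h.exists_Ioo hXflow
  refine isPreconnected_Ioo.induction₂ (s := Ioo a b) (fun s s' => γ s' ∈ orbit U 𝓕 (γ s))
    (fun s hs => ?_) (fun _ _ _ _ _ _ h h' => orbit_trans h h')
    (fun _ _ _ _ h => orbit_symm hflow h) h0 ht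
  obtain ⟨c, hc, γ', hγ'0, hγ', horb⟩ := exists_curve_mem_orbit hU hF hne hX hlim (hγ s hs).1
  have h1 : IsIntegralCurve U X (Ioo (max a (s - c)) (min b (s + c))) γ :=
    hγ.mono (Ioo_subset_Ioo (le_max_left _ _) (min_le_left _ _))
  have h2 : IsIntegralCurve U X (Ioo (max a (s - c)) (min b (s + c))) fun t => γ' (t + -s) := by
    refine hγ'.comp_add (-s) fun r hr => ?_
    have h1 := (le_max_right a (s - c)).trans_lt hr.1
    have h2 := hr.2.trans_le (min_le_right b (s + c))
    exact ⟨by linarith, by linarith⟩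
  have hs' : s ∈ Ioo (max a (s - c)) (min b (s + c)) :=
    ⟨max_lt hs.1 (by linarith), lt_min hs.2 (by linarith)⟩
  have heq := hXflow.eqOn_Ioo h1 h2 hs' (by simp [hγ'0])
  filter_upwards [mem_nhdsWithin_of_mem_nhds (isOpen_Ioo.mem_nhds hs')] with r hr
  rw [heq hr]
  have h3 := (le_max_right a (s - c)).trans_lt hr.1
  have h4 := hr.2.trans_le (min_le_right b (s + c))
  exact horb _ ⟨by linarith, by linarith⟩

end Limits


/-! ### Comparison of the two families -/

section Comparison

variable {d : ℕ} {U : Set (Euc d)} {𝓕 𝓖 : Set (Euc d → Euc d)}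

/-- `𝓖` is a family of fields having a flow, which contains the smooth family `𝓕` and consists of
uniform limits of members of `𝓕`. -/
structure IsLimitFamily (U : Set (Euc d)) (𝓕 𝓖 : Set (Euc d → Euc d)) : Prop where
  isOpen : IsOpen U
  contDiffOn : ∀ X ∈ 𝓕, ContDiffOn ℝ ∞ X U
  nonempty : 𝓕.Nonempty
  subset : 𝓕 ⊆ 𝓖
  continuousOn : ∀ X ∈ 𝓖, ContinuousOn X U
  isUniformLimit : ∀ X ∈ 𝓖, IsUniformLimit U 𝓕 X
  hasFlow : ∀ X ∈ 𝓖, HasFlow U X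

namespace IsLimitFamily

lemma isFlowAdapted (h : IsLimitFamily U 𝓕 𝓖) {X : Euc d → Euc d} (hX : X ∈ 𝓖) :
    IsFlowAdapted 0 U (fun _ => ⊥) X :=
  isFlowAdapted_zero_of_isUniformLimit h.isOpen h.contDiffOn (h.continuousOn X hX)
    (h.isUniformLimit X hX) (h.hasFlow X hX) _

lemma reaches_mem_orbit (h : IsLimitFamily U 𝓕 𝓖) {l : List ((Euc d → Euc d) × ℝ)}
    (hl : ∀ e ∈ l, e.1 ∈ 𝓖) {x y : Euc d} (hx : x ∈ U) (hxy : Reaches U l x y) :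
    y ∈ orbit U 𝓕 x := by
  induction l generalizing y with
  | nil =>
    obtain rfl : x = y := hxy
    exact mem_orbit_self h.nonempty hx
  | cons e l ih =>
    obtain ⟨z, hz, hzy⟩ := hxy
    have he := hl e List.mem_cons_self
    exact orbit_trans (ih (fun e he => hl e (List.mem_cons_of_mem _ he)) hz)
      (hzy.mem_orbit_of_isUniformLimit h.isOpen h.contDiffOn h.nonempty (h.continuousOn _ he)
        (h.isUniformLimit _ he) (h.hasFlow _ he))

lemma orbit_eq (h : IsLimitFamily U 𝓕 𝓖) {m : Euc d} (hm : m ∈ U) :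
    orbit U 𝓖 m = orbit U 𝓕 m := by
  refine Subset.antisymm (fun y hy => ?_) (orbit_mono h.subset)
  obtain ⟨l, -, hl, hy⟩ := mem_orbit_iff.1 hy
  exact h.reaches_mem_orbit hl hm hy

lemma hasFlow_smooth (h : IsLimitFamily U 𝓕 𝓖) : ∀ X ∈ 𝓕, HasFlow U X :=
  fun X hX => h.hasFlow X (h.subset hX)

lemma orbitSpace_smooth (h : IsLimitFamily U 𝓕 𝓖) {m : Euc d} (hm : m ∈ U) :
    IsPlaqueManifold (OrbitSpace.incl (U := U) (𝓕 := 𝓕) (m := m))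
      (Module.finrank ℝ (pushforwardSpan U 𝓕 m)) :=
  isPlaqueManifold_orbitSpace h.isOpen h.contDiffOn h.nonempty hm

lemma secondCountable_smooth (h : IsLimitFamily U 𝓕 𝓖) {m : Euc d} (hm : m ∈ U) :
    SecondCountableTopology (OrbitSpace U 𝓕 m) := by
  have := orbitSpace_connectedSpace h.hasFlow_smooth h.nonempty hm
  exact (h.orbitSpace_smooth hm).secondCountableTopology

/-- The two orbits, with their topologies, coincide. -/
def homeomorph (h : IsLimitFamily U 𝓕 𝓖) {m : Euc d} (hm : m ∈ U) :
    OrbitSpace U 𝓖 m ≃ₜ OrbitSpace U 𝓕 m where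
  toFun p := ⟨p.incl, h.orbit_eq hm ▸ p.2⟩
  invFun p := ⟨p.incl, (h.orbit_eq hm).symm ▸ p.2⟩
  left_inv _ := rfl
  right_inv _ := rfl
  continuous_toFun := by
    have := h.secondCountable_smooth hm
    refine OrbitSpace.continuous_dom fun N hN X hX => ?_
    have hXa := fun j => h.isFlowAdapted (hX j)
    -- The flows of `𝓖` are continuous into `ℝᵈ`; since the domain is open, hence locally connected,
    -- their compositions lift to the orbit of `𝓕`.
    have := (isOpen_concatDom hXa m).locallyConnectedSpace
    exact (h.orbitSpace_smooth hm).continuous_of_comp (continuous_incl_concatMap hN hX hXa)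
  continuous_invFun := by
    refine OrbitSpace.continuous_dom fun N hN X hX => ?_
    -- The maps (1) for `𝓕` are among those for `𝓖`.
    have := continuous_concatMap (U := U) (m := m) hN X fun j => h.subset (hX j)
    refine this.congr fun t => rfl

lemma incl_homeomorph (h : IsLimitFamily U 𝓕 𝓖) {m : Euc d} (hm : m ∈ U) (p : OrbitSpace U 𝓖 m) :
    (h.homeomorph hm p).incl = p.incl := rfl

end IsLimitFamily

lemma IsPlaqueChart.comp_homeomorph {M M' : Type} [TopologicalSpace M] [TopologicalSpace M']
    {ι : M → Euc d} {ι' : M' → Euc d} {q : ℕ} {ξ : OpenPartialHomeomorph (Euc d) (Euc d)} {η : ℝ}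
    (h : IsPlaqueChart ι q ξ η) (Φ : M' ≃ₜ M) (hΦ : ∀ p, ι (Φ p) = ι' p) :
    IsPlaqueChart ι' q ξ η := by
  obtain rfl : ι' = ι ∘ Φ := funext fun p => (hΦ p).symm
  refine ⟨h.pos, h.target_eq, h.contDiffOn, h.contDiffOn_symm, ?_, fun p hp => ?_⟩
  · rw [Φ.surjective.range_comp]
    exact h.saturated
  · rw [Φ.isInducing.nhds_eq_comap, h.nhds_eq _ hp, Filter.comap_inf, Filter.comap_comap,
      Filter.comap_principal]
    rfl

namespace IsLimitFamily

lemma isPlaqueChart (h : IsLimitFamily U 𝓕 𝓖) {m : Euc d} (hm : m ∈ U)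
    {ξ : OpenPartialHomeomorph (Euc d) (Euc d)} {η : ℝ}
    (hξ : IsFlowChart U 𝓕 (Module.finrank ℝ (pushforwardSpan U 𝓕 m)) ξ η) :
    IsPlaqueChart (OrbitSpace.incl (U := U) (𝓕 := 𝓖) (m := m))
      (Module.finrank ℝ (pushforwardSpan U 𝓕 m)) ξ η :=
  (hξ.isPlaqueChart h.isOpen h.contDiffOn hm h.nonempty).comp_homeomorph (h.homeomorph hm)
    (h.incl_homeomorph hm)

lemma isPlaqueManifold (h : IsLimitFamily U 𝓕 𝓖) {m : Euc d} (hm : m ∈ U) :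
    IsPlaqueManifold (OrbitSpace.incl (U := U) (𝓕 := 𝓖) (m := m))
      (Module.finrank ℝ (pushforwardSpan U 𝓕 m)) := by
  have hM := h.orbitSpace_smooth hm
  refine ⟨OrbitSpace.incl_injective, hM.le, fun p => ?_⟩
  obtain ⟨ξ, η, hξ, hp⟩ := hM.exists_chart (h.homeomorph hm p)
  exact ⟨ξ, η, hξ.comp_homeomorph (h.homeomorph hm) (h.incl_homeomorph hm), hp⟩

lemma connectedSpace (h : IsLimitFamily U 𝓕 𝓖) {m : Euc d} (hm : m ∈ U) :
    ConnectedSpace (OrbitSpace U 𝓖 m) :=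
  orbitSpace_connectedSpace h.hasFlow (h.nonempty.mono h.subset) hm

lemma secondCountableTopology (h : IsLimitFamily U 𝓕 𝓖) {m : Euc d} (hm : m ∈ U) :
    SecondCountableTopology (OrbitSpace U 𝓖 m) := by
  have := h.connectedSpace hm
  exact (h.isPlaqueManifold hm).secondCountableTopology

/-- In flow coordinates at the point, both spaces are the span of the first `q` coordinate fields.
-/
lemma tangent_eq (h : IsLimitFamily U 𝓕 𝓖) {m : Euc d} (hm : m ∈ U) (p : OrbitSpace U 𝓖 m) :
    (h.isPlaqueManifold hm).toImmersedStructure.tangent p = pushforwardSpan U 𝓕 p.incl := by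
  have hp : p.incl ∈ orbit U 𝓕 m := h.orbit_eq hm ▸ p.2
  have hrank := finrank_eq_of_mem_orbit h.isOpen h.contDiffOn hp
  obtain ⟨ξ, η, hξ, hpξ, -⟩ := exists_isFlowChart h.isOpen h.contDiffOn (orbit_subset hp)
  rw [hrank] at hξ
  rw [(h.isPlaqueChart hm hξ).tangent_eq (h.isPlaqueManifold hm).le _ rfl hpξ,
    hξ.pushforwardSpan_eq hrank hpξ]

/-- A diffeomorphism made of flows of members of `𝓖` preserves the distribution. -/
lemma fderiv_mem (h : IsLimitFamily U 𝓕 𝓖) {N : ℕ} {X : Fin N → Euc d → Euc d}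
    (hX : ∀ j, X j ∈ 𝓖) {t : Fin N → ℝ} {φ : OpenPartialHomeomorph (Euc d) (Euc d)}
    (hφ : ∀ x ∈ φ.source, ConcatTo U X t x (φ x)) (hU : φ.source ⊆ U)
    (hd : ContDiffOn ℝ 1 φ φ.source) {z : Euc d} (hz : z ∈ φ.source) {w : Euc d}
    (hw : w ∈ pushforwardSpan U 𝓕 z) : fderiv ℝ φ z w ∈ pushforwardSpan U 𝓕 (φ z) := by
  have hzU := hU hz
  have horb : ∀ x ∈ φ.source, φ x ∈ orbit U 𝓕 x := fun x hx => by
    refine h.reaches_mem_orbit (l := List.ofFn fun j => (X j, t j)) ?_ (hU hx)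
      (concatTo_iff_reaches.1 (hφ x hx))
    intro e he
    obtain ⟨j, rfl⟩ := List.mem_ofFn.1 he
    exact hX j
  have hM := h.orbitSpace_smooth hzU
  have := h.secondCountable_smooth hzU
  have hrank := finrank_eq_of_mem_orbit h.isOpen h.contDiffOn (horb z hz)
  obtain ⟨ξ, η, hξ, hzξ, -⟩ := exists_isFlowChart h.isOpen h.contDiffOn hzU
  obtain ⟨ξ', η', hξ', hzξ', -⟩ := exists_isFlowChart h.isOpen h.contDiffOn
    (orbit_subset (horb z hz))
  rw [hrank] at hξ'
  rw [← hξ.pushforwardSpan_eq rfl hzξ, mem_coordSpan_iff hξ.contDiffOn hξ.contDiffOn_symm hzξ] at hw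
  rw [← hξ'.pushforwardSpan_eq hrank hzξ',
    mem_coordSpan_iff hξ'.contDiffOn hξ'.contDiffOn_symm hzξ']
  have hP := hξ.isPlaqueChart h.isOpen h.contDiffOn hzU h.nonempty
  have hP' := hξ'.isPlaqueChart h.isOpen h.contDiffOn hzU h.nonempty
  set q := Module.finrank ℝ (pushforwardSpan U 𝓕 z)
  -- The straight line in the coordinates with velocity `w` stays in the slice of `z`, hence in its
  -- orbit. Its image by `φ` is a continuous curve in the same orbit, so it stays in one plaque near
  -- `φ z`; its velocity there, `dφ(w)`, is tangent to the slice.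
  let c : ℝ → Euc d := fun s => ξ z + s • fderiv ℝ ξ z w
  have hc : HasDerivAt c (fderiv ℝ ξ z w) 0 := by
    have := ((hasDerivAt_id (0 : ℝ)).smul_const (fderiv ℝ ξ z w)).const_add (ξ z)
    rwa [one_smul] at this
  have hc0 : c 0 = ξ z := by simp [c]
  have hcc : Continuous c := by fun_prop
  have hg0 : ξ.symm (c 0) = z := by rw [hc0, ξ.left_inv hzξ]
  have d1 : HasDerivAt (fun s => ξ.symm (c s)) w 0 := by
    have e1 := (differentiableAt_of_smooth (φ := ξ.symm) hξ.contDiffOn_symm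
      (ξ.map_source hzξ)).hasFDerivAt
    rw [← hc0] at e1
    have := e1.comp_hasDerivAt 0 hc
    rwa [hc0, fderiv_symm_fderiv hξ.contDiffOn hξ.contDiffOn_symm hzξ] at this
  have d2 : HasDerivAt (fun s => φ (ξ.symm (c s))) (fderiv ℝ φ z w) 0 := by
    have e1 := ((hd.contDiffAt (φ.open_source.mem_nhds hz)).differentiableAt (by simp)).hasFDerivAt
    rw [← hg0] at e1
    have := e1.comp_hasDerivAt 0 d1
    rwa [hg0] at this
  have d3 : HasDerivAt (fun s => tailCoordL q (ξ' (φ (ξ.symm (c s)))))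
      (tailCoordL q (fderiv ℝ ξ' (φ z) (fderiv ℝ φ z w))) 0 := by
    have e1 := (differentiableAt_of_smooth hξ'.contDiffOn hzξ').hasFDerivAt
    rw [← hg0] at e1
    have := (tailCoordL q).hasFDerivAt.comp_hasDerivAt 0 (e1.comp_hasDerivAt 0 d2)
    rwa [hg0] at this
  have hO1 : IsOpen (c ⁻¹' ξ.target) := ξ.open_target.preimage hcc
  have hcont1 : ContinuousOn (fun s => ξ.symm (c s)) (c ⁻¹' ξ.target) :=
    ξ.continuousOn_symm.comp hcc.continuousOn fun s hs => hs
  have hO2 := hcont1.isOpen_inter_preimage hO1 φ.open_source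
  have hcont2 : ContinuousOn (fun s => φ (ξ.symm (c s)))
      (c ⁻¹' ξ.target ∩ (fun s => ξ.symm (c s)) ⁻¹' φ.source) :=
    φ.continuousOn.comp (hcont1.mono inter_subset_left) fun s hs => hs.2
  have hO3 := hcont2.isOpen_inter_preimage hO2 ξ'.open_source
  obtain ⟨r, hr, hball⟩ := Metric.isOpen_iff.1 hO3 0 ⟨⟨by
    rw [mem_preimage, hc0]; exact ξ.map_source hzξ, by rw [mem_preimage, hg0]; exact hz⟩, by
    rw [mem_preimage, hg0]; exact hzξ'⟩
  have hconst : (fun s => tailCoordL q (ξ' (φ (ξ.symm (c s))))) =ᶠ[𝓝 0]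
      fun _ => tailCoordL q (ξ' (φ (ξ.symm (c 0)))) := by
    filter_upwards [Metric.ball_mem_nhds 0 hr] with s hs
    refine hP'.tailCoord_eq_of_isPreconnected (convex_ball (0 : ℝ) r).isPreconnected
      (hcont2.mono fun s hs => (hball hs).1) (fun s hs => (hball hs).2) (fun s hs => ?_) hs
      (Metric.mem_ball_self hr)
    obtain ⟨⟨hs1, hs2⟩, -⟩ := hball hs
    rw [OrbitSpace.range_incl]
    refine orbit_trans ?_ (horb _ hs2)
    rw [← OrbitSpace.range_incl]
    refine hP.saturated z hzξ _ (ξ.map_target hs1) ?_ ?_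
    · rw [ξ.right_inv hs1, ← tailCoordL_apply, ← tailCoordL_apply, map_add, map_smul, hw, smul_zero,
        add_zero]
    · rw [OrbitSpace.range_incl]
      exact mem_orbit_self h.nonempty hzU
  exact d3.unique ((hasDerivAt_const _ _).congr_of_eventuallyEq hconst)

/-- The values of `X₀` belong to `P_𝓕` because a subspace is closed under limits, and the
differential of `φ` carries `P_𝓕` into itself. -/
theorem pushforwardSpan_eq (h : IsLimitFamily U 𝓕 𝓖) (x : Euc d) :
    pushforwardSpan U 𝓖 x = pushforwardSpan U 𝓕 x := by
  refine le_antisymm (Submodule.span_le.2 ?_) (pushforwardSpan_mono h.subset x)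
  rintro - ⟨D, Y, ⟨X₀, hX₀, N, hN, X, hX, t, φ, hφ, hU, hd, -, rfl, hY⟩, hx, rfl⟩
  have hz := φ.map_target hx
  have h1 : X₀ (φ.symm x) ∈ pushforwardSpan U 𝓕 (φ.symm x) :=
    mem_of_isUniformLimit (h.isUniformLimit _ hX₀) (hU hz)
      fun Y hY => mem_pushforwardSpan hY h.isOpen (hU hz)
  have h2 := h.fderiv_mem hX hφ hU hd hz h1
  rwa [← hY _ hz, φ.right_inv hx] at h2

/-- The adapted coordinates. -/
theorem isAdaptedChart (h : IsLimitFamily U 𝓕 𝓖) {m : Euc d} (hm : m ∈ U)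
    {ξ : OpenPartialHomeomorph (Euc d) (Euc d)} {η : ℝ}
    (hξ : IsFlowChart U 𝓕 (Module.finrank ℝ (pushforwardSpan U 𝓕 m)) ξ η)
    (hmξ : m ∈ ξ.source) (h0 : ξ m = 0) :
    IsAdaptedChart U 𝓖 m (h.isPlaqueManifold hm).toImmersedStructure ξ η := by
  have hM := h.isPlaqueManifold hm
  have hP := h.isPlaqueChart hm hξ
  have := h.secondCountableTopology hm
  have hmo : m ∈ orbit U 𝓖 m := mem_orbit_self (h.nonempty.mono h.subset) hm
  refine ⟨hξ.source_subset, hmξ, h0, hξ.pos, hξ.target_eq, hξ.contDiffOn, hξ.contDiffOn_symm,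
    ?_, ?_, ?_, ?_⟩
  · refine ⟨levels OrbitSpace.incl _ ξ, ?_, ⟨⟨m, hmo⟩, hmξ, ?_⟩, ?_, hP.isInducing hM⟩
    · rintro - ⟨p, hp, rfl⟩ i
      exact hP.map_mem_cube hp i.1
    · change tailCoordL _ (ξ m) = 0
      rw [h0, map_zero]
    · intro x hx
      rw [← OrbitSpace.range_incl]
      constructor
      · rintro ⟨p, rfl⟩
        exact ⟨p, hx, rfl⟩
      · rintro ⟨p, hp, hpx⟩
        exact hP.saturated _ hp _ hx hpx ⟨p, rfl⟩
  · intro D Y _ t₁ t₂ γ hγ hstay i hi s hs t ht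
    -- A curve in the orbit and the chart, being continuous, stays in one plaque.
    have := hP.tailCoord_eq_of_isPreconnected isPreconnected_Icc hγ.continuousOn
      (fun r hr => (hstay r hr).1)
      (fun r hr => OrbitSpace.range_incl.symm ▸ (hstay r hr).2) hs ht
    exact congrFun this ⟨i, hi⟩
  · intro p hp
    exact hP.tangent_eq hM.le _ rfl hp
  · intro x hx
    have hxU := hξ.source_subset hx
    refine ⟨(h.isPlaqueManifold hxU).toImmersedStructure,
      ⟨x, mem_orbit_self (h.nonempty.mono h.subset) hxU⟩, rfl, fun i hi => ?_⟩
    -- `P_𝓕(x)` contains the first `q` coordinate fields even where the orbit through `x` is of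
    -- larger dimension.
    have := hξ.coordField_mem x hx i hi
    exact (h.tangent_eq hxU ⟨x, mem_orbit_self (h.nonempty.mono h.subset) hxU⟩).symm ▸ this

theorem orbitTheoremHolds (h : IsLimitFamily U 𝓕 𝓖) {m : Euc d} (hm : m ∈ U) :
    OrbitTheoremHolds U 𝓖 m := by
  have hM := h.isPlaqueManifold hm
  have : Nonempty (OrbitSpace U 𝓖 m) := ⟨⟨m, mem_orbit_self (h.nonempty.mono h.subset) hm⟩⟩
  obtain ⟨ξ, η, hξ, hmξ, h0⟩ := exists_isFlowChart h.isOpen h.contDiffOn hm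
  refine ⟨hM.t2Space, h.secondCountableTopology hm, h.connectedSpace hm, hM.toImmersedStructure,
    fun S' => hM.same S', fun N hN X hX hXs => ?_, fun p => ?_, ξ, η,
    h.isAdaptedChart hm hξ hmξ h0⟩
  -- Smooth members of `𝓖` need not belong to `𝓕`. The finite family `range X` is itself a smooth
  -- family and provides a distribution preserved by these flows.
  · have hXa : ∀ j, IsFlowAdapted ∞ U (pushforwardSpan U (range X)) (X j) := fun j =>
      isFlowAdapted_pushforwardSpan h.isOpen (by rintro - ⟨j, rfl⟩; exact hXs j) ⟨j, rfl⟩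
    refine hM.smoothOn_of_comp (isOpen_concatDom hXa m) (continuous_concatMap hN X hX) fun t => ?_
    obtain ⟨V, G, hV, htV, hG, he, -⟩ := exists_concatMap_eq hN hX hXa t
    exact ⟨V, G, hV, htV, hG, he⟩
  · rw [h.tangent_eq hm, h.pushforwardSpan_eq]

end IsLimitFamily

end Comparison

/-! ### Application to the families of difference fields. -/

section Feedbacks

variable {d r : ℕ} {f : Euc d × Euc r → Euc d} {Ω : Set (Euc d × Euc r)}

theorem isLimitFamily_family'' (hf : ContDiff ℝ ∞ f) (hΩ : IsOpen Ω) (h : ∃ α, IsFeedback Ω α) :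
    IsLimitFamily (stateProj Ω) (smoothFamily f Ω) (family'' f Ω) where
  isOpen := isOpen_stateProj hΩ
  contDiffOn _ hX := contDiffOn_of_mem_smoothFamily hf hX
  nonempty := smoothFamily_nonempty hf.continuous hΩ h
  subset := smoothFamily_subset_family'' hf hΩ
  continuousOn _ hX := continuousOn_of_mem_family' hf.continuous hX.1
  isUniformLimit _ hX := isUniformLimit_of_mem_family' hf.continuous hΩ hX.1
  hasFlow _ hX := hX.2

lemma families_eq_empty (f : Euc d × Euc r → Euc d) (h : ¬ ∃ α, IsFeedback Ω α) :
    family'' f Ω = ∅ ∧ smoothFamily f Ω = ∅ := by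
  constructor
  · refine eq_empty_of_forall_notMem ?_
    rintro X ⟨⟨α₁, -, h₁, -⟩, -⟩
    exact h ⟨α₁, h₁⟩
  · refine eq_empty_of_forall_notMem ?_
    rintro X ⟨α₁, -, h₁, -⟩
    exact h ⟨α₁, h₁.1⟩

end Feedbacks

end FeedbackOrbit
end

theorem propositionB3 (d r : ℕ) (f : Euc d × Euc r → Euc d) (hf : ContDiff ℝ ∞ f)
    (Ω : Set (Euc d × Euc r)) (hΩ : IsOpen Ω) (m : Euc d) (hm : m ∈ stateProj Ω) :
    orbit (stateProj Ω) (family'' f Ω) m = orbit (stateProj Ω) (smoothFamily f Ω) m ∧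
    (∃ Φ : OrbitSpace (stateProj Ω) (family'' f Ω) m ≃ₜ
        OrbitSpace (stateProj Ω) (smoothFamily f Ω) m, ∀ p, (Φ p).incl = p.incl) ∧
    ((∃ α, IsFeedback Ω α) →
      OrbitTheoremHolds (stateProj Ω) (family'' f Ω) m ∧
      ∀ x ∈ orbit (stateProj Ω) (family'' f Ω) m,
        pushforwardSpan (stateProj Ω) (family'' f Ω) x =
          pushforwardSpan (stateProj Ω) (smoothFamily f Ω) x) := by
  by_cases h : ∃ α, IsFeedback Ω α
  · have hlim := isLimitFamily_family'' hf hΩ h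
    exact ⟨hlim.orbit_eq hm, ⟨hlim.homeomorph hm, hlim.incl_homeomorph hm⟩, fun _ =>
      ⟨hlim.orbitTheoremHolds hm, fun x _ => hlim.pushforwardSpan_eq x⟩⟩
  -- Without feedbacks the two families are the same empty set, and the last assertion is void.
  · obtain ⟨h₁, h₂⟩ := families_eq_empty f h
    rw [h₁, h₂]
    exact ⟨rfl, ⟨Homeomorph.refl _, fun _ => rfl⟩, fun h' => absurd h' h⟩
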